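/- Consider an oriented graph with finitely many vertices, $K\ge 1$ infinite leads $e_1,\dots,e_K$, each with one vertex, and $M$ finite edges $e_{K+1},\dots,e_{K+M}$, each with two distinct end vertices (multiple edges are allowed). Given edge lengths $\ell_m\in(0,\infty)$, $K+1\le m\le K+M$, and $\ell_k=\infty$ for $k\le K$, let $P$ be the unbounded operator on $L^2=\bigoplus_{m=1}^{K+M}L^2([0,\ell_m])$ given by $(Pu)_m=-u_m''$, with domain the set of all $u$ with $u_m\in H^2([0,\ell_m])$ which are continuous at every vertex, $u_m(v)=u_n(v)$ for $v\in e_m\cap e_n$, and satisfy $\sum_{e_m\ni v}\partial_\nu u_m(v)=0$ at every vertex $v$, where $\partial_\nu$ is the outward normal derivative ($\partial_\nu u_m(0)=-u_m'(0)$, $\partial_\nu u_m(\ell_m)=u_m'(\ell_m)$). Let $\mathrm{Res}(P)\subset\mathbb C$ be the set of poles of the meromorphic continuation of $\lambda\mapsto(P-\lambda^2)^{-1}$ from $\{\operatorname{Im}\lambda>0\}$ to $\mathbb C$ as a family of operators $L^2_{\mathrm{comp}}\to L^2_{\mathrm{loc}}$, and let $D(\lambda_0,r)=\{\lambda\in\mathbb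 C:|\lambda-\lambda_0|<r\}$. Let $\ell_m\in C^1(\mathbb R;\mathbb R)$ with $\ell_m(0)>0$ for all $K+1\le m\le K+M$, and let $P(t)$ be the operator $P$ on the graph with edge lengths $\ell_m(t)$, for those $t$ for which all of these are positive. Suppose that $\lambda_0>0$ and that $\lambda_0^2$ is an eigenvalue of $P(0)$. Then for every $\gamma<1$ there is $t_0>0$ such that, for $0<|t|\le t_0$, all the lengths $\ell_m(t)$ are positive and $$\mathrm{Res}(P(t))\cap D(\lambda_0,|t|^\gamma)\neq\emptyset .$$ -/

import Mathlib

open MeasureTheory Set Filter Topology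
open scoped ENNReal

noncomputable section

namespace QuantumGraph

/-- The combinatorial data of an oriented graph with vertices `V`, infinite leads `K` and finite
edges `M`.  A lead has one vertex (at `x = 0`); a finite edge `m` runs from `src m` (at `x = 0`) to
`tgt m` (at `x = ℓ m`) and is not a loop.  Multiple edges are allowed. -/
structure LeadGraph (V K M : Type*) where
  base : K → V
  src : M → V
  tgt : M → V
  src_ne_tgt : ∀ m, src m ≠ tgt m

/-- The segment parametrizing an edge: `[0, ∞)` for a lead and `[0, ℓ m]` for a finite edge. -/
def edgeSegment {K M : Type*} (ℓ : M → ℝ) : K ⊕ M → Set ℝ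
  | .inl _ => Ici 0
  | .inr m => Icc 0 (ℓ m)

/-- The Hilbert space `⨁ L²([0, ℓ_m])` (Hilbert direct sum over all edges). -/
abbrev L2 (K : Type*) {M : Type*} (ℓ : M → ℝ) :=
  PiLp 2 (fun e : K ⊕ M => Lp ℂ 2 (volume.restrict (edgeSegment (K := K) ℓ e)))

/-- `u ∈ H²(S)` with `u'' = g`, for an interval `S` with left end `0`: the class `u ∈ L²(S)` has the
`C¹` representative `U` on `S`, its derivative `V` is in `L²(S)` and is absolutely continuous, with
almost everywhere derivative `g ∈ L²(S)`. -/
structure IsH2 (S : Set ℝ) (u : Lp ℂ 2 (volume.restrict S)) (U V : ℝ → ℂ)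
    (g : Lp ℂ 2 (volume.restrict S)) : Prop where
  ae_eq : u =ᵐ[volume.restrict S] U
  hasDeriv : ∀ x ∈ S, HasDerivWithinAt U (V x) S x
  memLp : MemLp V 2 (volume.restrict S)
  eq_integral : ∀ x ∈ S, V x = V 0 + ∫ y in (0 : ℝ)..x, g y

theorem intervalIntegrable_of_Lp {S : Set ℝ} (g : Lp ℂ 2 (volume.restrict S)) {x : ℝ}
    (hx : uIoc 0 x ⊆ S) : IntervalIntegrable (fun y => g y) volume 0 x := by
  rw [intervalIntegrable_iff]
  have h := (Lp.memLp g).mono_measure (Measure.restrict_mono hx le_rfl)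
  have : IsFiniteMeasure (volume.restrict (uIoc (0 : ℝ) x)) := ⟨by simp [uIoc]⟩
  exact h.integrable (by norm_num)

theorem intervalIntegral_congr_of_ae {S : Set ℝ} {f g : ℝ → ℂ} (h : f =ᵐ[volume.restrict S] g)
    {x : ℝ} (hx : uIoc 0 x ⊆ S) : ∫ y in (0 : ℝ)..x, f y = ∫ y in (0 : ℝ)..x, g y := by
  have h' := ae_mono (Measure.restrict_mono hx le_rfl) h
  exact intervalIntegral.integral_congr_ae ((ae_restrict_iff' measurableSet_uIoc).1 h')

theorem uIoc_subset_edgeSegment {K M : Type*} (ℓ : M → ℝ) (e : K ⊕ M) {x : ℝ}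
    (hx : x ∈ edgeSegment ℓ e) : uIoc 0 x ⊆ edgeSegment ℓ e := by
  rcases e with k | m
  · intro y hy
    have hx : 0 ≤ x := hx
    rw [uIoc_of_le hx] at hy
    exact hy.1.le
  · intro y hy
    have hx : x ∈ Icc 0 (ℓ m) := hx
    rw [uIoc_of_le hx.1] at hy
    exact ⟨hy.1.le, hy.2.trans hx.2⟩

theorem IsH2.zero {S : Set ℝ} (hS : ∀ x ∈ S, uIoc 0 x ⊆ S) : IsH2 S 0 0 0 0 := by
  refine ⟨Lp.coeFn_zero _ _ _, fun x _ => hasDerivWithinAt_const x _ (0 : ℂ), MemLp.zero, ?_⟩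
  intro x hx
  rw [intervalIntegral_congr_of_ae (Lp.coeFn_zero ℂ 2 (volume.restrict S)) (hS x hx)]
  simp

theorem IsH2.add {S : Set ℝ} (hS : ∀ x ∈ S, uIoc 0 x ⊆ S) {u u' g g' : Lp ℂ 2 (volume.restrict S)}
    {U V U' V' : ℝ → ℂ} (h : IsH2 S u U V g) (h' : IsH2 S u' U' V' g') :
    IsH2 S (u + u') (U + U') (V + V') (g + g') := by
  refine ⟨(Lp.coeFn_add u u').trans (h.ae_eq.add h'.ae_eq),
    fun x hx => (h.hasDeriv x hx).add (h'.hasDeriv x hx), h.memLp.add h'.memLp, ?_⟩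
  intro x hx
  rw [intervalIntegral_congr_of_ae (Lp.coeFn_add g g') (hS x hx)]
  simp only [Pi.add_apply]
  rw [intervalIntegral.integral_add (intervalIntegrable_of_Lp g (hS x hx))
    (intervalIntegrable_of_Lp g' (hS x hx)), h.eq_integral x hx, h'.eq_integral x hx]
  ring

theorem IsH2.smul {S : Set ℝ} (hS : ∀ x ∈ S, uIoc 0 x ⊆ S) (c : ℂ)
    {u g : Lp ℂ 2 (volume.restrict S)} {U V : ℝ → ℂ} (h : IsH2 S u U V g) :
    IsH2 S (c • u) (c • U) (c • V) (c • g) := by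
  refine ⟨(Lp.coeFn_smul c u).trans (h.ae_eq.const_smul c),
    fun x hx => (h.hasDeriv x hx).const_smul c, h.memLp.const_smul c, ?_⟩
  intro x hx
  rw [intervalIntegral_congr_of_ae (Lp.coeFn_smul c g) (hS x hx)]
  simp only [Pi.smul_apply]
  rw [intervalIntegral.integral_smul, h.eq_integral x hx, smul_add]

theorem IsH2.ae_eq_zero {S : Set ℝ} {u g : Lp ℂ 2 (volume.restrict S)} {U V : ℝ → ℂ}
    (h : IsH2 S u U V g) (hu : u = 0) {b : ℝ} (hb : 0 < b) (hS : Icc 0 b ⊆ S) :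
    ∀ᵐ x, x ∈ Ioo 0 b → g x = 0 := by
  have hU : EqOn U 0 (Icc 0 b) := by
    refine Measure.eqOn_Icc_of_ae_eq volume hb.ne ?_
      (fun x hx => (h.hasDeriv x (hS hx)).continuousWithinAt.mono hS) continuousOn_const
    have h1 : U =ᵐ[volume.restrict S] 0 := by
      subst hu
      exact h.ae_eq.symm.trans (Lp.coeFn_zero _ _ _)
    exact ae_mono (Measure.restrict_mono hS le_rfl) h1
  have hV : ∀ x ∈ Icc 0 b, V x = 0 := by
    intro x hx
    have h1 := (h.hasDeriv x (hS hx)).mono hS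
    have h2 : HasDerivWithinAt U 0 (Icc 0 b) x :=
      (hasDerivWithinAt_const x (Icc 0 b) (0 : ℂ)).congr hU (hU hx)
    exact (uniqueDiffOn_Icc hb x hx).eq_deriv _ h1 h2
  have hg : ∀ x ∈ Icc 0 b, ∫ y in (0 : ℝ)..x, g y = 0 := by
    intro x hx
    have h1 := h.eq_integral x (hS hx)
    rw [hV x hx, hV 0 ⟨le_rfl, hb.le⟩, zero_add] at h1
    exact h1.symm
  have hint : IntervalIntegrable (fun y => g y) volume 0 b := by
    refine intervalIntegrable_of_Lp g ?_
    rw [uIoc_of_le hb.le]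
    exact Ioc_subset_Icc_self.trans hS
  filter_upwards [hint.ae_hasDerivAt_integral] with x hx hx0
  rw [uIcc_of_le hb.le] at hx
  have h1 := hx ⟨hx0.1.le, hx0.2.le⟩ 0 ⟨le_rfl, hb.le⟩
  have h2 : HasDerivAt (fun x => ∫ y in (0 : ℝ)..x, g y) 0 x := by
    refine (hasDerivAt_const x (0 : ℂ)).congr_of_eventuallyEq ?_
    filter_upwards [Ioo_mem_nhds hx0.1 hx0.2] with y hy
    exact hg y ⟨hy.1.le, hy.2.le⟩
  exact h1.unique h2

/-- The second derivative of an `H²` function on an edge is determined by the function. -/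
theorem IsH2.eq_zero {K M : Type*} (ℓ : M → ℝ) (e : K ⊕ M)
    {u g : Lp ℂ 2 (volume.restrict (edgeSegment ℓ e))} {U V : ℝ → ℂ}
    (h : IsH2 (edgeSegment ℓ e) u U V g) (hu : u = 0) : g = 0 := by
  suffices hg : ∀ᵐ x, x ∈ edgeSegment ℓ e → g x = 0 by
    refine Lp.ext ?_
    have hm : MeasurableSet (edgeSegment ℓ e) := by
      cases e
      · exact measurableSet_Ici
      · exact measurableSet_Icc
    have h1 : g =ᵐ[volume.restrict (edgeSegment ℓ e)] 0 := (ae_restrict_iff' hm).2 hg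
    exact h1.trans (Lp.coeFn_zero _ _ _).symm
  have h0 : ∀ᵐ x : ℝ, x ≠ 0 := by simp [ae_iff]
  rcases e with k | m
  · have h1 : ∀ n : ℕ, ∀ᵐ x, x ∈ Ioo (0 : ℝ) (n + 1) → g x = 0 := fun n =>
      h.ae_eq_zero hu (by positivity) (fun x hx => hx.1)
    filter_upwards [ae_all_iff.2 h1, h0] with x hx hx0 hxS
    obtain ⟨n, hn⟩ := exists_nat_gt x
    exact hx n ⟨lt_of_le_of_ne hxS (Ne.symm hx0), by linarith⟩
  · have hl : ∀ᵐ x : ℝ, x ≠ ℓ m := by simp [ae_iff]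
    by_cases hm : 0 < ℓ m
    · filter_upwards [h.ae_eq_zero hu hm subset_rfl, h0, hl] with x hx hx0 hxl hxS
      have hxS : x ∈ Icc 0 (ℓ m) := hxS
      exact hx ⟨lt_of_le_of_ne hxS.1 (Ne.symm hx0), lt_of_le_of_ne hxS.2 hxl⟩
    · filter_upwards [h0] with x hx0 hxS
      have hxS : x ∈ Icc 0 (ℓ m) := hxS
      exact absurd (le_antisymm (hxS.2.trans (not_lt.1 hm)) hxS.1) hx0

section Laplacian

variable {V K M : Type*} [Fintype K] [Fintype M]

open Classical in
/-- The sum over all edge ends at the vertex `v` of the outward normal derivatives of a function on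
the graph with edgewise derivatives `D e`: `-D e 0` at an end `x = 0`, `D e (ℓ m)` at an end
`x = ℓ m`. -/
def normalSum (G : LeadGraph V K M) (ℓ : M → ℝ) (D : K ⊕ M → ℝ → ℂ) (v : V) : ℂ :=
  (∑ k, if G.base k = v then -D (.inl k) 0 else 0) +
    (∑ m, if G.src m = v then -D (.inr m) 0 else 0) +
    ∑ m, if G.tgt m = v then D (.inr m) (ℓ m) else 0

/-- `u` belongs to the domain of the graph Hamiltonian and `f = -u''`: on every edge `u` is in `H²`
with `u'' = -f`, the edgewise functions agree at every vertex (with common value `val v`), and the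
outward normal derivatives at every vertex sum to zero. -/
def IsNegLaplacian (G : LeadGraph V K M) (ℓ : M → ℝ) (u f : L2 K ℓ) : Prop :=
  ∃ U D : K ⊕ M → ℝ → ℂ,
    (∀ e, IsH2 (edgeSegment ℓ e) (u e) (U e) (D e) (-f e)) ∧
    (∃ val : V → ℂ, (∀ k, U (.inl k) 0 = val (G.base k)) ∧
      (∀ m, U (.inr m) 0 = val (G.src m)) ∧ ∀ m, U (.inr m) (ℓ m) = val (G.tgt m)) ∧
    ∀ v, normalSum G ℓ D v = 0

/-- The graph of the Hamiltonian, as a subspace of `L² × L²`. -/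
def hamiltonianGraph (G : LeadGraph V K M) (ℓ : M → ℝ) : Submodule ℂ (L2 K ℓ × L2 K ℓ) where
  carrier := {p | IsNegLaplacian G ℓ p.1 p.2}
  zero_mem' := by
    refine ⟨0, 0, fun e => ?_, ⟨0, by simp, by simp, by simp⟩, by simp [normalSum]⟩
    simpa using IsH2.zero (fun x hx => uIoc_subset_edgeSegment ℓ e hx)
  add_mem' := by
    rintro p q ⟨U, D, h, ⟨w, h1, h2, h3⟩, h4⟩ ⟨U', D', h', ⟨w', h1', h2', h3'⟩, h4'⟩
    refine ⟨U + U', D + D', fun e => ?_, ⟨w + w', by simp [h1, h1'], by simp [h2, h2'],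
      by simp [h3, h3']⟩, fun v => ?_⟩
    · have := (h e).add (fun x hx => uIoc_subset_edgeSegment ℓ e hx) (h' e)
      rwa [← neg_add] at this
    · have := congrArg₂ (· + ·) (h4 v) (h4' v)
      rw [add_zero] at this
      rw [← this]
      simp only [normalSum, Pi.add_apply]
      rw [add_add_add_comm, add_add_add_comm (Finset.sum _ _)]
      simp only [← Finset.sum_add_distrib]
      congr 1
      · congr 1
        all_goals
          refine Finset.sum_congr rfl fun _ _ => ?_
          split_ifs
          · ring
          · ring
      · refine Finset.sum_congr rfl fun _ _ => ?_
        split_ifs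
        · ring
        · ring
  smul_mem' := by
    rintro c p ⟨U, D, h, ⟨w, h1, h2, h3⟩, h4⟩
    refine ⟨c • U, c • D, fun e => ?_, ⟨c • w, by simp [h1], by simp [h2], by simp [h3]⟩,
      fun v => ?_⟩
    · have := (h e).smul (fun x hx => uIoc_subset_edgeSegment ℓ e hx) c
      rwa [smul_neg] at this
    · have := congrArg (c * ·) (h4 v)
      simp only [mul_zero] at this
      rw [← this]
      simp only [normalSum, Pi.smul_apply, smul_eq_mul, mul_add, Finset.mul_sum, mul_ite, mul_neg,
        mul_zero]

/-- The quantum graph Hamiltonian `P`, an unbounded operator on `L²`: `(P u)_m = -u_m''`. -/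
def hamiltonian (G : LeadGraph V K M) (ℓ : M → ℝ) : L2 K ℓ →ₗ.[ℂ] L2 K ℓ :=
  (hamiltonianGraph G ℓ).toLinearPMap

theorem mem_graph_hamiltonian (G : LeadGraph V K M) (ℓ : M → ℝ) (u f : L2 K ℓ) :
    (u, f) ∈ (hamiltonian G ℓ).graph ↔ IsNegLaplacian G ℓ u f := by
  rw [hamiltonian, Submodule.toLinearPMap_graph_eq]
  · rfl
  · rintro ⟨u, f⟩ ⟨U, D, h, -⟩ (rfl : u = 0)
    ext1 e
    simpa using (h e).eq_zero ℓ e rfl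

end Laplacian

section Resonances

/-- `z` is an eigenvalue of the unbounded operator `P`. -/
def IsEigenvalue {H : Type*} [AddCommGroup H] [Module ℂ H] (P : H →ₗ.[ℂ] H) (z : ℂ) : Prop :=
  ∃ u : P.domain, (u : H) ≠ 0 ∧ P u = z • (u : H)

/-- The bounded operator `T` is the resolvent `(P - z)⁻¹`. -/
def IsResolvent {H : Type*} [NormedAddCommGroup H] [NormedSpace ℂ H] (P : H →ₗ.[ℂ] H) (z : ℂ)
    (T : H →L[ℂ] H) : Prop :=
  (∀ f : H, ∃ h : T f ∈ P.domain, P ⟨T f, h⟩ - z • T f = f) ∧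
    ∀ u : P.domain, T (P u - z • (u : H)) = u

/-- The part of an edge at distance at most `r` from the finite part: `[0, r]` on a lead, the whole
segment for a finite edge. -/
def truncatedSegment {K M : Type*} (ℓ : M → ℝ) (r : ℝ) : K ⊕ M → Set ℝ
  | .inl _ => Icc 0 r
  | .inr m => Icc 0 (ℓ m)

theorem measurableSet_truncatedSegment {K M : Type*} (ℓ : M → ℝ) (r : ℝ) (e : K ⊕ M) :
    MeasurableSet (truncatedSegment ℓ r e) := by
  cases e <;> exact measurableSet_Icc

/-- The product of the indicator function of `A` with an element of `L²(μ)`. -/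
def indicatorLp (μ : Measure ℝ) {A : Set ℝ} (hA : MeasurableSet A) (f : Lp ℂ 2 μ) : Lp ℂ 2 μ :=
  MemLp.toLp (A.indicator f) ((Lp.memLp f).indicator hA)

theorem coeFn_indicatorLp (μ : Measure ℝ) {A : Set ℝ} (hA : MeasurableSet A) (f : Lp ℂ 2 μ) :
    indicatorLp μ hA f =ᵐ[μ] A.indicator f := by
  unfold indicatorLp
  exact MemLp.coeFn_toLp _

/-- Multiplication by the indicator function of `A`, as a bounded operator on `L²(μ)`. -/
def indicatorCLM (μ : Measure ℝ) {A : Set ℝ} (hA : MeasurableSet A) : Lp ℂ 2 μ →L[ℂ] Lp ℂ 2 μ :=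
  LinearMap.mkContinuous
    { toFun := indicatorLp μ hA
      map_add' := fun f g => by
        refine Lp.ext ?_
        filter_upwards [coeFn_indicatorLp μ hA (f + g), coeFn_indicatorLp μ hA f,
          coeFn_indicatorLp μ hA g, Lp.coeFn_add f g,
          Lp.coeFn_add (indicatorLp μ hA f) (indicatorLp μ hA g)] with x h1 h2 h3 h4 h5
        rw [h1, h5, Pi.add_apply, h2, h3]
        by_cases hx : x ∈ A
        · simp only [indicator_of_mem hx, h4, Pi.add_apply]
        · simp only [indicator_of_notMem hx, add_zero]
      map_smul' := fun c f => by
        refine Lp.ext ?_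
        filter_upwards [coeFn_indicatorLp μ hA (c • f), coeFn_indicatorLp μ hA f,
          Lp.coeFn_smul c f, Lp.coeFn_smul c (indicatorLp μ hA f)] with x h1 h2 h3 h4
        rw [RingHom.id_apply, h1, h4, Pi.smul_apply, h2]
        by_cases hx : x ∈ A
        · simp only [indicator_of_mem hx, h3, Pi.smul_apply]
        · simp only [indicator_of_notMem hx, smul_zero] }
    1 fun f => by
      rw [one_mul]
      refine Lp.norm_le_norm_of_ae_le ?_
      filter_upwards [coeFn_indicatorLp μ hA f] with x hx
      refine (congrArg norm hx).trans_le ?_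
      by_cases hxA : x ∈ A
      · rw [indicator_of_mem hxA]
      · rw [indicator_of_notMem hxA, norm_zero]
        exact norm_nonneg _

variable {V K M : Type*} [Fintype K] [Fintype M]

/-- The truncation `1_{x ≤ r}` on `L²`: multiplication by the indicator function of `[0, r]` on the
leads and by `1` on the finite edges. -/
def truncation (ℓ : M → ℝ) (r : ℝ) : L2 K ℓ →L[ℂ] L2 K ℓ :=
  (PiLp.continuousLinearEquiv 2 ℂ _).symm.toContinuousLinearMap ∘L
    ContinuousLinearMap.pi fun e =>
      indicatorCLM (volume.restrict (edgeSegment (K := K) ℓ e)) (measurableSet_truncatedSegment ℓ r e) ∘L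
        PiLp.proj 2 _ e

/-- `R` is the meromorphic continuation to `ℂ`, as a family of operators `L²_comp → L²_loc`, of the
resolvent `R(λ) = (P - λ²)⁻¹`, `Im λ > 0`.  The family is recorded through its truncations
`R r λ = 1_{x ≤ r} R(λ) 1_{x ≤ r}`, which are bounded operators on `L²`. -/
def IsResolventContinuation (G : LeadGraph V K M) (ℓ : M → ℝ)
    (R : ℝ → ℂ → (L2 K ℓ →L[ℂ] L2 K ℓ)) : Prop :=
  ∀ r : ℝ, 0 < r →
    MeromorphicOn (R r) univ ∧
    ∀ μ : ℂ, 0 < μ.im → ∃ T : L2 K ℓ →L[ℂ] L2 K ℓ, IsResolvent (hamiltonian G ℓ) (μ ^ 2) T ∧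
      R r μ = truncation ℓ r ∘L T ∘L truncation ℓ r

/-- The set of resonances: the poles of the meromorphic continuation of `λ ↦ (P - λ²)⁻¹` from
`Im λ > 0` to `ℂ` as a family of operators `L²_comp → L²_loc`. -/
def resonances (G : LeadGraph V K M) (ℓ : M → ℝ) : Set ℂ :=
  {z | ∃ R, IsResolventContinuation G ℓ R ∧ ∃ r : ℝ, 0 < r ∧ meromorphicOrderAt (R r) z < 0}

end Resonances

end QuantumGraph

end

/-! On every edge a solution of -u'' = z²u is a superposition of waves, described by the amplitude
`a d` leaving each edge end `d`. The amplitude arriving at `d` is exp(izℓ) times the one leaving the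
opposite end, and zero on a lead (`propagate`). Continuity and the Kirchhoff condition say together
that a = U b, where b is the incoming amplitude and U is a unitary involution (`scatter`). So for z
≠ 0 outgoing solutions correspond to null vectors of the secular matrix 1 - U K(z), and the theorem
reduces to following a zero of its determinant.

An eigenfunction at λ₀² gives a null vector at λ₀ (`exists_secular_eq_zero_of_eigenfunction`). At a
real point x the degeneracy is exactly of first order, that is, ‖(1 - U K(z))a‖ ≥ c|z - x|‖a‖ near x
(`exists_secular_lower_bound`). By unitarity, pairing with a null vector v leaves only the factors 1
- exp(i(z - x)ℓ), whose first-order term gives -i∑ℓ|v|² ≠ 0. Changing the lengths perturbs the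
matrix by O(|t|) (`exists_secular_lipschitz`).

If the perturbed matrix A(z, t) were invertible on a disc of radius comparable to |t|^g, with γ < g
< 1, its inverse would be O(|t|^(-g)) on the boundary circle. The maximum principle would carry this
bound to the centre, where A(λ₀, t)v = O(|t|)‖v‖ for the unperturbed null vector v, which is
impossible for small t (`exists_singular_near`). This argument needs neither multiplicities nor a
determinant expansion.

A nonzero zero z must then be shown to be a pole. The resolvent is written explicitly as the free
Green operators of the edges plus waves whose amplitudes solve the secular system. Its truncations
are meromorphic on ℂ, since the kernels are entire and the amplitudes are given by Cramer's rule
(`isResolventContinuation_resolventFamily`). A null vector at z gives for each μ in the upper half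
plane a u in the domain with (P - μ²)u = (z - μ)q(μ). Here q(μ) is compactly supported and
polynomial in μ, and u restricted to the finite edges is a nonzero function independent of μ
(`exists_quasimode`). Applying the resolvent and continuing in μ to z excludes regularity there
(`meromorphicOrderAt_neg_of_quasimode`, `mem_resonances`). -/

noncomputable section

namespace QuantumGraph

/-! ### Perturbation of singular points of analytic matrix families. -/

section Secular

/-- If an analytic matrix family `A · 0` degenerates at `z₀` exactly to first order, then the
perturbed families `A · t` are singular somewhere within distance `o(|t|^γ)` of `z₀`, `γ < 1`. -/
theorem exists_singular_near {D : Type*} [Fintype D] [DecidableEq D]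
    {A : ℂ → ℝ → Matrix D D ℂ} {z₀ : ℂ} {C c ε η : ℝ} (hη : 0 < η) (hC : 0 < C) (hc : 0 < c)
    (hε : 0 < ε) (hA : ∀ t i j, Differentiable ℂ fun z => A z t i j)
    (hlip : ∀ᶠ t in 𝓝 (0 : ℝ), ∀ z ∈ Metric.closedBall z₀ ε, ∀ v : D → ℂ,
      ‖(A z t).mulVec v - (A z 0).mulVec v‖ ≤ C * |t| * ‖v‖)
    (hlow : ∀ z ∈ Metric.closedBall z₀ ε, ∀ v : D → ℂ,
      c * ‖z - z₀‖ * ‖v‖ ≤ ‖(A z 0).mulVec v‖)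
    (hker : ∃ v : D → ℂ, v ≠ 0 ∧ (A z₀ 0).mulVec v = 0) {γ : ℝ} (hγ : γ < 1) :
    ∀ᶠ t in 𝓝[≠] (0 : ℝ), ∃ z : ℂ, ‖z - z₀‖ < |t| ^ γ ∧ ‖z - z₀‖ < η ∧
      ∃ v : D → ℂ, v ≠ 0 ∧ (A z t).mulVec v = 0 := by
  -- The working radius is |t|^g: smaller than |t|^γ, yet much larger than |t|. Since γ may be
  -- negative, g > 0 is imposed separately so that the radius tends to 0.
  obtain ⟨g, hg1, hg2⟩ : ∃ g : ℝ, max γ 0 < g ∧ g < 1 := exists_between (max_lt hγ one_pos)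
  have hgγ : γ < g := (le_max_left _ _).trans_lt hg1
  have hg0 : 0 < g := (le_max_right _ _).trans_lt hg1
  have habs : Tendsto (fun t : ℝ => |t|) (𝓝[≠] 0) (𝓝 0) := by
    have : Tendsto (fun t : ℝ => |t|) (𝓝 0) (𝓝 |0|) := continuous_abs.tendsto 0
    rw [abs_zero] at this
    exact this.mono_left nhdsWithin_le_nhds
  have hpow : ∀ {s : ℝ}, 0 < s → Tendsto (fun t : ℝ => |t| ^ s) (𝓝[≠] 0) (𝓝 0) := by
    intro s hs
    have := habs.rpow_const (p := s) (Or.inr hs.le)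
    rwa [Real.zero_rpow hs.ne'] at this
  filter_upwards [hlip.filter_mono nhdsWithin_le_nhds, self_mem_nhdsWithin,
    habs.eventually (gt_mem_nhds one_pos),
    (hpow hg0).eventually (gt_mem_nhds (lt_min hε hη)),
    (hpow (sub_pos.2 hg2)).eventually (gt_mem_nhds (show 0 < c / (8 * C) by positivity))]
    with t hlip ht0 ht1 hρε hsmall
  have ht : 0 < |t| := abs_pos.2 ht0
  set ρ : ℝ := |t| ^ g with hρ
  have hρ0 : 0 < ρ := Real.rpow_pos_of_pos ht _
  -- The perturbation C|t| is below cρ/8. It is thereby absorbed into the lower bound cρ/2 on the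
  -- circle of radius ρ/2, and the final comparison at the centre still fails.
  have htρ : 8 * C * |t| < c * ρ := by
    have h1 : |t| ^ (1 - g) * ρ = |t| := by
      rw [hρ, ← Real.rpow_add ht]
      simp
    rw [lt_div_iff₀ (by positivity)] at hsmall
    calc 8 * C * |t| = (|t| ^ (1 - g) * (8 * C)) * ρ := by linear_combination (-8 * C) * h1
      _ < c * ρ := by gcongr
  have hργ : ρ < |t| ^ γ := Real.rpow_lt_rpow_of_exponent_gt ht ht1 hgγ
  by_contra hcon
  push Not at hcon
  have hball : ∀ z ∈ Metric.closedBall z₀ (ρ / 2), IsUnit (A z t).det := by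
    intro z hz
    rw [Metric.mem_closedBall, dist_eq_norm] at hz
    have hz' : ‖z - z₀‖ < ρ := by linarith
    rw [isUnit_iff_ne_zero]
    intro h0
    obtain ⟨v, hv, hv0⟩ := Matrix.exists_mulVec_eq_zero_iff.2 h0
    exact hcon z (hz'.trans hργ) (hz'.trans (hρε.trans_le (min_le_right _ _))) v hv hv0
  have hsub : ∀ z ∈ Metric.closedBall z₀ (ρ / 2), z ∈ Metric.closedBall z₀ ε := fun z hz =>
    Metric.closedBall_subset_closedBall (by linarith [hρε.trans_le (min_le_left _ _)]) hz
  obtain ⟨v, hv, hv0⟩ := hker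
  set w := (A z₀ t).mulVec v with hw
  have hwn : ‖w‖ ≤ C * |t| * ‖v‖ := by
    simpa [hv0] using hlip z₀ (Metric.mem_closedBall_self hε.le) v
  -- This function is holomorphic on the disc by Cramer's rule. It equals `v` at the centre,
  -- although `w` is only of size O(|t|).
  set f : ℂ → D → ℂ := fun z => ((A z t)⁻¹).mulVec w with hf
  have hdet : ∀ (B : ℂ → Matrix D D ℂ), (∀ i j, Differentiable ℂ fun z => B z i j) →
      Differentiable ℂ fun z => (B z).det := by
    intro B hB
    simp only [Matrix.det_apply]
    fun_prop
  have hfd : ∀ z ∈ Metric.closedBall z₀ (ρ / 2), DifferentiableAt ℂ f z := by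
    intro z hz
    rw [differentiableAt_pi]
    intro i
    have h1 : (fun z => f z i) = fun z => ((A z t).det)⁻¹ * ((A z t).adjugate.mulVec w) i := by
      funext z
      simp [hf, Matrix.inv_def, Matrix.smul_mulVec]
    rw [h1]
    refine DifferentiableAt.mul ((hdet _ (hA t)).differentiableAt.inv (hball z hz).ne_zero) ?_
    simp only [Matrix.mulVec, dotProduct, Matrix.adjugate_apply]
    refine DifferentiableAt.fun_sum fun j _ => DifferentiableAt.mul_const ?_ _
    refine (hdet _ fun a b => ?_).differentiableAt
    by_cases hab : a = j
    · subst hab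
      simp
    · simpa [Matrix.updateRow_ne hab] using hA t a b
  have hinv : ∀ z ∈ Metric.closedBall z₀ (ρ / 2), (A z t).mulVec (f z) = w := by
    intro z hz
    simp only [hf, Matrix.mulVec_mulVec, Matrix.mul_nonsing_inv _ (hball z hz), Matrix.one_mulVec]
  have hmem : ∀ z ∈ Metric.sphere z₀ (ρ / 2), ‖f z‖ ≤ 4 * ‖w‖ / (c * ρ) := by
    intro z hz
    have hz1 := Metric.sphere_subset_closedBall hz
    have h1 := hlow z (hsub z hz1) (f z)
    have h2 := hlip z (hsub z hz1) (f z)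
    rw [hinv z hz1] at h2
    rw [mem_sphere_iff_norm.1 hz] at h1
    have h3 : ‖(A z 0).mulVec (f z)‖ ≤ ‖w‖ + C * |t| * ‖f z‖ := by
      have := norm_sub_norm_le ((A z 0).mulVec (f z)) w
      rw [norm_sub_rev] at h2
      linarith
    have h4 := mul_le_mul_of_nonneg_right htρ.le (norm_nonneg (f z))
    rw [le_div_iff₀ (by positivity)]
    linarith [norm_nonneg w]
  -- The maximum principle carries the bound from the circle to the centre, where the lower bound on
  -- `A · 0` is void.
  have hmax : ‖f z₀‖ ≤ 4 * ‖w‖ / (c * ρ) := by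
    refine Complex.norm_le_of_forall_mem_frontier_norm_le (U := Metric.ball z₀ (ρ / 2))
      Metric.isBounded_ball ?_ ?_ (subset_closure (Metric.mem_ball_self (by positivity)))
    · refine DifferentiableOn.diffContOnCl fun z hz => ?_
      rw [closure_ball _ (by positivity)] at hz
      exact (hfd z hz).differentiableWithinAt
    · rw [frontier_ball _ (by positivity)]
      exact hmem
  have hfv : f z₀ = v := by
    simp only [hf, hw, Matrix.mulVec_mulVec,
      Matrix.nonsing_inv_mul _ (hball z₀ (Metric.mem_closedBall_self (by positivity))),
      Matrix.one_mulVec]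
  rw [hfv, le_div_iff₀ (by positivity)] at hmax
  have hvp : 0 < ‖v‖ := norm_pos_iff.2 hv
  linarith [mul_lt_mul_of_pos_right htρ hvp, mul_pos (mul_pos hC ht) hvp]

/-! ### Edge ends, Kirchhoff scattering and the secular matrix. -/

variable {V K M : Type*}

/-- The ends of the edges: a lead has one, a finite edge `m` has the end `inr (inl m)` at `src m`
and the end `inr (inr m)` at `tgt m`. -/
abbrev EdgeEnd (K M : Type*) := K ⊕ (M ⊕ M)

/-- The vertex at an edge end. -/
def LeadGraph.endVertex (G : LeadGraph V K M) : EdgeEnd K M → V :=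
  Sum.elim G.base (Sum.elim G.src G.tgt)

/-- The other end of the same edge (the same end for a lead). -/
def oppositeEnd : EdgeEnd K M → EdgeEnd K M
  | .inl k => .inl k
  | .inr (.inl m) => .inr (.inr m)
  | .inr (.inr m) => .inr (.inl m)

@[simp]
theorem oppositeEnd_oppositeEnd (d : EdgeEnd K M) : oppositeEnd (oppositeEnd d) = d := by
  rcases d with k | m | m <;> rfl

/-- The involution `oppositeEnd` as a permutation. -/
def oppositeEquiv : Equiv.Perm (EdgeEnd K M) :=
  Function.Involutive.toPerm oppositeEnd oppositeEnd_oppositeEnd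

/-- The factor `exp(i z ℓ)` picked up by a wave crossing an edge; nothing comes back from a lead. -/
def transit (ℓ : M → ℝ) (z : ℂ) : EdgeEnd K M → ℂ
  | .inl _ => 0
  | .inr (.inl m) => Complex.exp (Complex.I * z * ℓ m)
  | .inr (.inr m) => Complex.exp (Complex.I * z * ℓ m)

@[simp]
theorem transit_oppositeEnd (ℓ : M → ℝ) (z : ℂ) (d : EdgeEnd K M) :
    transit ℓ z (oppositeEnd d) = transit ℓ z d := by
  rcases d with k | m | m <;> rfl

/-- Incoming amplitudes at the edge ends produced by outgoing amplitudes. -/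
def propagate (ℓ : M → ℝ) (z : ℂ) : (EdgeEnd K M → ℂ) →ₗ[ℂ] (EdgeEnd K M → ℂ) where
  toFun a d := transit ℓ z d * a (oppositeEnd d)
  map_add' a b := by
    funext d
    simp [mul_add]
  map_smul' c a := by
    funext d
    simp [mul_left_comm]

theorem propagate_apply (ℓ : M → ℝ) (z : ℂ) (a : EdgeEnd K M → ℂ) (d : EdgeEnd K M) :
    propagate ℓ z a d = transit ℓ z d * a (oppositeEnd d) := rfl

theorem norm_transit_le_one {ℓ : M → ℝ} (hℓ : ∀ m, 0 < ℓ m) {z : ℂ} (hz : 0 ≤ z.im)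
    (d : EdgeEnd K M) : ‖transit ℓ z d‖ ≤ 1 := by
  rcases d with k | m | m
  · simp [transit]
  all_goals
    simp only [transit, Complex.norm_exp]
    rw [Real.exp_le_one_iff]
    simp
    nlinarith [hℓ m]

theorem norm_transit_lt_one {ℓ : M → ℝ} (hℓ : ∀ m, 0 < ℓ m) {z : ℂ} (hz : 0 < z.im)
    (d : EdgeEnd K M) : ‖transit ℓ z d‖ < 1 := by
  rcases d with k | m | m
  · simp [transit]
  all_goals
    simp only [transit, Complex.norm_exp]
    rw [Real.exp_lt_one_iff]
    simp
    nlinarith [hℓ m]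

theorem differentiable_transit (ℓ : M → ℝ) (d : EdgeEnd K M) :
    Differentiable ℂ fun z => transit ℓ z d := by
  rcases d with k | m | m
  · exact differentiable_const _
  all_goals
    simp only [transit]
    fun_prop

/-- A difference quotient of exp(i(z - x)ℓ) at z = x. Through it the edge lengths become the weights
of the quadratic form that makes real zeros nondegenerate. -/
theorem tendsto_one_sub_transit_div (ℓ : M → ℝ) (d : M ⊕ M) {x : ℂ} :
    Tendsto (fun z : ℂ => (z - x)⁻¹ * (1 - transit ℓ (z - x) (.inr d : EdgeEnd K M))) (𝓝[≠] x)
      (𝓝 (-Complex.I * ℓ (d.elim id id))) := by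
  have h1 : transit ℓ 0 (.inr d : EdgeEnd K M) = 1 := by
    rcases d with m | m
    · simp [transit]
    · simp [transit]
  have h2 : HasDerivAt (fun z : ℂ => -transit ℓ (z - x) (.inr d : EdgeEnd K M))
      (-Complex.I * ℓ (d.elim id id)) x := by
    have h3 : ∀ m, HasDerivAt (fun z : ℂ => -Complex.exp (Complex.I * (z - x) * ℓ m))
        (-Complex.I * ℓ m) x := by
      intro m
      have h4 : HasDerivAt (fun z : ℂ => Complex.I * (z - x) * ℓ m) (Complex.I * 1 * ℓ m) x :=
        (((hasDerivAt_id x).sub_const x).const_mul Complex.I).mul_const _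
      convert! h4.cexp.neg using 1
      simp
    rcases d with m | m
    · exact h3 m
    · exact h3 m
  refine (hasDerivAt_iff_tendsto_slope.1 h2).congr fun z => ?_
  simp only [slope, vsub_eq_sub, smul_eq_mul, sub_self, h1]
  ring

variable [Fintype K] [Fintype M]

open Classical in
/-- The sum of a family over all edge ends at a vertex. -/
def LeadGraph.sumAt (G : LeadGraph V K M) (v : V) : (EdgeEnd K M → ℂ) →ₗ[ℂ] ℂ where
  toFun b := ∑ d, if G.endVertex d = v then b d else 0
  map_add' a b := by
    rw [← Finset.sum_add_distrib]
    refine Finset.sum_congr rfl fun d _ => ?_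
    split_ifs
    · rfl
    · simp
  map_smul' c a := by
    rw [RingHom.id_apply, smul_eq_mul, Finset.mul_sum]
    refine Finset.sum_congr rfl fun d _ => ?_
    split_ifs
    · rfl
    · simp

open Classical in
theorem LeadGraph.sumAt_apply (G : LeadGraph V K M) (v : V) (b : EdgeEnd K M → ℂ) :
    G.sumAt v b = ∑ d, if G.endVertex d = v then b d else 0 := rfl

/-- The Kirchhoff scattering map, from incoming to outgoing amplitudes. -/
def LeadGraph.scatter (G : LeadGraph V K M) : (EdgeEnd K M → ℂ) →ₗ[ℂ] (EdgeEnd K M → ℂ) where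
  toFun b d := 2 / G.sumAt (G.endVertex d) 1 * G.sumAt (G.endVertex d) b - b d
  map_add' a b := by
    funext d
    simp only [map_add, Pi.add_apply]
    ring
  map_smul' c a := by
    funext d
    simp only [map_smul, Pi.smul_apply, RingHom.id_apply, smul_eq_mul]
    ring

theorem LeadGraph.scatter_apply (G : LeadGraph V K M) (b : EdgeEnd K M → ℂ) (d : EdgeEnd K M) :
    G.scatter b d = 2 / G.sumAt (G.endVertex d) 1 * G.sumAt (G.endVertex d) b - b d := rfl

-- This sum is the degree of the vertex, positive because `d` itself ends there. It makes the
-- division in `scatter` legitimate.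
open Classical in
theorem LeadGraph.sumAt_endVertex_one_ne_zero (G : LeadGraph V K M) (d : EdgeEnd K M) :
    G.sumAt (G.endVertex d) 1 ≠ 0 := by
  rw [sumAt_apply]
  simp only [Pi.one_apply, Finset.sum_boole]
  rw [Nat.cast_ne_zero]
  exact Finset.card_ne_zero_of_mem (Finset.mem_filter.2 ⟨Finset.mem_univ d, rfl⟩)

theorem LeadGraph.sumAt_congr (G : LeadGraph V K M) {v : V} {a b : EdgeEnd K M → ℂ}
    (h : ∀ d, G.endVertex d = v → a d = b d) : G.sumAt v a = G.sumAt v b := by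
  classical
  simp only [sumAt_apply]
  refine Finset.sum_congr rfl fun d _ => ?_
  split_ifs with hd
  · exact h d hd
  · rfl

theorem LeadGraph.sumAt_scatter (G : LeadGraph V K M) (b : EdgeEnd K M → ℂ) (d : EdgeEnd K M) :
    G.sumAt (G.endVertex d) (G.scatter b) = G.sumAt (G.endVertex d) b := by
  have h : G.sumAt (G.endVertex d) (G.scatter b) = G.sumAt (G.endVertex d)
      ((2 / G.sumAt (G.endVertex d) 1 * G.sumAt (G.endVertex d) b) • 1 - b) := by
    refine G.sumAt_congr fun d' hd' => ?_
    simp [scatter_apply, hd']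
  rw [h, map_sub, map_smul, smul_eq_mul]
  have := G.sumAt_endVertex_one_ne_zero d
  field_simp
  ring

/-- At each vertex the map is 2Π - 1, with Π the averaging projection onto constants, hence a
reflection. Being also real and symmetric, it is unitary. -/
theorem LeadGraph.scatter_scatter (G : LeadGraph V K M) (b : EdgeEnd K M → ℂ) :
    G.scatter (G.scatter b) = b := by
  funext d
  rw [scatter_apply, sumAt_scatter, scatter_apply]
  ring

open Classical in
theorem LeadGraph.dotProduct_scatter (G : LeadGraph V K M) (a b : EdgeEnd K M → ℂ) :
    a ⬝ᵥ G.scatter b = G.scatter a ⬝ᵥ b := by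
  simp only [dotProduct, scatter_apply, mul_sub, sub_mul, Finset.sum_sub_distrib]
  congr 1
  simp only [sumAt_apply, Finset.mul_sum, Finset.sum_mul]
  rw [Finset.sum_comm]
  refine Finset.sum_congr rfl fun d _ => Finset.sum_congr rfl fun d' _ => ?_
  by_cases h : G.endVertex d = G.endVertex d'
  · simp [h]
    ring
  · simp [h, Ne.symm h]

open Classical in
theorem LeadGraph.star_scatter (G : LeadGraph V K M) (b : EdgeEnd K M → ℂ) :
    star (G.scatter b) = G.scatter (star b) := by
  have h : ∀ v c, star (G.sumAt v c) = G.sumAt v (star c) := by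
    intro v c
    simp only [sumAt_apply, star_sum]
    refine Finset.sum_congr rfl fun d _ => ?_
    split_ifs
    · rfl
    · simp
  funext d
  simp only [Pi.star_apply, scatter_apply, star_sub, star_mul', star_div₀, h, star_one, star_ofNat]

theorem LeadGraph.star_dotProduct_scatter (G : LeadGraph V K M) (a b : EdgeEnd K M → ℂ) :
    star (G.scatter a) ⬝ᵥ G.scatter b = star a ⬝ᵥ b := by
  rw [G.star_scatter, G.dotProduct_scatter, G.scatter_scatter]

open Classical in
/-- The secular matrix `1 - U K(z)`. -/
def secular (G : LeadGraph V K M) (ℓ : M → ℝ) (z : ℂ) : Matrix (EdgeEnd K M) (EdgeEnd K M) ℂ :=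
  LinearMap.toMatrix' (LinearMap.id - G.scatter ∘ₗ propagate ℓ z)

open Classical in
theorem secular_mulVec (G : LeadGraph V K M) (ℓ : M → ℝ) (z : ℂ) (a : EdgeEnd K M → ℂ) :
    (secular G ℓ z).mulVec a = a - G.scatter (propagate ℓ z a) := by
  rw [secular, LinearMap.toMatrix'_mulVec]
  rfl

theorem secular_mulVec_eq_zero_iff {G : LeadGraph V K M} {ℓ : M → ℝ} {z : ℂ}
    {a : EdgeEnd K M → ℂ} :
    (secular G ℓ z).mulVec a = 0 ↔ a = G.scatter (propagate ℓ z a) := by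
  rw [secular_mulVec, sub_eq_zero]

/-- Conservation of flux: unitarity equates the total outgoing and incoming intensities, and the
incoming ones are the outgoing ones at the opposite ends, damped by the transit factor. -/
theorem sum_normSq_eq_of_secular_eq_zero {G : LeadGraph V K M} {ℓ : M → ℝ} {z : ℂ}
    {a : EdgeEnd K M → ℂ} (h : (secular G ℓ z).mulVec a = 0) :
    ∑ d, (1 - ‖transit ℓ z d‖ ^ 2) * ‖a d‖ ^ 2 = 0 := by
  have h1 := G.star_dotProduct_scatter (propagate ℓ z a) (propagate ℓ z a)
  rw [← secular_mulVec_eq_zero_iff.1 h] at h1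
  have h2 : ∀ b : EdgeEnd K M → ℂ, star b ⬝ᵥ b = ((∑ d, ‖b d‖ ^ 2 : ℝ) : ℂ) := by
    intro b
    simp [dotProduct, Complex.conj_mul']
  rw [h2, h2, Complex.ofReal_inj, ← Equiv.sum_comp (oppositeEquiv (K := K) (M := M))
    (fun d => ‖propagate ℓ z a d‖ ^ 2)] at h1
  simp only [sub_mul, one_mul, Finset.sum_sub_distrib]
  rw [h1, sub_eq_zero]
  refine Finset.sum_congr rfl fun d _ => ?_
  have h3 : oppositeEquiv d = oppositeEnd d := rfl
  simp [propagate_apply, h3, mul_pow]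

/-- For Im z ≥ 0 no transit factor exceeds 1 in modulus, so every term of the flux identity is
nonnegative and must vanish. For real z this kills the lead amplitudes; for Im z > 0 it kills all of
them. -/
theorem transit_mul_of_secular_eq_zero {G : LeadGraph V K M} {ℓ : M → ℝ} (hℓ : ∀ m, 0 < ℓ m)
    {z : ℂ} (hz : 0 ≤ z.im) {a : EdgeEnd K M → ℂ} (h : (secular G ℓ z).mulVec a = 0)
    (d : EdgeEnd K M) : ‖transit ℓ z d‖ = 1 ∨ a d = 0 := by
  have h1 : ∀ d ∈ Finset.univ, 0 ≤ (1 - ‖transit ℓ z d‖ ^ 2) * ‖a d‖ ^ 2 := by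
    intro d _
    have := norm_transit_le_one hℓ hz d
    have := norm_nonneg (transit ℓ z d)
    exact mul_nonneg (by nlinarith) (by positivity)
  have h2 := (Finset.sum_eq_zero_iff_of_nonneg h1).1 (sum_normSq_eq_of_secular_eq_zero h) d
    (Finset.mem_univ d)
  rcases mul_eq_zero.1 h2 with h3 | h3
  · left
    nlinarith [norm_nonneg (transit ℓ z d)]
  · right
    simpa using h3

theorem isUnit_det_secular (G : LeadGraph V K M) {ℓ : M → ℝ} (hℓ : ∀ m, 0 < ℓ m) {z : ℂ}
    (hz : 0 < z.im) [DecidableEq (EdgeEnd K M)] : IsUnit (secular G ℓ z).det := by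
  rw [isUnit_iff_ne_zero]
  intro h0
  obtain ⟨a, ha, ha0⟩ := Matrix.exists_mulVec_eq_zero_iff.2 h0
  refine ha (funext fun d => ?_)
  exact (transit_mul_of_secular_eq_zero hℓ hz.le ha0 d).resolve_left (norm_transit_lt_one hℓ hz d).ne

theorem differentiable_secular (G : LeadGraph V K M) (ℓ : M → ℝ) (d d' : EdgeEnd K M) :
    Differentiable ℂ fun z => secular G ℓ z d d' := by
  classical
  simp only [secular, LinearMap.toMatrix'_apply, LinearMap.sub_apply, LinearMap.comp_apply]
  have h1 : Differentiable ℂ fun z =>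
      (LinearMap.toContinuousLinearMap G.scatter) (propagate ℓ z (Pi.single d' 1)) := by
    refine (ContinuousLinearMap.differentiable _).comp ?_
    rw [differentiable_pi]
    intro e
    simp only [propagate_apply]
    exact (differentiable_transit ℓ e).mul_const _
  exact (differentiable_const _).sub ((differentiable_pi.1 h1) d)

/-- Pairing the secular matrix at `z` with a null vector at a real `x`. -/
theorem star_dotProduct_secular {G : LeadGraph V K M} {ℓ : M → ℝ} (hℓ : ∀ m, 0 < ℓ m)
    {x : ℝ} {v : EdgeEnd K M → ℂ} (hv : (secular G ℓ x).mulVec v = 0) (z : ℂ)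
    (a : EdgeEnd K M → ℂ) :
    star v ⬝ᵥ (secular G ℓ z).mulVec a =
      ∑ d, star (v d) * ((1 - transit ℓ (z - x) d) * a d) := by
  have hlead : ∀ d, ‖transit ℓ (x : ℂ) d‖ = 1 ∨ v d = 0 :=
    transit_mul_of_secular_eq_zero hℓ (by simp) hv
  -- The null vector is itself of the form `scatter (propagate ..)`, so unitarity removes the
  -- scattering map from both sides of the pairing.
  have h1 : star v ⬝ᵥ G.scatter (propagate ℓ z a)
      = star (propagate ℓ x v) ⬝ᵥ propagate ℓ z a := by
    conv_lhs => rw [secular_mulVec_eq_zero_iff.1 hv]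
    exact G.star_dotProduct_scatter _ _
  rw [secular_mulVec, dotProduct_sub, h1]
  have h2 : star (propagate ℓ x v) ⬝ᵥ propagate ℓ z a
      = ∑ d, star (v d) * (transit ℓ (z - x) d * a d) := by
    rw [dotProduct, ← Equiv.sum_comp (oppositeEquiv (K := K) (M := M))]
    refine Finset.sum_congr rfl fun d _ => ?_
    have h3 : oppositeEquiv d = oppositeEnd d := rfl
    simp only [h3, Pi.star_apply, propagate_apply, transit_oppositeEnd, oppositeEnd_oppositeEnd,
      star_mul']
    rcases d with k | m | m
    · simp [transit]
    all_goals
      -- Here x is real: conjugation inverts the phase, and only the difference z - x survives.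
      have h4 : star (Complex.exp (Complex.I * x * ℓ m)) * Complex.exp (Complex.I * z * ℓ m)
          = Complex.exp (Complex.I * (z - x) * ℓ m) := by
        rw [Complex.star_def, ← Complex.exp_conj, ← Complex.exp_add]
        congr 1
        simp
        ring
      simp only [transit]
      rw [← h4]
      ring
  rw [h2, dotProduct, ← Finset.sum_sub_distrib]
  refine Finset.sum_congr rfl fun d _ => ?_
  rw [Pi.star_apply]
  ring

theorem continuous_secular_mulVec (G : LeadGraph V K M) (ℓ : M → ℝ) :
    Continuous fun p : ℂ × (EdgeEnd K M → ℂ) => (secular G ℓ p.1).mulVec p.2 := by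
  refine continuous_pi fun d => ?_
  simp only [Matrix.mulVec, dotProduct]
  refine continuous_finsetSum _ fun d' _ => ?_
  exact ((differentiable_secular G ℓ d d').continuous.comp continuous_fst).mul
    ((continuous_apply d').comp continuous_snd)

/-- Near a real resonance the secular matrix degenerates exactly to first order. -/
theorem exists_secular_lower_bound (G : LeadGraph V K M) {ℓ : M → ℝ} (hℓ : ∀ m, 0 < ℓ m) (x : ℝ) :
    ∃ c > 0, ∃ ε > 0, ∀ z ∈ Metric.closedBall (x : ℂ) ε, ∀ a : EdgeEnd K M → ℂ,
      c * ‖z - x‖ * ‖a‖ ≤ ‖(secular G ℓ z).mulVec a‖ := by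
  by_contra hcon
  push Not at hcon
  -- Failure of the bound gives unit vectors aₙ at points zₙ → x whose images are o(|zₙ - x|). The
  -- strict inequality being negated forces zₙ ≠ x and a nonzero vector. A limit `v` of the aₙ is a
  -- null vector at x.
  have hex : ∀ n : ℕ, ∃ z : ℂ, ‖z - x‖ ≤ 1 / ((n : ℝ) + 1) ∧ z ≠ x ∧ ∃ a : EdgeEnd K M → ℂ,
      ‖a‖ = 1 ∧ ‖(secular G ℓ z).mulVec a‖ ≤ 1 / ((n : ℝ) + 1) * ‖z - x‖ := by
    intro n
    obtain ⟨z, hz, a, ha⟩ := hcon (1 / ((n : ℝ) + 1)) (by positivity) (1 / ((n : ℝ) + 1))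
      (by positivity)
    have h1 : 0 < 1 / ((n : ℝ) + 1) * ‖z - x‖ * ‖a‖ := (norm_nonneg _).trans_lt ha
    have hz0 : z ≠ x := by
      rintro rfl
      simp at h1
    have ha0 : a ≠ 0 := by
      rintro rfl
      simp at h1
    have hp : 0 < ‖a‖ := norm_pos_iff.2 ha0
    refine ⟨z, by simpa [dist_eq_norm] using hz, hz0, ((‖a‖⁻¹ : ℝ) : ℂ) • a, ?_, ?_⟩
    · rw [norm_smul]
      simp [hp.ne']
    · rw [Matrix.mulVec_smul, norm_smul, Complex.norm_real, norm_inv, norm_norm,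
        inv_mul_le_iff₀ hp]
      linarith
  choose z hz hzx a ha hsec using hex
  obtain ⟨v, hvs, φ, hφ, hlim⟩ := (isCompact_sphere (0 : EdgeEnd K M → ℂ) 1).tendsto_subseq
    (x := a) (fun n => by simp [ha n])
  have hinv : Tendsto (fun n : ℕ => 1 / ((n : ℝ) + 1)) atTop (𝓝 0) :=
    tendsto_one_div_add_atTop_nhds_zero_nat
  have hzlim : Tendsto (fun n => z (φ n)) atTop (𝓝 (x : ℂ)) := by
    rw [tendsto_iff_norm_sub_tendsto_zero]
    exact (squeeze_zero (fun _ => norm_nonneg _) hz hinv).comp hφ.tendsto_atTop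
  have hzlim' : Tendsto (fun n => z (φ n)) atTop (𝓝[≠] (x : ℂ)) :=
    tendsto_nhdsWithin_iff.2 ⟨hzlim, Eventually.of_forall fun n => hzx _⟩
  have hdiv : Tendsto (fun n => (z (φ n) - x)⁻¹ • (secular G ℓ (z (φ n))).mulVec (a (φ n))) atTop
      (𝓝 0) := by
    rw [tendsto_zero_iff_norm_tendsto_zero]
    refine squeeze_zero (fun _ => norm_nonneg _) (fun n => ?_) (hinv.comp hφ.tendsto_atTop)
    have hp : 0 < ‖z (φ n) - x‖ := norm_pos_iff.2 (sub_ne_zero.2 (hzx _))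
    rw [norm_smul, norm_inv, inv_mul_le_iff₀ hp, mul_comm]
    exact hsec _
  have hv : (secular G ℓ x).mulVec v = 0 := by
    have h1 : Tendsto (fun n => (secular G ℓ (z (φ n))).mulVec (a (φ n))) atTop
        (𝓝 ((secular G ℓ x).mulVec v)) := by
      have h0 : Tendsto (fun n => (z (φ n), a (φ n))) atTop (𝓝 ((x : ℂ), v)) :=
        hzlim.prodMk_nhds hlim
      have h1 := ((continuous_secular_mulVec G ℓ).tendsto ((x : ℂ), v)).comp h0
      simp only [Function.comp_def] at h1
      exact h1
    have h2 := (hzlim.sub_const (x : ℂ)).smul hdiv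
    rw [sub_self, smul_zero] at h2
    refine tendsto_nhds_unique h1 (h2.congr fun n => ?_)
    rw [smul_inv_smul₀ (sub_ne_zero.2 (hzx _))]
  have hv0 : ∀ k, v (.inl k) = 0 := fun k =>
    (transit_mul_of_secular_eq_zero hℓ (by simp) hv (.inl k)).resolve_left (by simp [transit])
  have h3 : Tendsto (fun n => star v ⬝ᵥ
      ((z (φ n) - x)⁻¹ • (secular G ℓ (z (φ n))).mulVec (a (φ n)))) atTop (𝓝 0) := by
    have h4 : Continuous fun b : EdgeEnd K M → ℂ => star v ⬝ᵥ b := by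
      simp only [dotProduct]
      fun_prop
    have := (h4.tendsto 0).comp hdiv
    rwa [dotProduct_zero] at this
  -- The same pairing, which tends to 0 by the choice of the sequence, is computed through the null
  -- vector `v`: its limit is -i times the length-weighted norm of `v` on the finite edges. Hence
  -- `v` = 0, against ‖v‖ = 1.
  have h5 : Tendsto (fun n => star v ⬝ᵥ
      ((z (φ n) - x)⁻¹ • (secular G ℓ (z (φ n))).mulVec (a (φ n)))) atTop
      (𝓝 (∑ d : M ⊕ M, star (v (.inr d)) * ((-Complex.I * ℓ (d.elim id id)) * v (.inr d)))) := by
    have h6 : ∀ n, star v ⬝ᵥ ((z (φ n) - x)⁻¹ • (secular G ℓ (z (φ n))).mulVec (a (φ n)))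
        = ∑ d : M ⊕ M, star (v (.inr d)) * (((z (φ n) - x)⁻¹ *
          (1 - transit ℓ (z (φ n) - x) (.inr d : EdgeEnd K M))) * a (φ n) (.inr d)) := by
      intro n
      rw [dotProduct_smul, star_dotProduct_secular hℓ hv, Fintype.sum_sum_type]
      simp only [hv0, star_zero, zero_mul, Finset.sum_const_zero, zero_add, smul_eq_mul,
        Finset.mul_sum]
      refine Finset.sum_congr rfl fun d _ => ?_
      ring
    simp only [h6]
    refine tendsto_finsetSum _ fun d _ => ?_
    exact (((tendsto_one_sub_transit_div (K := K) ℓ d).comp hzlim').mul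
      ((tendsto_pi_nhds.1 hlim) (.inr d))).const_mul _
  have h7 := tendsto_nhds_unique h5 h3
  have h8 : ∑ d : M ⊕ M, ℓ (d.elim id id) * ‖v (.inr d)‖ ^ 2 = 0 := by
    have h9 : ∑ d : M ⊕ M, star (v (.inr d)) * ((-Complex.I * ℓ (d.elim id id)) * v (.inr d))
        = -Complex.I * ((∑ d : M ⊕ M, ℓ (d.elim id id) * ‖v (.inr d)‖ ^ 2 : ℝ) : ℂ) := by
      push_cast
      rw [Finset.mul_sum]
      refine Finset.sum_congr rfl fun d _ => ?_
      rw [← Complex.conj_mul', Complex.star_def]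
      ring
    rw [h9] at h7
    exact Complex.ofReal_eq_zero.1 ((mul_eq_zero.1 h7).resolve_left (by simp))
  have h10 := (Finset.sum_eq_zero_iff_of_nonneg
    (fun d _ => mul_nonneg (hℓ _).le (by positivity))).1 h8
  have hvz : v = 0 := by
    funext d
    rcases d with k | d
    · exact hv0 k
    · have := h10 d (Finset.mem_univ d)
      simpa [(hℓ _).ne'] using this
  simp [hvz] at hvs

/-- The secular matrix depends Lipschitz continuously at `t = 0` on the edge lengths. -/
theorem exists_secular_lipschitz (G : LeadGraph V K M) {ℓ : M → ℝ → ℝ}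
    (hℓ : ∀ m, DifferentiableAt ℝ (ℓ m) 0) (z₀ : ℂ) (ε : ℝ) :
    ∃ C > 0, ∀ᶠ t in 𝓝 (0 : ℝ), ∀ z ∈ Metric.closedBall z₀ ε, ∀ a : EdgeEnd K M → ℂ,
      ‖(secular G (fun m => ℓ m t) z).mulVec a - (secular G (fun m => ℓ m 0) z).mulVec a‖
        ≤ C * |t| * ‖a‖ := by
  have hO : ∀ m, ∃ C > 0, ∀ᶠ t in 𝓝 (0 : ℝ), |ℓ m t - ℓ m 0| ≤ C * |t| := by
    intro m
    obtain ⟨C, hC, h⟩ := (hℓ m).isBigO_sub.exists_pos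
    exact ⟨C, hC, by simpa using h.bound⟩
  choose C₁ hC₁ hO using hO
  obtain ⟨B, hB⟩ := (isCompact_closedBall z₀ ε).exists_bound_of_continuousOn
    (f := id) continuousOn_id
  set B' : ℝ := max B 1 with hB'
  have hB0 : 0 < B' := lt_max_of_lt_right one_pos
  set L : ℝ := ∑ m, |ℓ m 0| + 1 with hL
  have hball : ∀ m, ∀ᶠ t in 𝓝 (0 : ℝ), |ℓ m t| ≤ L := by
    intro m
    have h1 : |ℓ m 0| < L := by
      have := Finset.single_le_sum (f := fun m => |ℓ m 0|) (fun i _ => abs_nonneg _)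
        (Finset.mem_univ m)
      linarith
    exact ((hℓ m).continuousAt.abs.eventually (gt_mem_nhds h1)).mono fun t ht => ht.le
  -- `E` bounds the derivative of y ↦ exp(izy) for |y| ≤ `L` and |z| ≤ `B'`. The summands 1 added to
  -- `N` and `S` below keep the final constant positive, even without finite edges.
  set E : ℝ := Real.exp (B' * L) * B' with hE
  set S : ℝ := ∑ m, C₁ m with hS
  set N : ℝ := ‖LinearMap.toContinuousLinearMap G.scatter‖ with hN
  refine ⟨(N + 1) * (E * (S + 1)), ?_, ?_⟩
  · have : 0 ≤ S := Finset.sum_nonneg fun m _ => (hC₁ m).le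
    positivity
  have hw : ∀ᶠ t in 𝓝 (0 : ℝ), ∀ m, ∀ z ∈ Metric.closedBall z₀ ε,
      ‖Complex.exp (Complex.I * z * ℓ m t) - Complex.exp (Complex.I * z * ℓ m 0)‖
        ≤ E * (S + 1) * |t| := by
    rw [eventually_all]
    intro m
    -- The mean value inequality needs both `ℓ m t` and `ℓ m 0` in [-L, L]; the third entry is the
    -- bound at t = 0, made constant in t.
    filter_upwards [hO m, hball m, hball m |>.self_of_nhds |> fun h => Eventually.of_forall
      (fun _ : ℝ => h)] with t h1 h2 h3 z hz
    have hzB : ‖z‖ ≤ B' := (hB z hz).trans (le_max_left _ _)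
    have hLip : ∀ y ∈ Icc (-L) L, ‖Complex.I * z * Complex.exp (Complex.I * z * (y : ℝ))‖ ≤ E := by
      intro y hy
      rw [norm_mul, norm_mul, Complex.norm_I, one_mul, hE, mul_comm]
      gcongr
      refine (Complex.norm_exp_le_exp_norm _).trans ?_
      gcongr
      rw [norm_mul, norm_mul, Complex.norm_I, one_mul, Complex.norm_real]
      gcongr
      exact abs_le.2 hy
    have h4 := (convex_Icc (-L) L).norm_image_sub_le_of_norm_hasDerivWithin_le
      (f := fun y : ℝ => Complex.exp (Complex.I * z * y))
      (f' := fun y : ℝ => Complex.I * z * Complex.exp (Complex.I * z * y)) (C := E)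
      (fun y _ => by
        have h5 : HasDerivAt (fun y : ℝ => Complex.I * z * (y : ℂ)) (Complex.I * z * 1) y :=
          (Complex.ofRealCLM.hasDerivAt (x := y)).const_mul _
        have h6 := h5.cexp
        rw [mul_one, mul_comm (Complex.exp _)] at h6
        exact h6.hasDerivWithinAt) hLip (abs_le.1 h3) (abs_le.1 h2)
    refine h4.trans ?_
    have h7 : C₁ m ≤ S := Finset.single_le_sum (f := C₁) (fun i _ => (hC₁ i).le)
      (Finset.mem_univ m)
    have h8 : |ℓ m t - ℓ m 0| ≤ (S + 1) * |t| := h1.trans (by gcongr; linarith)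
    rw [Real.norm_eq_abs, mul_assoc E]
    exact mul_le_mul_of_nonneg_left h8 (mul_nonneg (Real.exp_pos _).le hB0.le)
  filter_upwards [hw] with t ht z hz a
  have h1 : (secular G (fun m => ℓ m t) z).mulVec a - (secular G (fun m => ℓ m 0) z).mulVec a
      = LinearMap.toContinuousLinearMap G.scatter
        (propagate (fun m => ℓ m 0) z a - propagate (fun m => ℓ m t) z a) := by
    rw [secular_mulVec, secular_mulVec, map_sub]
    simp only [LinearMap.coe_toContinuousLinearMap']
    abel
  rw [h1]
  refine (ContinuousLinearMap.le_opNorm _ _).trans ?_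
  have hS0 : 0 ≤ S := Finset.sum_nonneg fun m _ => (hC₁ m).le
  have hE0 : 0 ≤ E := by positivity
  have h2 : ‖propagate (fun m => ℓ m 0) z a - propagate (fun m => ℓ m t) z a‖
      ≤ E * (S + 1) * |t| * ‖a‖ := by
    rw [pi_norm_le_iff_of_nonneg (by positivity)]
    intro d
    rw [Pi.sub_apply, propagate_apply, propagate_apply, ← sub_mul, norm_mul]
    refine mul_le_mul ?_ (norm_le_pi_norm a _) (norm_nonneg _) (by positivity)
    rcases d with k | m | m
    · simp only [transit, sub_self, norm_zero]
      positivity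
    all_goals
      simp only [transit]
      rw [norm_sub_rev]
      exact ht m z hz
  calc N * _ ≤ (N + 1) * (E * (S + 1) * |t| * ‖a‖) := by gcongr; linarith
    _ = _ := by ring

/-- A real zero of the secular determinant moves by `o(|t|^γ)`, `γ < 1`. -/
theorem exists_secular_zero_near (G : LeadGraph V K M) {ℓ : M → ℝ → ℝ}
    (hℓ : ∀ m, DifferentiableAt ℝ (ℓ m) 0) (hpos : ∀ m, 0 < ℓ m 0) {x : ℝ} (hx : 0 < x)
    (hker : ∃ a : EdgeEnd K M → ℂ, a ≠ 0 ∧ (secular G (fun m => ℓ m 0) x).mulVec a = 0)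
    {γ : ℝ} (hγ : γ < 1) :
    ∀ᶠ t in 𝓝[≠] (0 : ℝ), ∃ z : ℂ, ‖z - x‖ < |t| ^ γ ∧ z ≠ 0 ∧
      ∃ a : EdgeEnd K M → ℂ, a ≠ 0 ∧ (secular G (fun m => ℓ m t) z).mulVec a = 0 := by
  classical
  obtain ⟨c, hc, ε, hε, hlow⟩ := exists_secular_lower_bound G hpos x
  obtain ⟨C, hC, hlip⟩ := exists_secular_lipschitz G hℓ (x : ℂ) ε
  -- The second radius `η` is x itself: |z - x| < x excludes z = 0, where null vectors need not be
  -- resonances.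
  refine (exists_singular_near (A := fun z t => secular G (fun m => ℓ m t) z) hx hC hc hε
    (fun t i j => differentiable_secular G _ i j) hlip hlow hker hγ).mono ?_
  rintro t ⟨z, h1, h2, a, ha⟩
  refine ⟨z, h1, ?_, a, ha⟩
  rintro rfl
  simp [abs_of_pos hx] at h2

end Secular

/-! ### Schur's test and holomorphic families of integral operators. -/

section Kernel

variable {X Y : Type*} [MeasurableSpace X] [MeasurableSpace Y]

/-- The hypotheses of Schur's test for the integral kernel `k`. -/
structure IsSchur (μ : Measure X) (ν : Measure Y) (k : X × Y → ℂ) (C : NNReal) : Prop where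
  measurable : Measurable k
  left : ∀ᵐ x ∂μ, ∫⁻ y, ‖k (x, y)‖ₑ ∂ν ≤ C
  right : ∀ᵐ y ∂ν, ∫⁻ x, ‖k (x, y)‖ₑ ∂μ ≤ C

variable {μ : Measure X} {ν : Measure Y} {k k' : X × Y → ℂ} {C C' : NNReal}

theorem lintegral_enorm_rpow_two_lt_top {f : Y → ℂ} (hf : MemLp f 2 ν) :
    ∫⁻ y, ‖f y‖ₑ ^ (2 : ℝ) ∂ν < ∞ := by
  have := lintegral_rpow_enorm_lt_top_of_eLpNorm_lt_top (p := 2) (by norm_num) (by norm_num) hf.2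
  simpa using this

theorem IsSchur.sub (h : IsSchur μ ν k C) (h' : IsSchur μ ν k' C') :
    IsSchur μ ν (k - k') (C + C') where
  measurable := h.measurable.sub h'.measurable
  left := by
    filter_upwards [h.left, h'.left] with x hx hx'
    refine (lintegral_mono fun y => enorm_sub_le).trans ?_
    rw [lintegral_add_left (f := fun y => ‖k (x, y)‖ₑ)
      (h.measurable.comp measurable_prodMk_left).enorm, ENNReal.coe_add]
    exact add_le_add hx hx'
  right := by
    filter_upwards [h.right, h'.right] with y hy hy'
    refine (lintegral_mono fun x => enorm_sub_le).trans ?_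
    rw [lintegral_add_left (f := fun x => ‖k (x, y)‖ₑ)
      (h.measurable.comp measurable_prodMk_right).enorm, ENNReal.coe_add]
    exact add_le_add hy hy'

theorem IsSchur.const_smul (h : IsSchur μ ν k C) (c : ℂ) : IsSchur μ ν (c • k) (‖c‖₊ * C) where
  measurable := h.measurable.const_smul c
  left := by
    filter_upwards [h.left] with x hx
    simp only [Pi.smul_apply, smul_eq_mul, enorm_mul]
    rw [lintegral_const_mul' _ _ enorm_ne_top, ENNReal.coe_mul]
    gcongr
    exact le_rfl
  right := by
    filter_upwards [h.right] with x hx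
    simp only [Pi.smul_apply, smul_eq_mul, enorm_mul]
    rw [lintegral_const_mul' _ _ enorm_ne_top, ENNReal.coe_mul]
    gcongr
    exact le_rfl

/-- The row integrals are bounded through the measure of `A'` and the column integrals through that
of `A`; the sum of the two gives one constant for both. -/
theorem isSchur_of_bounded (hk : Measurable k) {A : Set X} {A' : Set Y} (hA : MeasurableSet A)
    (hA' : MeasurableSet A') (hμ : μ A ≠ ∞) (hν : ν A' ≠ ∞) {c : NNReal}
    (hc : ∀ q, ‖k q‖₊ ≤ c) (hs : ∀ q, q ∉ A ×ˢ A' → k q = 0) :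
    IsSchur μ ν k (c * ((μ A).toNNReal + (ν A').toNNReal)) where
  measurable := hk
  left := by
    refine Eventually.of_forall fun x => ?_
    have h1 : ∀ y, ‖k (x, y)‖ₑ ≤ A'.indicator (fun _ => (c : ℝ≥0∞)) y := by
      intro y
      by_cases hy : y ∈ A'
      · rw [indicator_of_mem hy]
        exact ENNReal.coe_le_coe.2 (hc _)
      · rw [hs _ (fun h => hy h.2)]
        simp
    refine (lintegral_mono h1).trans ?_
    rw [lintegral_indicator_const hA', ENNReal.coe_mul, ENNReal.coe_add, ENNReal.coe_toNNReal hν]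
    gcongr
    exact le_add_self
  right := by
    refine Eventually.of_forall fun y => ?_
    have h1 : ∀ x, ‖k (x, y)‖ₑ ≤ A.indicator (fun _ => (c : ℝ≥0∞)) x := by
      intro x
      by_cases hx : x ∈ A
      · rw [indicator_of_mem hx]
        exact ENNReal.coe_le_coe.2 (hc _)
      · rw [hs _ (fun h => hx h.1)]
        simp
    refine (lintegral_mono h1).trans ?_
    rw [lintegral_indicator_const hA, ENNReal.coe_mul, ENNReal.coe_add, ENNReal.coe_toNNReal hμ]
    gcongr
    exact le_self_add

variable [SFinite μ] [SFinite ν]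

/-- Split |k f| as |k|^(1/2) · |k|^(1/2)|f| and apply Cauchy–Schwarz in y. The row bound controls
the first factor; Tonelli and the column bound control the second. -/
theorem IsSchur.lintegral_le (h : IsSchur μ ν k C) {f : Y → ℂ} (hf : AEStronglyMeasurable f ν) :
    ∫⁻ x, (∫⁻ y, ‖k (x, y) * f y‖ₑ ∂ν) ^ (2 : ℝ) ∂μ ≤
      (C : ℝ≥0∞) ^ (2 : ℝ) * ∫⁻ y, ‖f y‖ₑ ^ (2 : ℝ) ∂ν := by
  have hk : ∀ x, AEMeasurable (fun y => ‖k (x, y)‖ₑ) ν := fun x =>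
    (h.measurable.comp measurable_prodMk_left).enorm.aemeasurable
  have hf2 : AEMeasurable (fun y => ‖f y‖ₑ ^ (2 : ℝ)) ν := hf.enorm.pow_const _
  have h1 : ∀ᵐ x ∂μ, (∫⁻ y, ‖k (x, y) * f y‖ₑ ∂ν) ^ (2 : ℝ) ≤
      C * ∫⁻ y, ‖k (x, y)‖ₑ * ‖f y‖ₑ ^ (2 : ℝ) ∂ν := by
    filter_upwards [h.left] with x hx
    have h2 := ENNReal.lintegral_mul_norm_pow_le (hk x) ((hk x).mul hf2)
      (p := 1 / 2) (q := 1 / 2) (by norm_num) (by norm_num) (by norm_num)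
    have h3 : ∀ y, ‖k (x, y)‖ₑ ^ (1 / 2 : ℝ) *
        ((fun y => ‖k (x, y)‖ₑ) * fun y => ‖f y‖ₑ ^ (2 : ℝ)) y ^ (1 / 2 : ℝ)
        = ‖k (x, y) * f y‖ₑ := by
      intro y
      rw [Pi.mul_apply, ENNReal.mul_rpow_of_nonneg _ _ (by norm_num), ← mul_assoc,
        ← ENNReal.rpow_add_of_nonneg _ _ (by norm_num) (by norm_num), ← ENNReal.rpow_mul, enorm_mul]
      norm_num
    simp only [h3] at h2
    calc (∫⁻ y, ‖k (x, y) * f y‖ₑ ∂ν) ^ (2 : ℝ)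
        ≤ ((∫⁻ y, ‖k (x, y)‖ₑ ∂ν) ^ (1 / 2 : ℝ) *
          (∫⁻ y, ‖k (x, y)‖ₑ * ‖f y‖ₑ ^ (2 : ℝ) ∂ν) ^ (1 / 2 : ℝ)) ^ (2 : ℝ) :=
          ENNReal.rpow_le_rpow h2 (by norm_num)
      _ = (∫⁻ y, ‖k (x, y)‖ₑ ∂ν) * ∫⁻ y, ‖k (x, y)‖ₑ * ‖f y‖ₑ ^ (2 : ℝ) ∂ν := by
          rw [ENNReal.mul_rpow_of_nonneg _ _ (by norm_num), ← ENNReal.rpow_mul, ← ENNReal.rpow_mul]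
          norm_num
      _ ≤ _ := by gcongr
  calc _ ≤ ∫⁻ x, C * ∫⁻ y, ‖k (x, y)‖ₑ * ‖f y‖ₑ ^ (2 : ℝ) ∂ν ∂μ := lintegral_mono_ae h1
    _ = C * ∫⁻ x, ∫⁻ y, ‖k (x, y)‖ₑ * ‖f y‖ₑ ^ (2 : ℝ) ∂ν ∂μ :=
        lintegral_const_mul' _ _ ENNReal.coe_ne_top
    _ = C * ∫⁻ y, ∫⁻ x, ‖k (x, y)‖ₑ * ‖f y‖ₑ ^ (2 : ℝ) ∂μ ∂ν := by
        rw [lintegral_lintegral_swap]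
        exact h.measurable.enorm.aemeasurable.mul hf2.comp_snd
    _ = C * ∫⁻ y, (∫⁻ x, ‖k (x, y)‖ₑ ∂μ) * ‖f y‖ₑ ^ (2 : ℝ) ∂ν := by
        congr 1
        refine lintegral_congr fun y => ?_
        exact lintegral_mul_const _ (h.measurable.comp measurable_prodMk_right).enorm
    _ ≤ C * ∫⁻ y, C * ‖f y‖ₑ ^ (2 : ℝ) ∂ν := by
        gcongr 1
        refine lintegral_mono_ae ?_
        filter_upwards [h.right] with y hy
        gcongr
    _ = _ := by
        rw [lintegral_const_mul' _ _ ENNReal.coe_ne_top, ← mul_assoc, ENNReal.rpow_two, sq]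

/-- An almost everywhere finite square has an almost everywhere finite root. This makes the Bochner
integral additive in f, hence `kernelOp` linear. -/
theorem IsSchur.integrable (h : IsSchur μ ν k C) {f : Y → ℂ} (hf : MemLp f 2 ν) :
    ∀ᵐ x ∂μ, Integrable (fun y => k (x, y) * f y) ν := by
  have hm : AEMeasurable (fun x => (∫⁻ y, ‖k (x, y) * f y‖ₑ ∂ν) ^ (2 : ℝ)) μ := by
    refine AEMeasurable.pow_const ?_ _
    refine AEMeasurable.lintegral_prod_right' (f := fun p : X × Y => ‖k p * f p.2‖ₑ) ?_
    exact (h.measurable.aestronglyMeasurable.mul hf.1.comp_snd).enorm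
  have hlt := (h.lintegral_le hf.1).trans_lt
    (ENNReal.mul_lt_top (by simp) (lintegral_enorm_rpow_two_lt_top hf))
  filter_upwards [ae_lt_top' hm hlt.ne] with x hx
  refine ⟨(h.measurable.comp measurable_prodMk_left).aestronglyMeasurable.mul hf.1, ?_⟩
  rw [HasFiniteIntegral]
  exact (ENNReal.rpow_lt_top_iff_of_pos (by norm_num)).1 hx

theorem IsSchur.eLpNorm_le (h : IsSchur μ ν k C) {f : Y → ℂ} (hf : AEStronglyMeasurable f ν) :
    eLpNorm (fun x => ∫ y, k (x, y) * f y ∂ν) 2 μ ≤ C * eLpNorm f 2 ν := by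
  rw [eLpNorm_eq_lintegral_rpow_enorm_toReal (by norm_num) (by norm_num),
    eLpNorm_eq_lintegral_rpow_enorm_toReal (by norm_num) (by norm_num)]
  simp only [ENNReal.toReal_ofNat]
  have h1 : ∫⁻ x, ‖∫ y, k (x, y) * f y ∂ν‖ₑ ^ (2 : ℝ) ∂μ ≤
      (C : ℝ≥0∞) ^ (2 : ℝ) * ∫⁻ y, ‖f y‖ₑ ^ (2 : ℝ) ∂ν := by
    refine (lintegral_mono fun x => ?_).trans (h.lintegral_le hf)
    exact ENNReal.rpow_le_rpow (enorm_integral_le_lintegral_enorm _) (by norm_num)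
  refine (ENNReal.rpow_le_rpow h1 (by norm_num)).trans_eq ?_
  rw [ENNReal.mul_rpow_of_nonneg _ _ (by norm_num), ← ENNReal.rpow_mul]
  norm_num

theorem IsSchur.memLp (h : IsSchur μ ν k C) {f : Y → ℂ} (hf : MemLp f 2 ν) :
    MemLp (fun x => ∫ y, k (x, y) * f y ∂ν) 2 μ := by
  refine ⟨?_, (h.eLpNorm_le hf.1).trans_lt (ENNReal.mul_lt_top (by simp) hf.2)⟩
  exact (h.measurable.aestronglyMeasurable.mul hf.1.comp_snd).integral_prod_right'

open Classical in
variable (μ ν) in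
/-- The bounded operator `L²(ν) → L²(μ)` with integral kernel `k` (zero unless Schur's test
applies). -/
def kernelOp (k : X × Y → ℂ) : Lp ℂ 2 ν →L[ℂ] Lp ℂ 2 μ :=
  if h : ∃ C, IsSchur μ ν k C then
    LinearMap.mkContinuous
      { toFun := fun f => (h.choose_spec.memLp (Lp.memLp f)).toLp _
        map_add' := fun f g => by
          rw [← MemLp.toLp_add]
          refine (MemLp.toLp_eq_toLp_iff _ _).2 ?_
          filter_upwards [h.choose_spec.integrable (Lp.memLp f),
            h.choose_spec.integrable (Lp.memLp g)] with x hf hg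
          rw [Pi.add_apply, ← integral_add hf hg]
          refine integral_congr_ae ?_
          filter_upwards [Lp.coeFn_add f g] with y hy
          rw [hy, Pi.add_apply, mul_add]
        map_smul' := fun c f => by
          rw [RingHom.id_apply, ← MemLp.toLp_const_smul]
          refine (MemLp.toLp_eq_toLp_iff _ _).2 (Eventually.of_forall fun x => ?_)
          simp only [Pi.smul_apply, smul_eq_mul]
          rw [← integral_const_mul]
          refine integral_congr_ae ?_
          filter_upwards [Lp.coeFn_smul c f] with y hy
          rw [hy, Pi.smul_apply, smul_eq_mul]
          ring }
      h.choose fun f => by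
        refine (Lp.norm_toLp _ (h.choose_spec.memLp (Lp.memLp f))).trans_le ?_
        rw [Lp.norm_def]
        have := ENNReal.toReal_mono (ENNReal.mul_lt_top (by simp) (Lp.memLp f).2).ne
          (h.choose_spec.eLpNorm_le (Lp.memLp f).1)
        rwa [ENNReal.toReal_mul, ENNReal.coe_toReal] at this
  else 0

theorem IsSchur.kernelOp_ae_eq (h : IsSchur μ ν k C) (f : Lp ℂ 2 ν) :
    kernelOp μ ν k f =ᵐ[μ] fun x => ∫ y, k (x, y) * f y ∂ν := by
  have h' : ∃ C, IsSchur μ ν k C := ⟨C, h⟩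
  rw [kernelOp, dif_pos h']
  exact MemLp.coeFn_toLp (h'.choose_spec.memLp (Lp.memLp f))

theorem IsSchur.norm_kernelOp_le (h : IsSchur μ ν k C) : ‖kernelOp μ ν k‖ ≤ C := by
  refine ContinuousLinearMap.opNorm_le_bound _ C.2 fun f => ?_
  rw [Lp.norm_def, Lp.norm_def, eLpNorm_congr_ae (h.kernelOp_ae_eq f)]
  have := ENNReal.toReal_mono (ENNReal.mul_lt_top (by simp) (Lp.memLp f).2).ne
    (h.eLpNorm_le (Lp.memLp f).1)
  rwa [ENNReal.toReal_mul, ENNReal.coe_toReal] at this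

theorem IsSchur.kernelOp_sub (h : IsSchur μ ν k C) (h' : IsSchur μ ν k' C') :
    kernelOp μ ν (k - k') = kernelOp μ ν k - kernelOp μ ν k' := by
  ext1 f
  refine Lp.ext ?_
  rw [sub_apply]
  filter_upwards [(h.sub h').kernelOp_ae_eq f, h.kernelOp_ae_eq f, h'.kernelOp_ae_eq f,
    Lp.coeFn_sub (kernelOp μ ν k f) (kernelOp μ ν k' f), h.integrable (Lp.memLp f),
    h'.integrable (Lp.memLp f)] with x h1 h2 h3 h4 h5 h6
  rw [h1, h4, Pi.sub_apply, h2, h3, ← integral_sub h5 h6]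
  simp only [Pi.sub_apply, sub_mul]

theorem IsSchur.kernelOp_const_smul (h : IsSchur μ ν k C) (c : ℂ) :
    kernelOp μ ν (c • k) = c • kernelOp μ ν k := by
  ext1 f
  refine Lp.ext ?_
  rw [smul_apply]
  filter_upwards [(h.const_smul c).kernelOp_ae_eq f, h.kernelOp_ae_eq f,
    Lp.coeFn_smul c (kernelOp μ ν k f)] with x h1 h2 h3
  rw [h1, h3, Pi.smul_apply, h2, smul_eq_mul, ← integral_const_mul]
  simp only [Pi.smul_apply, smul_eq_mul, mul_assoc]

/-- The kernel `exp(i z p)` cut off to the set `Ω`. -/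
def waveKernel (Ω : Set (X × Y)) (p : X × Y → ℝ) (z : ℂ) : X × Y → ℂ :=
  Ω.indicator fun q => Complex.exp (Complex.I * z * p q)

theorem measurable_waveKernel {Ω : Set (X × Y)} (hΩ : MeasurableSet Ω) {p : X × Y → ℝ}
    (hp : Measurable p) (z : ℂ) : Measurable (waveKernel Ω p z) :=
  Measurable.indicator (by fun_prop) hΩ

/-- With bounded phase and support of finite measure, the Taylor remainder of the kernel in z is
uniformly O(|h|²), and Schur's test turns this into an operator norm bound. No sign of Im z is
required, which is what allows continuation below the real axis. -/
theorem differentiable_kernelOp_waveKernel {Ω : Set (X × Y)} (hΩ : MeasurableSet Ω)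
    {p : X × Y → ℝ} (hp : Measurable p) {B : ℝ} (hB : ∀ q ∈ Ω, |p q| ≤ B) {A : Set X} {A' : Set Y}
    (hA : MeasurableSet A) (hA' : MeasurableSet A') (hμ : μ A ≠ ∞) (hν : ν A' ≠ ∞)
    (hs : Ω ⊆ A ×ˢ A') : Differentiable ℂ fun z => kernelOp μ ν (waveKernel Ω p z) := by
  set B' : ℝ := max B 1 with hB'
  have hB0 : 0 < B' := lt_max_of_lt_right one_pos
  have hpB : ∀ q ∈ Ω, |p q| ≤ B' := fun q hq => (hB q hq).trans (le_max_left _ _)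
  have hexp : ∀ z, ∀ q ∈ Ω, ‖Complex.exp (Complex.I * z * p q)‖ ≤ Real.exp (‖z‖ * B') := by
    intro z q hq
    refine (Complex.norm_exp_le_exp_norm _).trans ?_
    gcongr
    rw [norm_mul, norm_mul, Complex.norm_I, one_mul, Complex.norm_real]
    gcongr
    exact hpB q hq
  have hzero : ∀ (k : X × Y → ℂ) q, q ∉ A ×ˢ A' → Ω.indicator k q = 0 := fun k q hq =>
    indicator_of_notMem (fun h => hq (hs h)) _
  have hbd : ∀ (k : X × Y → ℂ) (c : ℝ) (hc : 0 ≤ c), (∀ q ∈ Ω, ‖k q‖ ≤ c) → Measurable k →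
      IsSchur μ ν (Ω.indicator k) (c.toNNReal * ((μ A).toNNReal + (ν A').toNNReal)) := by
    intro k c hc hk hkm
    refine isSchur_of_bounded (hkm.indicator hΩ) hA hA' hμ hν (fun q => ?_) (hzero k)
    by_cases hq : q ∈ Ω
    · rw [indicator_of_mem hq]
      rw [← NNReal.coe_le_coe, Real.coe_toNNReal _ hc]
      exact hk q hq
    · rw [indicator_of_notMem hq, nnnorm_zero]
      exact zero_le
  intro z
  set k₁ : X × Y → ℂ := Ω.indicator fun q =>
    Complex.I * p q * Complex.exp (Complex.I * z * p q) with hk₁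
  have hS : ∀ z, IsSchur μ ν (waveKernel Ω p z) _ := fun z =>
    hbd _ (Real.exp (‖z‖ * B')) (Real.exp_pos _).le (hexp z) (by fun_prop)
  have hS₁ := hbd (fun q => Complex.I * p q * Complex.exp (Complex.I * z * p q))
    (B' * Real.exp (‖z‖ * B')) (by positivity) (fun q hq => by
      rw [norm_mul, norm_mul, Complex.norm_I, one_mul, Complex.norm_real]
      gcongr
      · exact hpB q hq
      · exact hexp z q hq) (by fun_prop)
  refine HasDerivAt.differentiableAt (f' := kernelOp μ ν k₁) ?_
  rw [hasDerivAt_iff_isLittleO_nhds_zero]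
  refine Asymptotics.IsBigO.trans_isLittleO (g := fun h : ℂ => h ^ 2) ?_
    (Asymptotics.isLittleO_pow_id one_lt_two)
  set N : NNReal := (μ A).toNNReal + (ν A').toNNReal with hN
  refine Asymptotics.IsBigO.of_bound (Real.exp (‖z‖ * B') * B' ^ 2 * N) ?_
  -- For |h| < 1/B' the exponent ihp has modulus at most 1, the range where |e^w - 1 - w| ≤ |w|².
  filter_upwards [Metric.ball_mem_nhds (0 : ℂ) (inv_pos.2 hB0)] with h hh
  rw [mem_ball_zero_iff, inv_eq_one_div, lt_div_iff₀ hB0] at hh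
  rw [← (hS (z + h)).kernelOp_sub (hS z), ← hS₁.kernelOp_const_smul h,
    ← ((hS (z + h)).sub (hS z)).kernelOp_sub (hS₁.const_smul h)]
  have heq : waveKernel Ω p (z + h) - waveKernel Ω p z - h • k₁ = Ω.indicator fun q =>
      Complex.exp (Complex.I * z * p q) * (Complex.exp (Complex.I * h * p q) - 1 -
        Complex.I * h * p q) := by
    funext q
    by_cases hq : q ∈ Ω
    · simp only [waveKernel, hk₁, Pi.sub_apply, Pi.smul_apply, indicator_of_mem hq, smul_eq_mul]
      have : Complex.I * (z + h) * p q = Complex.I * z * p q + Complex.I * h * p q := by ring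
      rw [this, Complex.exp_add]
      ring
    · simp [waveKernel, hk₁, indicator_of_notMem hq]
  have hfin := hbd (fun q => Complex.exp (Complex.I * z * p q) *
      (Complex.exp (Complex.I * h * p q) - 1 - Complex.I * h * p q))
    (Real.exp (‖z‖ * B') * (B' * ‖h‖) ^ 2) (by positivity) (fun q hq => by
      have h1 : ‖Complex.I * h * p q‖ ≤ B' * ‖h‖ := by
        rw [norm_mul, norm_mul, Complex.norm_I, one_mul, Complex.norm_real, mul_comm]
        gcongr
        exact hpB q hq
      rw [norm_mul]
      refine mul_le_mul (hexp z q hq) ?_ (norm_nonneg _) (Real.exp_pos _).le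
      refine (Complex.norm_exp_sub_one_sub_id_le (h1.trans (by linarith))).trans ?_
      gcongr) (by fun_prop)
  rw [heq]
  refine hfin.norm_kernelOp_le.trans_eq ?_
  rw [norm_pow, NNReal.coe_mul, Real.coe_toNNReal _ (by positivity)]
  ring

end Kernel

/-! ### Waves on an edge, and vertex conditions in terms of amplitudes. -/

section Edge

variable {V K M : Type*}

/-- A retraction of the line onto an edge segment. -/
theorem exists_retraction (ℓ : M → ℝ) (hℓ : ∀ m, 0 < ℓ m) (e : K ⊕ M) :
    ∃ r : ℝ → ℝ, Continuous r ∧ (∀ x, r x ∈ edgeSegment ℓ e) ∧ ∀ x ∈ edgeSegment ℓ e, r x = x := by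
  rcases e with k | m
  · exact ⟨fun x => max 0 x, by fun_prop, fun x => show (0 : ℝ) ≤ max 0 x from le_max_left _ _,
      fun x hx => max_eq_right hx⟩
  · refine ⟨fun x => max 0 (min x (ℓ m)), by fun_prop,
      fun x => ⟨le_max_left _ _, max_le (hℓ m).le (min_le_right _ _)⟩, fun x hx => ?_⟩
    have hx : x ∈ Icc 0 (ℓ m) := hx
    simp [hx.1, hx.2]

theorem convex_edgeSegment (ℓ : M → ℝ) (e : K ⊕ M) : Convex ℝ (edgeSegment ℓ e) := by
  rcases e with k | m
  · exact convex_Ici 0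
  · exact convex_Icc 0 (ℓ m)

theorem measurableSet_edgeSegment (ℓ : M → ℝ) (e : K ⊕ M) : MeasurableSet (edgeSegment ℓ e) := by
  rcases e with k | m
  · exact measurableSet_Ici
  · exact measurableSet_Icc

theorem nonneg_of_mem_edgeSegment {ℓ : M → ℝ} {e : K ⊕ M} {x : ℝ} (hx : x ∈ edgeSegment ℓ e) :
    0 ≤ x := by
  rcases e with k | m
  · exact hx
  · exact hx.1

theorem zero_mem_edgeSegment {ℓ : M → ℝ} (hℓ : ∀ m, 0 < ℓ m) (e : K ⊕ M) :
    0 ∈ edgeSegment ℓ e := by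
  rcases e with k | m
  · exact self_mem_Ici
  · exact ⟨le_rfl, (hℓ m).le⟩

/-- An indefinite integral of a function continuous on an edge is differentiable there. -/
theorem hasDerivWithinAt_of_eq_integral {ℓ : M → ℝ} (hℓ : ∀ m, 0 < ℓ m) {e : K ⊕ M} {F g : ℝ → ℂ}
    (hg : ContinuousOn g (edgeSegment ℓ e))
    (h : ∀ x ∈ edgeSegment ℓ e, F x = F 0 + ∫ y in (0 : ℝ)..x, g y) :
    ∀ x ∈ edgeSegment ℓ e, HasDerivWithinAt F (g x) (edgeSegment ℓ e) x := by
  -- Composing with the retraction extends the integrand continuously to the line, so the two-sided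
  -- fundamental theorem of calculus applies also at the end points.
  obtain ⟨r, hr, hrm, hre⟩ := exists_retraction ℓ hℓ e
  have hc : Continuous fun y => g (r y) := hg.comp_continuous hr hrm
  intro x hx
  have h1 : HasDerivAt (fun x => F 0 + ∫ y in (0 : ℝ)..x, g (r y)) (g x) x := by
    have := (hc.integral_hasStrictDerivAt 0 x).hasDerivAt.const_add (F 0)
    rwa [hre x hx] at this
  have h2 : ∀ x ∈ edgeSegment ℓ e, F x = F 0 + ∫ y in (0 : ℝ)..x, g (r y) := by
    intro x hx
    rw [h x hx]
    congr 1
    refine intervalIntegral.integral_congr_ae (Eventually.of_forall fun y hy => ?_)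
    rw [hre y (uIoc_subset_edgeSegment ℓ e hx hy)]
  exact h1.hasDerivWithinAt.congr h2 (h2 x hx)

theorem eq_const_of_hasDerivWithinAt_zero {ℓ : M → ℝ} (hℓ : ∀ m, 0 < ℓ m) {e : K ⊕ M} {F : ℝ → ℂ}
    (h : ∀ x ∈ edgeSegment ℓ e, HasDerivWithinAt F 0 (edgeSegment ℓ e) x) :
    ∀ x ∈ edgeSegment ℓ e, F x = F 0 := by
  intro x hx
  have := (convex_edgeSegment ℓ e).norm_image_sub_le_of_norm_hasDerivWithin_le (C := 0) h
    (fun _ _ => by simp) (zero_mem_edgeSegment hℓ e) hx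
  rwa [zero_mul, norm_le_zero_iff, sub_eq_zero] at this

theorem hasDerivAt_exp_mul (c : ℂ) (x : ℝ) :
    HasDerivAt (fun x : ℝ => Complex.exp (c * x)) (c * Complex.exp (c * x)) x := by
  have h1 : HasDerivAt (fun x : ℝ => c * (x : ℂ)) (c * 1) x :=
    (Complex.ofRealCLM.hasDerivAt (x := x)).const_mul _
  have h2 := h1.cexp
  rwa [mul_one, mul_comm] at h2

/-- Solutions of `-u'' = z² u` on an edge are superpositions of two waves. -/
theorem IsH2.exists_wave {ℓ : M → ℝ} (hℓ : ∀ m, 0 < ℓ m) {e : K ⊕ M} {z : ℂ} (hz : z ≠ 0)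
    {u : Lp ℂ 2 (volume.restrict (edgeSegment ℓ e))} {U D : ℝ → ℂ}
    (h : IsH2 (edgeSegment ℓ e) u U D (-(z ^ 2 • u))) :
    ∃ p q : ℂ, ∀ x ∈ edgeSegment ℓ e,
      U x = p * Complex.exp (Complex.I * z * x) + q * Complex.exp (-(Complex.I * z) * x) ∧
      D x = Complex.I * z * (p * Complex.exp (Complex.I * z * x)
        - q * Complex.exp (-(Complex.I * z) * x)) := by
  have hUc : ContinuousOn U (edgeSegment ℓ e) := fun x hx => (h.hasDeriv x hx).continuousWithinAt
  have hg : ⇑(-(z ^ 2 • u)) =ᵐ[volume.restrict (edgeSegment ℓ e)] fun x => -(z ^ 2 * U x) := by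
    filter_upwards [Lp.coeFn_neg (z ^ 2 • u), Lp.coeFn_smul (z ^ 2) u, h.ae_eq] with x h1 h2 h3
    rw [h1, Pi.neg_apply, h2, Pi.smul_apply, h3, smul_eq_mul]
  have hD : ∀ x ∈ edgeSegment ℓ e, HasDerivWithinAt D (-(z ^ 2 * U x)) (edgeSegment ℓ e) x := by
    refine hasDerivWithinAt_of_eq_integral (g := fun x => -(z ^ 2 * U x)) hℓ
      (continuousOn_const.mul hUc).neg fun x hx => ?_
    rw [h.eq_integral x hx, intervalIntegral_congr_of_ae hg (uIoc_subset_edgeSegment ℓ e hx)]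
  have hI : Complex.I * Complex.I = -1 := Complex.I_mul_I
  -- The factorization d²/dx² + z² = (d/dx + c)(d/dx - c) makes e^(cx) an integrating factor for D -
  -- cU. The two roots c = ±iz determine U and D.
  have key : ∀ c : ℂ, c ^ 2 = -z ^ 2 → ∀ x ∈ edgeSegment ℓ e,
      (D x - c * U x) * Complex.exp (c * x) = D 0 - c * U 0 := by
    intro c hc x hx
    have := eq_const_of_hasDerivWithinAt_zero hℓ
      (F := fun x => (D x - c * U x) * Complex.exp (c * x)) (fun x hx => by
        have h1 := ((hD x hx).sub ((h.hasDeriv x hx).const_mul c)).mul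
          (hasDerivAt_exp_mul c x).hasDerivWithinAt
        convert! h1 using 1
        simp only [Pi.sub_apply]
        linear_combination U x * Complex.exp (c * x) * hc) x hx
    simpa using this
  have h1 := key (Complex.I * z) (by rw [mul_pow, Complex.I_sq]; ring)
  have h2 := key (-(Complex.I * z)) (by rw [neg_sq, mul_pow, Complex.I_sq]; ring)
  refine ⟨(D 0 + Complex.I * z * U 0) / (2 * (Complex.I * z)),
    -((D 0 - Complex.I * z * U 0) / (2 * (Complex.I * z))), fun x hx => ?_⟩
  have hiz : Complex.I * z ≠ 0 := mul_ne_zero Complex.I_ne_zero hz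
  have h3 : Complex.exp (Complex.I * z * x) * Complex.exp (-(Complex.I * z) * x) = 1 := by
    rw [← Complex.exp_add]
    simp
  have h1x := h1 x hx
  have h2x := h2 x hx
  generalize Complex.exp (Complex.I * z * x) = E at *
  generalize Complex.exp (-(Complex.I * z) * x) = E' at *
  generalize Complex.I * z = w at *
  have h4 : D x - w * U x = (D 0 - w * U 0) * E' := by
    linear_combination E' * h1x - (D x - w * U x) * h3
  have h5 : D x + w * U x = (D 0 + w * U 0) * E := by
    linear_combination E * h2x - (D x + w * U x) * h3
  constructor
  · field_simp
    linear_combination h5 - h4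
  · field_simp
    linear_combination h5 + h4

/-- On a lead only the outgoing wave can be square integrable together with its derivative. -/
theorem coeff_eq_zero_of_memLp {z p q : ℂ} (hz : z ≠ 0) (hz' : 0 ≤ z.im) {U D : ℝ → ℂ}
    (hU : MemLp U 2 (volume.restrict (Ici 0))) (hD : MemLp D 2 (volume.restrict (Ici 0)))
    (h : ∀ x ∈ Ici (0 : ℝ),
      U x = p * Complex.exp (Complex.I * z * x) + q * Complex.exp (-(Complex.I * z) * x) ∧
      D x = Complex.I * z * (p * Complex.exp (Complex.I * z * x)
        - q * Complex.exp (-(Complex.I * z) * x))) : q = 0 := by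
  -- D - izU isolates the incoming wave, whose modulus is at least |2zq| because Im z ≥ 0. A
  -- constant is square integrable on a half-line only if it is zero.
  have h1 : MemLp (fun _ : ℝ => 2 * z * q) 2 (volume.restrict (Ici 0)) := by
    refine MemLp.of_le (hD.sub (hU.const_mul (Complex.I * z))) aestronglyMeasurable_const ?_
    filter_upwards [ae_restrict_mem measurableSet_Ici] with x hx
    have hx' : 0 ≤ x := hx
    have h2 : (D - fun x => Complex.I * z * U x) x
        = -Complex.I * (2 * z * q) * Complex.exp (-(Complex.I * z) * x) := by
      rw [Pi.sub_apply, (h x hx).1, (h x hx).2]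
      ring
    rw [h2]
    simp only [norm_mul, norm_neg, Complex.norm_I, one_mul, Complex.norm_exp]
    refine le_mul_of_one_le_right (by positivity) (Real.one_le_exp ?_)
    simp
    positivity
  rw [memLp_const_iff (by norm_num) (by norm_num)] at h1
  simpa [hz] using h1

/-- A twice differentiable function is in `H²`. -/
theorem IsH2.of_hasDerivAt {ℓ : M → ℝ} {e : K ⊕ M}
    {u g : Lp ℂ 2 (volume.restrict (edgeSegment ℓ e))} {U D W : ℝ → ℂ}
    (hu : u =ᵐ[volume.restrict (edgeSegment ℓ e)] U)
    (hg : g =ᵐ[volume.restrict (edgeSegment ℓ e)] W) (hU : ∀ x, HasDerivAt U (D x) x)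
    (hD : ∀ x, HasDerivAt D (W x) x) (hW : Continuous W)
    (hm : MemLp D 2 (volume.restrict (edgeSegment ℓ e))) : IsH2 (edgeSegment ℓ e) u U D g where
  ae_eq := hu
  hasDeriv x _ := (hU x).hasDerivWithinAt
  memLp := hm
  eq_integral x hx := by
    rw [intervalIntegral_congr_of_ae hg (uIoc_subset_edgeSegment ℓ e hx),
      intervalIntegral.integral_eq_sub_of_hasDerivAt (fun y _ => hD y)
        (hW.intervalIntegrable _ _)]
    ring

/-- The edge containing an edge end. -/
def edgeOf : EdgeEnd K M → K ⊕ M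
  | .inl k => .inl k
  | .inr (.inl m) => .inr m
  | .inr (.inr m) => .inr m

variable [Fintype K] [Fintype M]

/-- `U` has edgewise derivative `D` and the outgoing and incoming amplitudes `a`, `b` at the edge
ends. -/
structure HasAmplitudes (ℓ : M → ℝ) (z : ℂ) (U D : K ⊕ M → ℝ → ℂ) (a b : EdgeEnd K M → ℂ) :
    Prop where
  lead : ∀ k, U (.inl k) 0 = a (.inl k) + b (.inl k)
  src : ∀ m, U (.inr m) 0 = a (.inr (.inl m)) + b (.inr (.inl m))
  tgt : ∀ m, U (.inr m) (ℓ m) = a (.inr (.inr m)) + b (.inr (.inr m))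
  deriv_lead : ∀ k, D (.inl k) 0 = Complex.I * z * (a (.inl k) - b (.inl k))
  deriv_src : ∀ m, D (.inr m) 0 = Complex.I * z * (a (.inr (.inl m)) - b (.inr (.inl m)))
  deriv_tgt : ∀ m, D (.inr m) (ℓ m) = -(Complex.I * z * (a (.inr (.inr m)) - b (.inr (.inr m))))

-- With these conventions the outward normal derivative is -iz(a - b) at every end, whatever the
-- orientation of the edge.
open Classical in
theorem HasAmplitudes.normalSum_eq {ℓ : M → ℝ} {z : ℂ} {U D : K ⊕ M → ℝ → ℂ}
    {a b : EdgeEnd K M → ℂ} (h : HasAmplitudes ℓ z U D a b) (G : LeadGraph V K M) (v : V) :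
    normalSum G ℓ D v = -(Complex.I * z * G.sumAt v (a - b)) := by
  rw [normalSum, LeadGraph.sumAt_apply, Fintype.sum_sum_type, Fintype.sum_sum_type, ← add_assoc,
    mul_add, mul_add, neg_add, neg_add]
  simp only [Finset.mul_sum, ← Finset.sum_neg_distrib]
  congr 1
  · congr 1
    · refine Finset.sum_congr rfl fun i _ => ?_
      by_cases hv : G.base i = v
      · rw [if_pos hv, if_pos (show G.endVertex (.inl i) = v from hv), h.deriv_lead, Pi.sub_apply]
      · rw [if_neg hv, if_neg (show ¬G.endVertex (.inl i) = v from hv), mul_zero, neg_zero]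
    · refine Finset.sum_congr rfl fun i _ => ?_
      by_cases hv : G.src i = v
      · rw [if_pos hv, if_pos (show G.endVertex (.inr (.inl i)) = v from hv), h.deriv_src, Pi.sub_apply]
      · rw [if_neg hv, if_neg (show ¬G.endVertex (.inr (.inl i)) = v from hv), mul_zero, neg_zero]
  · refine Finset.sum_congr rfl fun i _ => ?_
    by_cases hv : G.tgt i = v
    · rw [if_pos hv, if_pos (show G.endVertex (.inr (.inr i)) = v from hv), h.deriv_tgt, Pi.sub_apply]
    · rw [if_neg hv, if_neg (show ¬G.endVertex (.inr (.inr i)) = v from hv), mul_zero, neg_zero]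

/-- Amplitudes related by the scattering map satisfy the vertex conditions. -/
theorem HasAmplitudes.vertex_conditions {ℓ : M → ℝ} {z : ℂ} {U D : K ⊕ M → ℝ → ℂ}
    {a b : EdgeEnd K M → ℂ} (h : HasAmplitudes ℓ z U D a b) {G : LeadGraph V K M}
    (hab : a = G.scatter b) :
    (∃ val : V → ℂ, (∀ k, U (.inl k) 0 = val (G.base k)) ∧
      (∀ m, U (.inr m) 0 = val (G.src m)) ∧ ∀ m, U (.inr m) (ℓ m) = val (G.tgt m)) ∧
    ∀ v, normalSum G ℓ D v = 0 := by
  classical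
  have h1 : ∀ d, a d + b d = 2 / G.sumAt (G.endVertex d) 1 * G.sumAt (G.endVertex d) b := by
    intro d
    rw [hab, LeadGraph.scatter_apply]
    ring
  refine ⟨⟨fun v => 2 / G.sumAt v 1 * G.sumAt v b, fun k => ?_, fun m => ?_, fun m => ?_⟩,
    fun v => ?_⟩
  · rw [h.lead, h1]
    rfl
  · rw [h.src, h1]
    rfl
  · rw [h.tgt, h1]
    rfl
  · rw [h.normalSum_eq, map_sub]
    by_cases hv : ∃ d, G.endVertex d = v
    · obtain ⟨d, rfl⟩ := hv
      rw [hab, LeadGraph.sumAt_scatter, sub_self, mul_zero, neg_zero]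
    -- An isolated vertex imposes an empty condition.
    · have h2 : ∀ c, G.sumAt v c = 0 := by
        intro c
        rw [LeadGraph.sumAt_apply]
        exact Finset.sum_eq_zero fun d _ => if_neg fun hd => hv ⟨d, hd⟩
      simp [h2]

/-- The vertex conditions force the amplitudes to be related by the scattering map. -/
theorem HasAmplitudes.eq_scatter {ℓ : M → ℝ} {z : ℂ} (hz : z ≠ 0) {U D : K ⊕ M → ℝ → ℂ}
    {a b : EdgeEnd K M → ℂ} (h : HasAmplitudes ℓ z U D a b) {G : LeadGraph V K M} {val : V → ℂ}
    (h1 : ∀ k, U (.inl k) 0 = val (G.base k)) (h2 : ∀ m, U (.inr m) 0 = val (G.src m))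
    (h3 : ∀ m, U (.inr m) (ℓ m) = val (G.tgt m)) (h4 : ∀ v, normalSum G ℓ D v = 0) :
    a = G.scatter b := by
  have hval : ∀ d, a d + b d = val (G.endVertex d) := by
    rintro (k | m | m)
    · rw [← h.lead, h1]
      rfl
    · rw [← h.src, h2]
      rfl
    · rw [← h.tgt, h3]
      rfl
  funext d
  have h5 : G.sumAt (G.endVertex d) (a - b) = 0 := by
    have := h4 (G.endVertex d)
    rw [h.normalSum_eq, neg_eq_zero, mul_eq_zero] at this
    exact this.resolve_left (mul_ne_zero Complex.I_ne_zero hz)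
  -- At this vertex a = val - b by continuity. The Kirchhoff condition becomes deg · val = 2∑b,
  -- which determines `val` and hence a.
  have h6 : G.sumAt (G.endVertex d) (a - b)
      = G.sumAt (G.endVertex d) (val (G.endVertex d) • 1 - (2 : ℂ) • b) := by
    refine G.sumAt_congr fun d' hd' => ?_
    have := hval d'
    rw [hd'] at this
    simp only [Pi.sub_apply, Pi.smul_apply, Pi.one_apply, smul_eq_mul]
    linear_combination this
  rw [h6, map_sub, map_smul, map_smul, smul_eq_mul, smul_eq_mul] at h5
  have h7 := G.sumAt_endVertex_one_ne_zero d
  have h8 := hval d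
  rw [LeadGraph.scatter_apply]
  field_simp
  linear_combination G.sumAt (G.endVertex d) 1 * h8 + h5

/-- An eigenfunction at `z²`, `Im z ≥ 0`, produces a null vector of the secular matrix. -/
theorem exists_secular_eq_zero_of_eigenfunction {G : LeadGraph V K M} {ℓ : M → ℝ}
    (hℓ : ∀ m, 0 < ℓ m) {z : ℂ} (hz : z ≠ 0) (hz' : 0 ≤ z.im) {u : L2 K ℓ} (hu : u ≠ 0)
    (h : IsNegLaplacian G ℓ u (z ^ 2 • u)) :
    ∃ a : EdgeEnd K M → ℂ, a ≠ 0 ∧ (secular G ℓ z).mulVec a = 0 := by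
  obtain ⟨U, D, hH, ⟨val, h1, h2, h3⟩, h4⟩ := h
  have hw : ∀ e, ∃ p q : ℂ, ∀ x ∈ edgeSegment ℓ e,
      U e x = p * Complex.exp (Complex.I * z * x) + q * Complex.exp (-(Complex.I * z) * x) ∧
      D e x = Complex.I * z * (p * Complex.exp (Complex.I * z * x)
        - q * Complex.exp (-(Complex.I * z) * x)) := fun e => (hH e).exists_wave hℓ hz
  choose p q hpq using hw
  have hq : ∀ k, q (.inl k) = 0 := by
    intro k
    have hUm : MemLp (U (.inl k)) 2 (volume.restrict (edgeSegment ℓ (.inl k))) :=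
      (memLp_congr_ae (hH (.inl k)).ae_eq).1 (Lp.memLp _)
    exact coeff_eq_zero_of_memLp hz hz' hUm (hH (.inl k)).memLp (hpq (.inl k))
  -- At a target end, q e^(-izx) = q e^(-izℓ) · e^(iz(ℓ - x)) is read as a wave leaving that end.
  -- The leads have no incoming part, matching the zero transit factor.
  set a : EdgeEnd K M → ℂ := fun d => match d with
    | .inl k => p (.inl k)
    | .inr (.inl m) => p (.inr m)
    | .inr (.inr m) => q (.inr m) * Complex.exp (-(Complex.I * z) * ℓ m) with ha
  have hexp : ∀ m, Complex.exp (Complex.I * z * ℓ m) * Complex.exp (-(Complex.I * z) * ℓ m) = 1 := by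
    intro m
    rw [← Complex.exp_add]
    simp
  have hb1 : ∀ k, propagate ℓ z a (.inl k) = 0 := fun k => by simp [propagate_apply, transit]
  have hb2 : ∀ m, propagate ℓ z a (.inr (.inl m)) = q (.inr m) := by
    intro m
    simp only [propagate_apply, transit, oppositeEnd, ha]
    linear_combination q (.inr m) * hexp m
  have hb3 : ∀ m, propagate ℓ z a (.inr (.inr m)) = p (.inr m) * Complex.exp (Complex.I * z * ℓ m) := by
    intro m
    simp only [propagate_apply, transit, oppositeEnd, ha]
    ring
  have hamp : HasAmplitudes ℓ z U D a (propagate ℓ z a) := by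
    have h0 := fun e => hpq e 0 (zero_mem_edgeSegment hℓ e)
    have hl := fun m => hpq (.inr m) (ℓ m) ⟨(hℓ m).le, le_rfl⟩
    refine ⟨fun k => ?_, fun m => ?_, fun m => ?_, fun k => ?_, fun m => ?_, fun m => ?_⟩
    · rw [hb1, (h0 _).1, hq]
      simp [ha]
    · rw [hb2, (h0 _).1]
      simp [ha]
    · rw [hb3, (hl m).1]
      simp only [ha]
      ring
    · rw [hb1, (h0 _).2, hq]
      simp [ha]
    · rw [hb2, (h0 _).2]
      simp [ha]
    · rw [hb3, (hl m).2]
      simp only [ha]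
      ring
  refine ⟨a, fun ha0 => hu ?_, secular_mulVec_eq_zero_iff.2 (hamp.eq_scatter hz h1 h2 h3 h4)⟩
  have hp : ∀ e, p e = 0 := by
    rintro (k | m)
    · exact congrFun ha0 (.inl k)
    · exact congrFun ha0 (.inr (.inl m))
  have hq' : ∀ e, q e = 0 := by
    rintro (k | m)
    · exact hq k
    · have : q (.inr m) * Complex.exp (-(Complex.I * z) * ℓ m) = 0 := congrFun ha0 (.inr (.inr m))
      exact (mul_eq_zero.1 this).resolve_right (Complex.exp_ne_zero _)
  ext1 e
  refine Lp.ext ?_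
  refine (hH e).ae_eq.trans ?_
  have h5 : U e =ᵐ[volume.restrict (edgeSegment ℓ e)] 0 := by
    filter_upwards [ae_restrict_mem (measurableSet_edgeSegment ℓ e)] with x hx
    rw [(hpq e x hx).1, hp, hq']
    simp
  exact h5.trans (Lp.coeFn_zero _ _ _).symm

end Edge

/-! ### The free Green function on an edge. -/

section Green

variable {K M : Type*}

/-- Variation of parameters for `w' = c w + h`, `w(0) = 0`, in integrated form. -/
theorem exp_mul_integral_eq (c : ℂ) {h : ℝ → ℂ} {x : ℝ} (hx : 0 ≤ x)
    (hh : IntervalIntegrable h volume 0 x) :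
    Complex.exp (c * x) * ∫ y in (0 : ℝ)..x, Complex.exp (-c * y) * h y =
      ∫ s in (0 : ℝ)..x,
        (c * (Complex.exp (c * s) * ∫ y in (0 : ℝ)..s, Complex.exp (-c * y) * h y) + h s) := by
  set H : ℝ → ℂ := fun y => Complex.exp (-c * y) * h y with hH
  have hHi : IntervalIntegrable H volume 0 x := hh.continuousOn_mul (by fun_prop)
  set μ := volume.restrict (Ioc 0 x) with hμ
  have hHμ : Integrable H μ := by
    rw [intervalIntegrable_iff_integrableOn_Ioc_of_le hx] at hHi
    exact hHi
  have hEμ : Integrable (fun s : ℝ => c * Complex.exp (c * s)) μ := by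
    have : IntervalIntegrable (fun s : ℝ => c * Complex.exp (c * s)) volume 0 x :=
      Continuous.intervalIntegrable (by fun_prop) _ _
    rwa [intervalIntegrable_iff_integrableOn_Ioc_of_le hx] at this
  have hmeas : MeasurableSet {p : ℝ × ℝ | p.2 ≤ p.1} :=
    measurableSet_le measurable_snd measurable_fst
  have hF : Integrable ({p : ℝ × ℝ | p.2 ≤ p.1}.indicator
      fun p => c * Complex.exp (c * p.1) * H p.2) (μ.prod μ) :=
    (hEμ.mul_prod hHμ).indicator hmeas
  -- The source is merely integrable, so the product rule is replaced by Fubini on the triangle y ≤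
  -- s ≤ x. The integral over s is elementary.
  have hswap := integral_integral_swap (f := fun s y => {p : ℝ × ℝ | p.2 ≤ p.1}.indicator
      (fun p => c * Complex.exp (c * p.1) * H p.2) (s, y)) hF
  have hL : ∀ s ∈ Ioc 0 x, ∫ y, {p : ℝ × ℝ | p.2 ≤ p.1}.indicator
      (fun p => c * Complex.exp (c * p.1) * H p.2) (s, y) ∂μ
      = c * (Complex.exp (c * s) * ∫ y in (0 : ℝ)..s, H y) := by
    intro s hs
    have h1 : (fun y => {p : ℝ × ℝ | p.2 ≤ p.1}.indicator
        (fun p => c * Complex.exp (c * p.1) * H p.2) (s, y))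
        = (Iic s).indicator fun y => c * Complex.exp (c * s) * H y := by
      funext y
      simp [indicator_apply]
    rw [h1, hμ, setIntegral_indicator measurableSet_Iic, Ioc_inter_Iic, min_eq_right hs.2,
      integral_const_mul, intervalIntegral.integral_of_le hs.1.le, mul_assoc]
  have hR : ∀ y ∈ Ioc 0 x, ∫ s, {p : ℝ × ℝ | p.2 ≤ p.1}.indicator
      (fun p => c * Complex.exp (c * p.1) * H p.2) (s, y) ∂μ
      = Complex.exp (c * x) * H y - h y := by
    intro y hy
    have h1 : (fun s => {p : ℝ × ℝ | p.2 ≤ p.1}.indicator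
        (fun p => c * Complex.exp (c * p.1) * H p.2) (s, y))
        = (Ici y).indicator fun s => c * Complex.exp (c * s) * H y := by
      funext s
      simp [indicator_apply]
    have h2 : Ioc 0 x ∩ Ici y = Icc y x := by
      ext s
      simp only [mem_inter_iff, mem_Ioc, mem_Ici, mem_Icc]
      exact ⟨fun h => ⟨h.2, h.1.2⟩, fun h => ⟨⟨hy.1.trans_le h.1, h.2⟩, h.1⟩⟩
    rw [h1, hμ, setIntegral_indicator measurableSet_Ici, h2, integral_mul_const,
      integral_Icc_eq_integral_Ioc, ← intervalIntegral.integral_of_le hy.2,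
      intervalIntegral.integral_eq_sub_of_hasDerivAt (fun s _ => hasDerivAt_exp_mul c s)
        (Continuous.intervalIntegrable (by fun_prop) _ _), sub_mul]
    congr 1
    rw [hH, ← mul_assoc, ← Complex.exp_add]
    simp
  rw [setIntegral_congr_fun measurableSet_Ioc hL, setIntegral_congr_fun measurableSet_Ioc hR,
    ← intervalIntegral.integral_of_le hx, ← intervalIntegral.integral_of_le hx,
    intervalIntegral.integral_sub (hHi.const_mul _) hh,
    intervalIntegral.integral_const_mul (Complex.exp (c * x))] at hswap
  have hcont : ContinuousOn (fun s : ℝ => c * (Complex.exp (c * s) * ∫ y in (0 : ℝ)..s, H y))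
      (uIcc 0 x) := by
    have := intervalIntegral.continuousOn_primitive_interval' hHi left_mem_uIcc
    fun_prop
  rw [intervalIntegral.integral_add hcont.intervalIntegrable hh, hswap]
  ring

/-- The part of the Green function coming from sources to the left. -/
def greenLeft (z : ℂ) (h : ℝ → ℂ) (x : ℝ) : ℂ :=
  Complex.exp (Complex.I * z * x) * ∫ y in (0 : ℝ)..x, Complex.exp (-(Complex.I * z) * y) * h y

/-- The part of the Green function coming from sources to the right, with total `J`. -/
def greenRight (z : ℂ) (J : ℂ) (h : ℝ → ℂ) (x : ℝ) : ℂ :=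
  Complex.exp (-(Complex.I * z) * x) *
    (J - ∫ y in (0 : ℝ)..x, Complex.exp (Complex.I * z * y) * h y)

variable {h : ℝ → ℂ}

theorem continuous_greenLeft (hh : ∀ a b, IntervalIntegrable h volume a b) (z : ℂ) :
    Continuous (greenLeft z h) := by
  have := intervalIntegral.continuous_primitive (μ := volume)
    (f := fun y : ℝ => Complex.exp (-(Complex.I * z) * y) * h y)
    (fun a b => (hh a b).continuousOn_mul (by fun_prop)) 0
  unfold greenLeft
  fun_prop

theorem continuous_greenRight (hh : ∀ a b, IntervalIntegrable h volume a b) (z J : ℂ) :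
    Continuous (greenRight z J h) := by
  have := intervalIntegral.continuous_primitive (μ := volume)
    (f := fun y : ℝ => Complex.exp (Complex.I * z * y) * h y)
    (fun a b => (hh a b).continuousOn_mul (by fun_prop)) 0
  unfold greenRight
  fun_prop

theorem greenLeft_eq_integral (hh : ∀ a b, IntervalIntegrable h volume a b) (z : ℂ) {x : ℝ}
    (hx : 0 ≤ x) :
    greenLeft z h x = ∫ s in (0 : ℝ)..x, (Complex.I * z * greenLeft z h s + h s) :=
  exp_mul_integral_eq (Complex.I * z) hx (hh 0 x)

theorem greenRight_eq_integral (hh : ∀ a b, IntervalIntegrable h volume a b) (z J : ℂ) {x : ℝ}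
    (hx : 0 ≤ x) :
    greenRight z J h x = J + ∫ s in (0 : ℝ)..x, (-(Complex.I * z) * greenRight z J h s - h s) := by
  set k : ℝ → ℂ := fun s => Complex.exp (-(Complex.I * z) * s) *
    ∫ y in (0 : ℝ)..s, Complex.exp (Complex.I * z * y) * h y with hk
  have h1 := exp_mul_integral_eq (-(Complex.I * z)) hx (hh 0 x)
  simp only [neg_neg] at h1
  have hkc : Continuous k := by
    have := intervalIntegral.continuous_primitive (μ := volume)
      (f := fun y : ℝ => Complex.exp (Complex.I * z * y) * h y)
      (fun a b => (hh a b).continuousOn_mul (by fun_prop)) 0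
    fun_prop
  have h2 : ∫ s in (0 : ℝ)..x, -(Complex.I * z) * Complex.exp (-(Complex.I * z) * s) =
      Complex.exp (-(Complex.I * z) * x) - 1 := by
    rw [intervalIntegral.integral_eq_sub_of_hasDerivAt (fun s _ => hasDerivAt_exp_mul _ s)
      (Continuous.intervalIntegrable (by fun_prop) _ _)]
    simp
  have h3 : ∫ s in (0 : ℝ)..x, (-(Complex.I * z) * greenRight z J h s - h s)
      = ∫ s in (0 : ℝ)..x, (J * (-(Complex.I * z) * Complex.exp (-(Complex.I * z) * s))
        - (-(Complex.I * z) * k s + h s)) := by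
    refine intervalIntegral.integral_congr fun s _ => ?_
    simp only [greenRight, hk]
    ring
  rw [h3, intervalIntegral.integral_sub (Continuous.intervalIntegrable (by fun_prop) _ _)
    ((Continuous.intervalIntegrable (by fun_prop) _ _).add (hh 0 x)),
    intervalIntegral.integral_const_mul, h2, ← h1]
  simp only [greenRight]
  ring

/-- The free Green function solves `-u'' - z² u = F` on an edge. -/
theorem isH2_green {ℓ : M → ℝ} (hℓ : ∀ m, 0 < ℓ m) {e : K ⊕ M} {z : ℂ} (hz : z ≠ 0) (J : ℂ)
    {F A B : Lp ℂ 2 (volume.restrict (edgeSegment ℓ e))}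
    (hh : ∀ a b, IntervalIntegrable h volume a b)
    (hF : F =ᵐ[volume.restrict (edgeSegment ℓ e)] h)
    (hA : A =ᵐ[volume.restrict (edgeSegment ℓ e)] greenLeft z h)
    (hB : B =ᵐ[volume.restrict (edgeSegment ℓ e)] greenRight z J h) :
    IsH2 (edgeSegment ℓ e) ((Complex.I / (2 * z)) • (A + B))
      (fun x => Complex.I / (2 * z) * (greenLeft z h x + greenRight z J h x))
      (fun x => -(1 / 2) * (greenLeft z h x - greenRight z J h x))
      (-(F + z ^ 2 • (Complex.I / (2 * z)) • (A + B))) := by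
  have hca := continuous_greenLeft hh z
  have hcb := continuous_greenRight hh z J
  have hI : Complex.I * Complex.I = -1 := Complex.I_mul_I
  have ha0 : greenLeft z h 0 = 0 := by simp [greenLeft]
  have hb0 : greenRight z J h 0 = J := by simp [greenRight]
  have hAB : ⇑((Complex.I / (2 * z)) • (A + B)) =ᵐ[volume.restrict (edgeSegment ℓ e)]
      fun x => Complex.I / (2 * z) * (greenLeft z h x + greenRight z J h x) := by
    filter_upwards [Lp.coeFn_smul (Complex.I / (2 * z)) (A + B), Lp.coeFn_add A B, hA, hB]
      with x h1 h2 h3 h4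
    rw [h1, Pi.smul_apply, h2, Pi.add_apply, h3, h4, smul_eq_mul]
  refine ⟨hAB, ?_, ?_, ?_⟩
  · refine hasDerivWithinAt_of_eq_integral hℓ (by fun_prop) fun x hx => ?_
    have hx0 := nonneg_of_mem_edgeSegment hx
    -- The parts A (left) and B (right) satisfy A' = izA + h and B' = -izB - h in integrated form.
    -- The sources cancel in (A + B)', so the derivative is continuous.
    have h1 : ∫ y in (0 : ℝ)..x, -(1 / 2) * (greenLeft z h y - greenRight z J h y)
        = Complex.I / (2 * z) * ((∫ s in (0 : ℝ)..x, (Complex.I * z * greenLeft z h s + h s)) +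
          ∫ s in (0 : ℝ)..x, (-(Complex.I * z) * greenRight z J h s - h s)) := by
      rw [← intervalIntegral.integral_add
        ((Continuous.intervalIntegrable (by fun_prop) _ _).add (hh 0 x))
        ((Continuous.intervalIntegrable (by fun_prop) _ _).sub (hh 0 x)),
        ← intervalIntegral.integral_const_mul]
      refine intervalIntegral.integral_congr fun s _ => ?_
      field_simp
      linear_combination (-z * (greenLeft z h s - greenRight z J h s)) * hI
    rw [h1, ← greenLeft_eq_integral hh z hx0, ha0, hb0, greenRight_eq_integral hh z J hx0]
    ring
  · have h1 : MemLp (greenLeft z h) 2 (volume.restrict (edgeSegment ℓ e)) :=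
      (memLp_congr_ae hA).1 (Lp.memLp A)
    have h2 : MemLp (greenRight z J h) 2 (volume.restrict (edgeSegment ℓ e)) :=
      (memLp_congr_ae hB).1 (Lp.memLp B)
    exact (h1.sub h2).const_mul _
  · intro x hx
    have hx0 := nonneg_of_mem_edgeSegment hx
    -- In (A - B)' the sources add to 2h; the factor -1/2 turns this into the required -h.
    have h1 : ⇑(-(F + z ^ 2 • (Complex.I / (2 * z)) • (A + B)))
        =ᵐ[volume.restrict (edgeSegment ℓ e)] fun x =>
          -(1 / 2) * ((Complex.I * z * greenLeft z h x + h x) -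
            (-(Complex.I * z) * greenRight z J h x - h x)) := by
      filter_upwards [Lp.coeFn_neg (F + z ^ 2 • (Complex.I / (2 * z)) • (A + B)),
        Lp.coeFn_add F (z ^ 2 • (Complex.I / (2 * z)) • (A + B)),
        Lp.coeFn_smul (z ^ 2) ((Complex.I / (2 * z)) • (A + B)), hAB, hF] with x h1 h2 h3 h4 h5
      rw [h1, Pi.neg_apply, h2, Pi.add_apply, h3, Pi.smul_apply, h4, h5, smul_eq_mul]
      field_simp
      ring
    rw [intervalIntegral_congr_of_ae h1 (uIoc_subset_edgeSegment ℓ e hx),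
      intervalIntegral.integral_const_mul, intervalIntegral.integral_sub
        ((Continuous.intervalIntegrable (by fun_prop) _ _).add (hh 0 x))
        ((Continuous.intervalIntegrable (by fun_prop) _ _).sub (hh 0 x)),
      ← greenLeft_eq_integral hh z hx0, ha0, hb0, greenRight_eq_integral hh z J hx0]
    ring

end Green

/-! ### The explicit resolvent as a meromorphic family. -/

section Family

variable {V K M : Type*}

/-- Lebesgue measure on an edge. -/
abbrev edgeMeasure (ℓ : M → ℝ) (e : K ⊕ M) : Measure ℝ := volume.restrict (edgeSegment ℓ e)

/-- The distance along the edge from an edge end. -/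
def endDist (ℓ : M → ℝ) : EdgeEnd K M → ℝ → ℝ
  | .inl _ => fun x => x
  | .inr (.inl _) => fun x => x
  | .inr (.inr m) => fun x => ℓ m - x

/-- The wave of unit amplitude leaving an edge end. -/
def outWave (ℓ : M → ℝ) (z : ℂ) (d : EdgeEnd K M) (x : ℝ) : ℂ :=
  Complex.exp (Complex.I * z * endDist ℓ d x)

@[fun_prop]
theorem continuous_endDist (ℓ : M → ℝ) (d : EdgeEnd K M) : Continuous (endDist ℓ d) := by
  rcases d with k | m | m
  all_goals
    simp only [endDist]
    fun_prop

@[fun_prop]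
theorem continuous_outWave (ℓ : M → ℝ) (z : ℂ) (d : EdgeEnd K M) : Continuous (outWave ℓ z d) := by
  unfold outWave
  fun_prop

theorem endDist_nonneg {ℓ : M → ℝ} {d : EdgeEnd K M} {x : ℝ}
    (hx : x ∈ edgeSegment ℓ (edgeOf d)) : 0 ≤ endDist ℓ d x := by
  rcases d with k | m | m
  · exact hx
  · exact hx.1
  · exact sub_nonneg.2 hx.2

theorem norm_outWave_le_one {ℓ : M → ℝ} {z : ℂ} (hz : 0 < z.im) {d : EdgeEnd K M} {x : ℝ}
    (hx : x ∈ edgeSegment ℓ (edgeOf d)) : ‖outWave ℓ z d x‖ ≤ 1 := by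
  rw [outWave, Complex.norm_exp, Real.exp_le_one_iff]
  have := endDist_nonneg hx
  simp
  positivity

theorem integrable_outWave (ℓ : M → ℝ) {z : ℂ} (hz : 0 < z.im) (d : EdgeEnd K M) :
    Integrable (outWave ℓ z d) (edgeMeasure ℓ (edgeOf d)) := by
  rcases d with k | m | m
  · have : IntegrableOn (fun x : ℝ => Complex.exp (Complex.I * z * x)) (Ioi 0) :=
      integrableOn_exp_mul_complex_Ioi (by simpa using hz) 0
    exact Iff.mpr integrableOn_Ici_iff_integrableOn_Ioi this
  · exact (continuous_outWave ℓ z _).continuousOn.integrableOn_Icc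
  · exact (continuous_outWave ℓ z _).continuousOn.integrableOn_Icc

theorem memLp_outWave (ℓ : M → ℝ) {z : ℂ} (hz : 0 < z.im) (d : EdgeEnd K M) :
    MemLp (outWave ℓ z d) 2 (edgeMeasure ℓ (edgeOf d)) := by
  have hm : AEStronglyMeasurable (outWave ℓ z d) (edgeMeasure ℓ (edgeOf d)) :=
    (continuous_outWave ℓ z d).aestronglyMeasurable
  rw [memLp_two_iff_integrable_sq_norm hm]
  refine (integrable_outWave ℓ hz d).norm.mono' (hm.norm.pow 2) ?_
  filter_upwards [ae_restrict_mem (measurableSet_edgeSegment ℓ (edgeOf d))] with x hx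
  have := norm_outWave_le_one hz hx
  rw [Real.norm_of_nonneg (by positivity)]
  nlinarith [norm_nonneg (outWave ℓ z d x)]

/-- Sources to the left of the observer. -/
def leftRegion : Set (ℝ × ℝ) := {q | q.2 ≤ q.1}

/-- Sources to the right of the observer. -/
def rightRegion : Set (ℝ × ℝ) := {q | q.1 < q.2}

theorem measurableSet_leftRegion : MeasurableSet leftRegion :=
  measurableSet_le measurable_snd measurable_fst

theorem measurableSet_rightRegion : MeasurableSet rightRegion :=
  measurableSet_lt measurable_fst measurable_snd

/-- A kernel dominated by an integrable convolution kernel satisfies Schur's test. -/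
theorem isSchur_of_convolution {k : ℝ × ℝ → ℂ} (hk : Measurable k) {j : ℝ → ℂ}
    (hj : Integrable j) (h : ∀ x y, ‖k (x, y)‖ₑ ≤ ‖j (x - y)‖ₑ) (S S' : Set ℝ) :
    ∃ C, IsSchur (volume.restrict S) (volume.restrict S') k C := by
  have hfin : ∫⁻ t, ‖j t‖ₑ ≠ ∞ := hj.2.ne
  refine ⟨(∫⁻ t, ‖j t‖ₑ).toNNReal, hk, Eventually.of_forall fun x => ?_,
    Eventually.of_forall fun y => ?_⟩
  · rw [ENNReal.coe_toNNReal hfin]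
    calc _ ≤ ∫⁻ y, ‖k (x, y)‖ₑ := lintegral_mono' Measure.restrict_le_self le_rfl
      _ ≤ ∫⁻ y, ‖j (x - y)‖ₑ := lintegral_mono fun y => h x y
      _ = _ := lintegral_sub_left_eq_self (fun t => ‖j t‖ₑ) x
  · rw [ENNReal.coe_toNNReal hfin]
    calc _ ≤ ∫⁻ x, ‖k (x, y)‖ₑ := lintegral_mono' Measure.restrict_le_self le_rfl
      _ ≤ ∫⁻ x, ‖j (x - y)‖ₑ := lintegral_mono fun x => h x y
      _ = _ := lintegral_sub_right_eq_self (fun t => ‖j t‖ₑ) y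

/-- On y ≤ x the kernel is a function of x - y ≥ 0, integrable because Im z > 0 makes it decay
exponentially. -/
theorem isSchur_left {z : ℂ} (hz : 0 < z.im) (S S' : Set ℝ) :
    ∃ C, IsSchur (volume.restrict S) (volume.restrict S')
      (waveKernel leftRegion (fun q => q.1 - q.2) z) C := by
  have h1 : IntegrableOn (fun x : ℝ => Complex.exp (Complex.I * z * x)) (Ici 0) :=
    Iff.mpr integrableOn_Ici_iff_integrableOn_Ioi
      (integrableOn_exp_mul_complex_Ioi (by simpa using hz) 0)
  refine isSchur_of_convolution (measurable_waveKernel measurableSet_leftRegion (by fun_prop) z)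
    (h1.integrable_indicator measurableSet_Ici) (fun x y => ?_) S S'
  by_cases hxy : y ≤ x
  · rw [waveKernel, indicator_of_mem (show (x, y) ∈ leftRegion from hxy),
      indicator_of_mem (show x - y ∈ Ici 0 from sub_nonneg.2 hxy)]
  · rw [waveKernel, indicator_of_notMem (show (x, y) ∉ leftRegion from hxy)]
    simp

theorem isSchur_right {z : ℂ} (hz : 0 < z.im) (S S' : Set ℝ) :
    ∃ C, IsSchur (volume.restrict S) (volume.restrict S')
      (waveKernel rightRegion (fun q => q.2 - q.1) z) C := by
  have h1 : IntegrableOn (fun x : ℝ => Complex.exp (Complex.I * z * x)) (Ici 0) :=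
    Iff.mpr integrableOn_Ici_iff_integrableOn_Ioi
      (integrableOn_exp_mul_complex_Ioi (by simpa using hz) 0)
  refine isSchur_of_convolution (measurable_waveKernel measurableSet_rightRegion (by fun_prop) z)
    (h1.integrable_indicator measurableSet_Ici).comp_neg (fun x y => ?_) S S'
  by_cases hxy : x < y
  · rw [waveKernel, indicator_of_mem (show (x, y) ∈ rightRegion from hxy),
      indicator_of_mem (show -(x - y) ∈ Ici 0 by simp [hxy.le])]
    simp
  · rw [waveKernel, indicator_of_notMem (show (x, y) ∉ rightRegion from hxy)]
    simp

theorem waveKernel_univ_endDist (ℓ : M → ℝ) (z : ℂ) (d d' : EdgeEnd K M) (q : ℝ × ℝ) :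
    waveKernel univ (fun q : ℝ × ℝ => endDist ℓ d q.1 + endDist ℓ d' q.2) z q =
      outWave ℓ z d q.1 * outWave ℓ z d' q.2 := by
  rw [waveKernel, indicator_univ, outWave, outWave, ← Complex.exp_add]
  congr 1
  push_cast
  ring

/-- The kernel is a product of two outgoing waves, each bounded by 1 and integrable on its edge. -/
theorem isSchur_coupling (ℓ : M → ℝ) {z : ℂ} (hz : 0 < z.im) (d d' : EdgeEnd K M) :
    ∃ C, IsSchur (edgeMeasure ℓ (edgeOf d)) (edgeMeasure ℓ (edgeOf d'))
      (waveKernel univ (fun q => endDist ℓ d q.1 + endDist ℓ d' q.2) z) C := by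
  have hfin : ∀ d : EdgeEnd K M, ∫⁻ x, ‖outWave ℓ z d x‖ₑ ∂(edgeMeasure ℓ (edgeOf d)) ≠ ∞ :=
    fun d => (integrable_outWave ℓ hz d).2.ne
  have hone : ∀ (d : EdgeEnd K M), ∀ᵐ x ∂(edgeMeasure ℓ (edgeOf d)), ‖outWave ℓ z d x‖ₑ ≤ 1 := by
    intro d
    filter_upwards [ae_restrict_mem (measurableSet_edgeSegment ℓ (edgeOf d))] with x hx
    rw [← ofReal_norm]
    exact ENNReal.ofReal_le_one.2 (norm_outWave_le_one hz hx)
  refine ⟨(∫⁻ x, ‖outWave ℓ z d x‖ₑ ∂(edgeMeasure ℓ (edgeOf d))).toNNReal +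
    (∫⁻ x, ‖outWave ℓ z d' x‖ₑ ∂(edgeMeasure ℓ (edgeOf d'))).toNNReal,
    measurable_waveKernel MeasurableSet.univ (by fun_prop) z, ?_, ?_⟩
  · filter_upwards [hone d] with x hx
    simp only [waveKernel_univ_endDist, enorm_mul]
    rw [lintegral_const_mul' _ _ enorm_ne_top, ENNReal.coe_add, ENNReal.coe_toNNReal (hfin d),
      ENNReal.coe_toNNReal (hfin d')]
    exact (mul_le_of_le_one_left zero_le hx).trans le_add_self
  · filter_upwards [hone d'] with x hx
    simp only [waveKernel_univ_endDist, enorm_mul]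
    rw [lintegral_mul_const' _ _ enorm_ne_top, ENNReal.coe_add, ENNReal.coe_toNNReal (hfin d),
      ENNReal.coe_toNNReal (hfin d')]
    exact (mul_le_of_le_one_right zero_le hx).trans le_self_add

theorem IsSchur.indicator {X Y : Type*} [MeasurableSpace X] [MeasurableSpace Y] {μ : Measure X}
    {ν : Measure Y} {k : X × Y → ℂ} {C : NNReal} (h : IsSchur μ ν k C) {B : Set (X × Y)}
    (hB : MeasurableSet B) : IsSchur μ ν (B.indicator k) C where
  measurable := h.measurable.indicator hB
  left := h.left.mono fun _ hx => (lintegral_mono fun _ => enorm_indicator_le_enorm_self k _).trans hx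
  right := h.right.mono fun _ hy =>
    (lintegral_mono fun _ => enorm_indicator_le_enorm_self k _).trans hy

theorem waveKernel_inter {X Y : Type*} (Ω B : Set (X × Y)) (p : X × Y → ℝ) (z : ℂ) :
    waveKernel (Ω ∩ B) p z = B.indicator (waveKernel Ω p z) := by
  rw [waveKernel, waveKernel, indicator_indicator, inter_comm]

/-- Truncating a kernel operator truncates its kernel. -/
theorem IsSchur.indicatorCLM_comp_kernelOp {μ ν : Measure ℝ} [SFinite μ] [SFinite ν]
    {k : ℝ × ℝ → ℂ} {C : NNReal} (h : IsSchur μ ν k C) {A A' : Set ℝ} (hA : MeasurableSet A)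
    (hA' : MeasurableSet A') (f : Lp ℂ 2 ν) :
    indicatorCLM μ hA (kernelOp μ ν k (indicatorCLM ν hA' f)) =
      kernelOp μ ν ((A ×ˢ A').indicator k) f := by
  refine Lp.ext ?_
  have h1 : ∀ (ρ : Measure ℝ) {B : Set ℝ} (hB : MeasurableSet B) (g : Lp ℂ 2 ρ),
      indicatorCLM ρ hB g =ᵐ[ρ] B.indicator g := fun ρ B hB g => coeFn_indicatorLp ρ hB g
  filter_upwards [h1 μ hA (kernelOp μ ν k (indicatorCLM ν hA' f)),
    h.kernelOp_ae_eq (indicatorCLM ν hA' f),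
    (h.indicator (hA.prod hA')).kernelOp_ae_eq f] with x h2 h3 h4
  rw [h2, h4]
  by_cases hx : x ∈ A
  · rw [indicator_of_mem hx, h3]
    refine integral_congr_ae ?_
    filter_upwards [h1 ν hA' f] with y hy
    rw [hy]
    by_cases hy' : y ∈ A'
    · rw [indicator_of_mem hy', indicator_of_mem (mk_mem_prod hx hy')]
    · rw [indicator_of_notMem hy', indicator_of_notMem (fun h => hy' h.2), zero_mul, mul_zero]
  · rw [indicator_of_notMem hx]
    have : ∀ y, (A ×ˢ A').indicator k (x, y) = 0 := fun y =>
      indicator_of_notMem (fun h => hx h.1) _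
    simp [this]

/-- The Green operator of an edge, truncated to `A`. -/
def edgeGreen (ℓ : M → ℝ) (A : Set ℝ) (z : ℂ) (e : K ⊕ M) :
    Lp ℂ 2 (edgeMeasure ℓ e) →L[ℂ] Lp ℂ 2 (edgeMeasure ℓ e) :=
  kernelOp _ _ (waveKernel (leftRegion ∩ A ×ˢ A) (fun q => q.1 - q.2) z) +
    kernelOp _ _ (waveKernel (rightRegion ∩ A ×ˢ A) (fun q => q.2 - q.1) z)

/-- The rank one operator producing the wave leaving `d` from the signal arriving at `d'`,
truncated to `A` and `A'`. -/
def edgeCoupling (ℓ : M → ℝ) (A A' : Set ℝ) (z : ℂ) (d d' : EdgeEnd K M) :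
    Lp ℂ 2 (edgeMeasure ℓ (edgeOf d')) →L[ℂ] Lp ℂ 2 (edgeMeasure ℓ (edgeOf d)) :=
  kernelOp _ _ (waveKernel (univ ∩ A ×ˢ A') (fun q => endDist ℓ d q.1 + endDist ℓ d' q.2) z)

/-- Restriction to one edge. -/
def edgeProj (ℓ : M → ℝ) (e : K ⊕ M) : L2 K ℓ →L[ℂ] Lp ℂ 2 (edgeMeasure ℓ e) :=
  PiLp.proj 2 _ e

theorem edgeProj_apply (ℓ : M → ℝ) (e : K ⊕ M) (f : L2 K ℓ) : edgeProj ℓ e f = f e := rfl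

open Classical in
/-- The inclusion of the functions on one edge. -/
def edgeIncl (ℓ : M → ℝ) (e : K ⊕ M) : Lp ℂ 2 (edgeMeasure ℓ e) →L[ℂ] L2 K ℓ :=
  (PiLp.continuousLinearEquiv 2 ℂ _).symm.toContinuousLinearMap ∘L
    ContinuousLinearMap.single ℂ (fun e : K ⊕ M => Lp ℂ 2 (edgeMeasure ℓ e)) e

theorem edgeIncl_same (ℓ : M → ℝ) (e : K ⊕ M) (f : Lp ℂ 2 (edgeMeasure ℓ e)) :
    edgeIncl ℓ e f e = f := by
  classical
  change (Pi.single e f : ∀ e, Lp ℂ 2 (edgeMeasure ℓ e)) e = f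
  exact Pi.single_eq_same (M := fun e => Lp ℂ 2 (edgeMeasure ℓ e)) e f

theorem edgeIncl_ne (ℓ : M → ℝ) {e e' : K ⊕ M} (h : e' ≠ e) (f : Lp ℂ 2 (edgeMeasure ℓ e)) :
    edgeIncl ℓ e f e' = 0 := by
  classical
  change (Pi.single e f : ∀ e, Lp ℂ 2 (edgeMeasure ℓ e)) e' = 0
  exact Pi.single_eq_of_ne (M := fun e => Lp ℂ 2 (edgeMeasure ℓ e)) h f

theorem truncation_edgeIncl (ℓ : M → ℝ) (r : ℝ) (e : K ⊕ M) (f : Lp ℂ 2 (edgeMeasure ℓ e)) :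
    truncation ℓ r (edgeIncl ℓ e f) =
      edgeIncl ℓ e (indicatorCLM _ (measurableSet_truncatedSegment ℓ r e) f) := by
  ext1 e'
  change indicatorCLM _ (measurableSet_truncatedSegment ℓ r e') (edgeIncl ℓ e f e') = _
  by_cases h : e' = e
  · subst h
    rw [edgeIncl_same, edgeIncl_same]
  · rw [edgeIncl_ne ℓ h, edgeIncl_ne ℓ h, map_zero]

theorem edgeProj_truncation (ℓ : M → ℝ) (r : ℝ) (e : K ⊕ M) (f : L2 K ℓ) :
    edgeProj ℓ e (truncation ℓ r f) =
      indicatorCLM _ (measurableSet_truncatedSegment ℓ r e) (edgeProj ℓ e f) := rfl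

variable [Fintype K] [Fintype M]

open Classical in
/-- The matrix taking incoming signals to outgoing amplitudes. -/
def response (G : LeadGraph V K M) (ℓ : M → ℝ) (z : ℂ) : Matrix (EdgeEnd K M) (EdgeEnd K M) ℂ :=
  (secular G ℓ z)⁻¹ * LinearMap.toMatrix' G.scatter

/-- The explicit resolvent, truncated to the part `A e` of every edge `e`. -/
def resolventFamily (G : LeadGraph V K M) (ℓ : M → ℝ) (A : K ⊕ M → Set ℝ) (z : ℂ) :
    L2 K ℓ →L[ℂ] L2 K ℓ :=
  (Complex.I / (2 * z)) • (∑ e, edgeIncl ℓ e ∘L edgeGreen ℓ (A e) z e ∘L edgeProj ℓ e +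
    ∑ d, ∑ d', response G ℓ z d d' • (edgeIncl ℓ (edgeOf d) ∘L
      edgeCoupling ℓ (A (edgeOf d)) (A (edgeOf d')) z d d' ∘L edgeProj ℓ (edgeOf d')))

/-- Cramer's rule: a quotient of entire functions, with the secular determinant as denominator. -/
theorem meromorphicAt_response (G : LeadGraph V K M) (ℓ : M → ℝ) (d d' : EdgeEnd K M) (z : ℂ) :
    MeromorphicAt (fun z => response G ℓ z d d') z := by
  classical
  have hdet : ∀ (B : ℂ → Matrix (EdgeEnd K M) (EdgeEnd K M) ℂ),
      (∀ i j, Differentiable ℂ fun z => B z i j) → Differentiable ℂ fun z => (B z).det := by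
    intro B hB
    simp only [Matrix.det_apply]
    fun_prop
  have h1 : (fun z => response G ℓ z d d') = fun z => ((secular G ℓ z).det)⁻¹ *
      ∑ j, (secular G ℓ z).adjugate d j * LinearMap.toMatrix' G.scatter j d' := by
    funext z
    simp only [response, Matrix.mul_apply, Matrix.inv_def, Matrix.smul_apply, smul_eq_mul,
      Ring.inverse_eq_inv', Finset.mul_sum, mul_assoc]
  rw [h1]
  refine MeromorphicAt.mul (MeromorphicAt.inv
    ((hdet _ (differentiable_secular G ℓ)).analyticAt z).meromorphicAt) ?_
  refine MeromorphicAt.fun_sum fun j _ => MeromorphicAt.mul ?_ (MeromorphicAt.const _ _)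
  simp only [Matrix.adjugate_apply]
  refine ((hdet _ fun a b => ?_).analyticAt z).meromorphicAt
  by_cases hab : a = j
  · subst hab
    simp
  · simpa [Matrix.updateRow_ne hab] using differentiable_secular G ℓ a b

theorem meromorphicAt_clm_comp {E₁ E₂ E₃ E₄ : Type*} [NormedAddCommGroup E₁] [NormedSpace ℂ E₁]
    [NormedAddCommGroup E₂] [NormedSpace ℂ E₂] [NormedAddCommGroup E₃] [NormedSpace ℂ E₃]
    [NormedAddCommGroup E₄] [NormedSpace ℂ E₄] [CompleteSpace E₄] {T : ℂ → E₂ →L[ℂ] E₃}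
    (hT : Differentiable ℂ T) (S : E₃ →L[ℂ] E₄) (R : E₁ →L[ℂ] E₂) (z : ℂ) :
    MeromorphicAt (fun z => S ∘L T z ∘L R) z := by
  refine (Differentiable.analyticAt ?_ z).meromorphicAt
  exact (differentiable_const _).clm_comp (hT.clm_comp (differentiable_const _))

/-- The truncated resolvent family is meromorphic. -/
theorem meromorphicAt_resolventFamily (G : LeadGraph V K M) (ℓ : M → ℝ) {A : K ⊕ M → Set ℝ}
    (hA : ∀ e, IsCompact (A e)) (z : ℂ) : MeromorphicAt (resolventFamily G ℓ A) z := by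
  -- Compactness of the truncations bounds the phase and the measure of the support, so every kernel
  -- operator is entire in z; only the scalar coefficients can have poles.
  have hkernel : ∀ (e e' : K ⊕ M) {Ω : Set (ℝ × ℝ)} (hΩ : MeasurableSet Ω) {p : ℝ × ℝ → ℝ}
      (hp : Continuous p), Differentiable ℂ fun z => kernelOp (edgeMeasure ℓ e) (edgeMeasure ℓ e')
        (waveKernel (Ω ∩ A e ×ˢ A e') p z) := by
    intro e e' Ω hΩ p hp
    obtain ⟨B, hB⟩ := ((hA e).prod (hA e')).exists_bound_of_continuousOn hp.continuousOn
    refine differentiable_kernelOp_waveKernel (hΩ.inter ((hA e).measurableSet.prod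
      (hA e').measurableSet)) hp.measurable (fun q hq => hB q hq.2) (hA e).measurableSet
      (hA e').measurableSet ?_ ?_ inter_subset_right
    · exact ((Measure.restrict_le_self _).trans_lt (hA e).measure_lt_top).ne
    · exact ((Measure.restrict_le_self _).trans_lt (hA e').measure_lt_top).ne
  have hgreen : ∀ e, Differentiable ℂ fun z => edgeGreen ℓ (A e) z e := fun e =>
    (hkernel e e measurableSet_leftRegion (by fun_prop)).add
      (hkernel e e measurableSet_rightRegion (by fun_prop))
  have hcoup : ∀ d d', Differentiable ℂ fun z =>
      edgeCoupling ℓ (A (edgeOf d)) (A (edgeOf d')) z d d' := fun d d' =>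
    hkernel (edgeOf d) (edgeOf d') MeasurableSet.univ (by fun_prop)
  have hc : MeromorphicAt (fun z : ℂ => Complex.I / (2 * z)) z :=
    (MeromorphicAt.const _ _).div ((MeromorphicAt.const _ _).mul (MeromorphicAt.id z))
  have h1 : MeromorphicAt (fun z => ∑ e, edgeIncl ℓ e ∘L edgeGreen ℓ (A e) z e ∘L edgeProj ℓ e) z :=
    MeromorphicAt.fun_sum fun e _ => meromorphicAt_clm_comp (hgreen e) _ _ z
  have h2 : MeromorphicAt (fun z => ∑ d, ∑ d', response G ℓ z d d' • (edgeIncl ℓ (edgeOf d) ∘L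
      edgeCoupling ℓ (A (edgeOf d)) (A (edgeOf d')) z d d' ∘L edgeProj ℓ (edgeOf d'))) z :=
    MeromorphicAt.fun_sum fun d _ => MeromorphicAt.fun_sum fun d' _ =>
      (meromorphicAt_response G ℓ d d' z).smul (meromorphicAt_clm_comp (hcoup d d') _ _ z)
  exact hc.smul (h1.add h2)

/-- In the upper half plane the truncated family is the truncation of the full one. -/
theorem truncation_comp_resolventFamily (G : LeadGraph V K M) (ℓ : M → ℝ) (r : ℝ) {z : ℂ}
    (hz : 0 < z.im) :
    truncation ℓ r ∘L resolventFamily G ℓ (fun _ => univ) z ∘L truncation ℓ r =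
      resolventFamily G ℓ (truncatedSegment ℓ r) z := by
  ext1 f
  have hgreen : ∀ e, indicatorCLM _ (measurableSet_truncatedSegment ℓ r e)
      (edgeGreen ℓ univ z e (indicatorCLM _ (measurableSet_truncatedSegment ℓ r e)
        (edgeProj ℓ e f))) = edgeGreen ℓ (truncatedSegment ℓ r e) z e (edgeProj ℓ e f) := by
    intro e
    -- Im z > 0 enters here: Schur's test must hold on the whole edge for the untruncated operator
    -- to be given by its kernel.
    obtain ⟨C, hC⟩ := isSchur_left hz (edgeSegment ℓ e) (edgeSegment ℓ e)
    obtain ⟨C', hC'⟩ := isSchur_right hz (edgeSegment ℓ e) (edgeSegment ℓ e)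
    simp only [edgeGreen, univ_prod_univ, inter_univ, add_apply, map_add]
    rw [hC.indicatorCLM_comp_kernelOp, hC'.indicatorCLM_comp_kernelOp, waveKernel_inter,
      waveKernel_inter]
  have hcoup : ∀ d d', indicatorCLM _ (measurableSet_truncatedSegment ℓ r (edgeOf d))
      (edgeCoupling ℓ univ univ z d d' (indicatorCLM _
        (measurableSet_truncatedSegment ℓ r (edgeOf d')) (edgeProj ℓ (edgeOf d') f))) =
      edgeCoupling ℓ (truncatedSegment ℓ r (edgeOf d)) (truncatedSegment ℓ r (edgeOf d')) z d d'
        (edgeProj ℓ (edgeOf d') f) := by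
    intro d d'
    obtain ⟨C, hC⟩ := isSchur_coupling ℓ hz d d'
    simp only [edgeCoupling, univ_prod_univ, inter_univ]
    rw [hC.indicatorCLM_comp_kernelOp, waveKernel_inter]
  simp only [resolventFamily, ContinuousLinearMap.comp_apply, smul_apply, add_apply,
    sum_apply, map_smul, map_add, map_sum, edgeProj_truncation,
    truncation_edgeIncl, hgreen, hcoup]

end Family

/-! ### The resolvent family edge by edge. -/

section Resolvent

variable {V K M : Type*}

theorem Lp_sum_ae_eq {X ι : Type*} [MeasurableSpace X] {μ : Measure X} {w : ι → Lp ℂ 2 μ}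
    {φ : ι → X → ℂ} (s : Finset ι) (h : ∀ i ∈ s, w i =ᵐ[μ] φ i) :
    ⇑(∑ i ∈ s, w i) =ᵐ[μ] fun x => ∑ i ∈ s, φ i x := by
  classical
  induction s using Finset.induction_on with
  | empty =>
    simp only [Finset.sum_empty]
    exact Lp.coeFn_zero ℂ 2 μ
  | insert i s hi ih =>
    rw [Finset.sum_insert hi]
    filter_upwards [Lp.coeFn_add (w i) (∑ i ∈ s, w i), h i (Finset.mem_insert_self i s),
      ih fun j hj => h j (Finset.mem_insert_of_mem hj)] with x h1 h2 h3
    rw [h1, Pi.add_apply, h2, h3, Finset.sum_insert hi]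

/-- Extending the source by zero makes it locally integrable on ℝ, so the Green function is
continuous on the whole line. -/
theorem intervalIntegrable_indicator {ℓ : M → ℝ} {e : K ⊕ M} (F : Lp ℂ 2 (edgeMeasure ℓ e))
    (a b : ℝ) : IntervalIntegrable ((edgeSegment ℓ e).indicator F) volume a b := by
  have h1 : MemLp ((edgeSegment ℓ e).indicator F) 2 volume :=
    (memLp_indicator_iff_restrict (measurableSet_edgeSegment ℓ e)).2 (Lp.memLp F)
  rw [intervalIntegrable_iff]
  have : IsFiniteMeasure (volume.restrict (uIoc a b)) := ⟨by simp [uIoc]⟩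
  exact (h1.mono_measure Measure.restrict_le_self).integrable (by norm_num)

theorem indicator_ae_eq {ℓ : M → ℝ} {e : K ⊕ M} (F : Lp ℂ 2 (edgeMeasure ℓ e)) :
    F =ᵐ[edgeMeasure ℓ e] (edgeSegment ℓ e).indicator F := by
  filter_upwards [ae_restrict_mem (measurableSet_edgeSegment ℓ e)] with x hx
  rw [indicator_of_mem hx]

theorem setIntegral_edgeSegment_inter_Iic {ℓ : M → ℝ} {e : K ⊕ M} {x : ℝ}
    (hx : x ∈ edgeSegment ℓ e) (φ : ℝ → ℂ) (F : Lp ℂ 2 (edgeMeasure ℓ e)) :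
    ∫ y in edgeSegment ℓ e ∩ Iic x, φ y * F y =
      ∫ y in (0 : ℝ)..x, φ y * (edgeSegment ℓ e).indicator F y := by
  have hx0 := nonneg_of_mem_edgeSegment hx
  have h1 : edgeSegment ℓ e ∩ Iic x = Icc 0 x := by
    ext y
    rcases e with k | m
    · exact Iff.rfl
    · have hx : x ∈ Icc 0 (ℓ m) := hx
      exact ⟨fun h => ⟨h.1.1, h.2⟩, fun h => ⟨⟨h.1, h.2.trans hx.2⟩, h.2⟩⟩
  rw [h1, integral_Icc_eq_integral_Ioc, intervalIntegral.integral_of_le hx0]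
  refine setIntegral_congr_fun measurableSet_Ioc fun y hy => ?_
  have : y ∈ edgeSegment ℓ e := by
    have hy' : y ∈ edgeSegment ℓ e ∩ Iic x := h1 ▸ ⟨hy.1.le, hy.2⟩
    exact hy'.1
  simp only [indicator_of_mem this]

theorem memLp_exp (ℓ : M → ℝ) {z : ℂ} (hz : 0 < z.im) (e : K ⊕ M) :
    MemLp (fun x : ℝ => Complex.exp (Complex.I * z * x)) 2 (edgeMeasure ℓ e) := by
  rcases e with k | m
  · exact memLp_outWave ℓ hz (.inl k)
  · exact memLp_outWave ℓ hz (.inr (.inl m))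

theorem kernelOp_left_ae_eq (ℓ : M → ℝ) {z : ℂ} (hz : 0 < z.im) {e : K ⊕ M}
    (F : Lp ℂ 2 (edgeMeasure ℓ e)) :
    kernelOp (edgeMeasure ℓ e) (edgeMeasure ℓ e) (waveKernel leftRegion (fun q => q.1 - q.2) z) F
      =ᵐ[edgeMeasure ℓ e] greenLeft z ((edgeSegment ℓ e).indicator F) := by
  obtain ⟨C, hC⟩ := isSchur_left hz (edgeSegment ℓ e) (edgeSegment ℓ e)
  filter_upwards [hC.kernelOp_ae_eq F, ae_restrict_mem (measurableSet_edgeSegment ℓ e)] with x h1 hx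
  have h2 : (fun y => waveKernel leftRegion (fun q : ℝ × ℝ => q.1 - q.2) z (x, y) * F y) =
      (Iic x).indicator fun y : ℝ => Complex.exp (Complex.I * z * x) *
        (Complex.exp (-(Complex.I * z) * y) * F y) := by
    funext y
    by_cases hy : y ≤ x
    · rw [waveKernel, indicator_of_mem (show (x, y) ∈ leftRegion from hy),
        indicator_of_mem (show y ∈ Iic x from hy), ← mul_assoc, ← Complex.exp_add]
      congr 2
      push_cast
      ring
    · rw [waveKernel, indicator_of_notMem (show (x, y) ∉ leftRegion from hy),
        indicator_of_notMem (show y ∉ Iic x from hy), zero_mul]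
  rw [h1, h2, setIntegral_indicator measurableSet_Iic, integral_const_mul,
    setIntegral_edgeSegment_inter_Iic hx, greenLeft]

/-- The integral over y > x is the total over the edge minus the part y ≤ x. On a lead the total
converges because Im z > 0. -/
theorem kernelOp_right_ae_eq (ℓ : M → ℝ) {z : ℂ} (hz : 0 < z.im) {e : K ⊕ M}
    (F : Lp ℂ 2 (edgeMeasure ℓ e)) :
    kernelOp (edgeMeasure ℓ e) (edgeMeasure ℓ e) (waveKernel rightRegion (fun q => q.2 - q.1) z) F
      =ᵐ[edgeMeasure ℓ e] greenRight z (∫ y, Complex.exp (Complex.I * z * y) * F y ∂edgeMeasure ℓ e)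
        ((edgeSegment ℓ e).indicator F) := by
  obtain ⟨C, hC⟩ := isSchur_right hz (edgeSegment ℓ e) (edgeSegment ℓ e)
  filter_upwards [hC.kernelOp_ae_eq F, ae_restrict_mem (measurableSet_edgeSegment ℓ e)] with x h1 hx
  have h2 : (fun y => waveKernel rightRegion (fun q : ℝ × ℝ => q.2 - q.1) z (x, y) * F y) =
      (Iic x)ᶜ.indicator fun y : ℝ => Complex.exp (-(Complex.I * z) * x) *
        (Complex.exp (Complex.I * z * y) * F y) := by
    funext y
    by_cases hy : x < y
    · rw [waveKernel, indicator_of_mem (show (x, y) ∈ rightRegion from hy),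
        indicator_of_mem (show y ∈ (Iic x)ᶜ by simpa using hy), ← mul_assoc, ← Complex.exp_add]
      congr 2
      push_cast
      ring
    · rw [waveKernel, indicator_of_notMem (show (x, y) ∉ rightRegion from hy),
        indicator_of_notMem (show y ∉ (Iic x)ᶜ by simpa using hy), zero_mul]
  have hint : IntegrableOn (fun y : ℝ => Complex.exp (Complex.I * z * y) * F y)
      (edgeSegment ℓ e) := (memLp_exp ℓ hz e).integrable_mul (Lp.memLp F)
  have h3 := integral_inter_add_sdiff (measurableSet_Iic (a := x)) hint
  rw [h1, h2, setIntegral_indicator measurableSet_Iic.compl, integral_const_mul, greenRight,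
    ← setIntegral_edgeSegment_inter_Iic hx, ← h3, add_sub_cancel_left, sdiff_eq]

variable [Fintype K] [Fintype M]

/-- The signal arriving at an edge end from the source `f`. -/
def signal (ℓ : M → ℝ) (z : ℂ) (f : L2 K ℓ) (d : EdgeEnd K M) : ℂ :=
  Complex.I / (2 * z) * ∫ y, outWave ℓ z d y * f (edgeOf d) y ∂edgeMeasure ℓ (edgeOf d)

/-- The amplitudes leaving the edge ends in response to the source `f`. -/
def outAmplitude (G : LeadGraph V K M) (ℓ : M → ℝ) (z : ℂ) (f : L2 K ℓ) : EdgeEnd K M → ℂ :=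
  (response G ℓ z).mulVec (signal ℓ z f)

open Classical in
/-- The outgoing waves on the edge `e` with given amplitudes at the edge ends. -/
def waveSum (ℓ : M → ℝ) (z : ℂ) (a : EdgeEnd K M → ℂ) (e : K ⊕ M) (x : ℝ) : ℂ :=
  ∑ d, (if edgeOf d = e then a d else 0) * outWave ℓ z d x

/-- Only couplings whose target end lies on `e` survive. Each has rank one, so their sum is a
combination of outgoing waves with coefficients response times signal. -/
theorem resolventFamily_apply (G : LeadGraph V K M) (ℓ : M → ℝ) {z : ℂ} (hz : 0 < z.im)
    (f : L2 K ℓ) (e : K ⊕ M) : ∃ w : Lp ℂ 2 (edgeMeasure ℓ e),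
      resolventFamily G ℓ (fun _ => univ) z f e =
        (Complex.I / (2 * z)) • edgeGreen ℓ univ z e (f e) + w ∧
      w =ᵐ[edgeMeasure ℓ e] waveSum ℓ z (outAmplitude G ℓ z f) e := by
  classical
  refine ⟨∑ d, ∑ d', (Complex.I / (2 * z) * response G ℓ z d d') •
    edgeIncl ℓ (edgeOf d) (edgeCoupling ℓ univ univ z d d' (f (edgeOf d'))) e, ?_, ?_⟩
  · have h1 : ∑ e', edgeIncl ℓ e' (edgeGreen ℓ univ z e' (f e')) e = edgeGreen ℓ univ z e (f e) := by
      rw [Finset.sum_eq_single e (fun e' _ he' => edgeIncl_ne ℓ he'.symm _) (by simp),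
        edgeIncl_same]
    have h2 : ∀ e', edgeProj ℓ e' f = f e' := fun e' => rfl
    simp only [resolventFamily, smul_apply, add_apply, sum_apply, ContinuousLinearMap.comp_apply,
      PiLp.smul_apply, PiLp.add_apply, smul_add, h2]
    rw [← edgeProj_apply, ← edgeProj_apply]
    simp only [map_sum, map_smul, edgeProj_apply, h1, Finset.smul_sum, smul_smul]
  · have hcoup : ∀ d d', edgeIncl ℓ (edgeOf d)
        (edgeCoupling ℓ univ univ z d d' (f (edgeOf d'))) e =ᵐ[edgeMeasure ℓ e] fun x =>
          (if edgeOf d = e then 1 else 0) * outWave ℓ z d x *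
            ∫ y, outWave ℓ z d' y * f (edgeOf d') y ∂edgeMeasure ℓ (edgeOf d') := by
      intro d d'
      by_cases hd : edgeOf d = e
      · subst hd
        rw [edgeIncl_same, edgeCoupling, univ_prod_univ, inter_univ]
        obtain ⟨C, hC⟩ := isSchur_coupling ℓ hz d d'
        filter_upwards [hC.kernelOp_ae_eq (f (edgeOf d'))] with x hx
        rw [hx, if_pos rfl, one_mul, ← integral_const_mul]
        refine integral_congr_ae (Eventually.of_forall fun y => ?_)
        simp only [waveKernel_univ_endDist, mul_assoc]
      · rw [edgeIncl_ne ℓ (Ne.symm hd)]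
        filter_upwards [Lp.coeFn_zero ℂ 2 (edgeMeasure ℓ e)] with x hx
        rw [hx, if_neg hd]
        simp
    have hsum := Lp_sum_ae_eq Finset.univ fun d (_ : d ∈ Finset.univ) =>
      Lp_sum_ae_eq Finset.univ fun d' (_ : d' ∈ Finset.univ) =>
        (Lp.coeFn_smul (Complex.I / (2 * z) * response G ℓ z d d')
          (edgeIncl ℓ (edgeOf d) (edgeCoupling ℓ univ univ z d d' (f (edgeOf d'))) e)).trans
          ((hcoup d d').const_smul (Complex.I / (2 * z) * response G ℓ z d d'))
    filter_upwards [hsum] with x hx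
    rw [hx, waveSum]
    refine Finset.sum_congr rfl fun d _ => ?_
    rw [outAmplitude, Matrix.mulVec, dotProduct]
    split_ifs with hd
    · rw [Finset.sum_mul]
      refine Finset.sum_congr rfl fun d' _ => ?_
      simp only [Pi.smul_apply, smul_eq_mul, signal]
      ring
    · simp

end Resolvent

/-! ### The explicit family inverts P - z² in the upper half plane. -/

section ResolventIdentity

variable {V K M : Type*}

/-- The sign of `d/dx` of the distance from an edge end. -/
def endSign : EdgeEnd K M → ℂ
  | .inl _ => 1
  | .inr (.inl _) => 1
  | .inr (.inr _) => -1

theorem hasDerivAt_outWave (ℓ : M → ℝ) (z : ℂ) (d : EdgeEnd K M) (x : ℝ) :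
    HasDerivAt (outWave ℓ z d) (Complex.I * z * endSign d * outWave ℓ z d x) x := by
  have h1 : HasDerivAt (fun x : ℝ => (endDist ℓ d x : ℂ)) (endSign d) x := by
    rcases d with k | m | m
    · exact Complex.ofRealCLM.hasDerivAt
    · exact Complex.ofRealCLM.hasDerivAt
    · simp only [endDist, endSign, Complex.ofReal_sub]
      exact (Complex.ofRealCLM.hasDerivAt (x := x)).const_sub _
  convert! (h1.const_mul (Complex.I * z)).cexp using 1
  rw [outWave]
  ring

theorem endSign_mul_self (d : EdgeEnd K M) : endSign d * endSign d = 1 := by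
  rcases d with k | m | m
  all_goals simp [endSign]

theorem integral_edgeMeasure_edge {ℓ : M → ℝ} (hℓ : ∀ m, 0 < ℓ m) (m : M) (φ : ℝ → ℂ)
    (F : Lp ℂ 2 (edgeMeasure ℓ (.inr m : K ⊕ M))) :
    ∫ y, φ y * F y ∂edgeMeasure ℓ (.inr m : K ⊕ M) =
      ∫ y in (0 : ℝ)..ℓ m, φ y * (edgeSegment ℓ (.inr m : K ⊕ M)).indicator F y := by
  rw [← setIntegral_edgeSegment_inter_Iic (e := (.inr m : K ⊕ M)) ⟨(hℓ m).le, le_rfl⟩ φ F]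
  have h1 : edgeSegment ℓ (.inr m : K ⊕ M) ∩ Iic (ℓ m) = edgeSegment ℓ (.inr m : K ⊕ M) :=
    inter_eq_left.2 fun y (hy : y ∈ Icc 0 (ℓ m)) => hy.2
  rw [h1]

variable [Fintype K] [Fintype M]

open Classical in
theorem sum_edgeOf_lead (φ : EdgeEnd K M → ℂ) (k : K) :
    ∑ d, (if edgeOf d = .inl k then φ d else 0) = φ (.inl k) := by
  rw [Finset.sum_eq_single (.inl k)]
  · simp [edgeOf]
  · rintro (k' | m | m) _ hd
    · refine if_neg fun h => hd ?_
      rw [Sum.inl.inj h]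
    · simp [edgeOf]
    · simp [edgeOf]
  · simp

open Classical in
theorem sum_edgeOf_edge (φ : EdgeEnd K M → ℂ) (m : M) :
    ∑ d, (if edgeOf d = .inr m then φ d else 0) = φ (.inr (.inl m)) + φ (.inr (.inr m)) := by
  simp [Fintype.sum_sum_type, edgeOf]

open Classical in
theorem waveSum_eq (ℓ : M → ℝ) (z : ℂ) (a : EdgeEnd K M → ℂ) (e : K ⊕ M) (x : ℝ) :
    waveSum ℓ z a e x = ∑ d, if edgeOf d = e then a d * outWave ℓ z d x else 0 := by
  simp only [waveSum, ite_mul, zero_mul]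

theorem hasDerivAt_waveSum (ℓ : M → ℝ) (z : ℂ) (a : EdgeEnd K M → ℂ) (e : K ⊕ M) (x : ℝ) :
    HasDerivAt (waveSum ℓ z a e) (Complex.I * z * waveSum ℓ z (endSign * a) e x) x := by
  classical
  have h : HasDerivAt (waveSum ℓ z a e) (∑ d, (if edgeOf d = e then a d else 0) *
      (Complex.I * z * endSign d * outWave ℓ z d x)) x :=
    HasDerivAt.fun_sum fun d _ => (hasDerivAt_outWave ℓ z d x).const_mul _
  convert! h using 1
  rw [waveSum, Finset.mul_sum]
  refine Finset.sum_congr rfl fun d _ => ?_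
  split_ifs
  · rw [Pi.mul_apply]
    ring
  · simp

theorem continuous_waveSum (ℓ : M → ℝ) (z : ℂ) (a : EdgeEnd K M → ℂ) (e : K ⊕ M) :
    Continuous (waveSum ℓ z a e) :=
  continuous_iff_continuousAt.2 fun x => (hasDerivAt_waveSum ℓ z a e x).continuousAt

theorem memLp_waveSum (ℓ : M → ℝ) {z : ℂ} (hz : 0 < z.im) (a : EdgeEnd K M → ℂ) (e : K ⊕ M) :
    MemLp (waveSum ℓ z a e) 2 (edgeMeasure ℓ e) := by
  classical
  refine memLp_finsetSum Finset.univ fun d _ => ?_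
  by_cases hd : edgeOf d = e
  · subst hd
    exact (memLp_outWave ℓ hz d).const_mul _
  · simp [hd]

/-- A superposition of waves solves `-w'' = z² w`. -/
theorem isH2_waveSum {ℓ : M → ℝ} {z : ℂ} {a : EdgeEnd K M → ℂ} {e : K ⊕ M}
    {w : Lp ℂ 2 (edgeMeasure ℓ e)} (hw : w =ᵐ[edgeMeasure ℓ e] waveSum ℓ z a e)
    (hm : MemLp (waveSum ℓ z (endSign * a) e) 2 (edgeMeasure ℓ e)) :
    IsH2 (edgeSegment ℓ e) w (waveSum ℓ z a e)
      (fun x => Complex.I * z * waveSum ℓ z (endSign * a) e x) (-(z ^ 2 • w)) := by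
  refine IsH2.of_hasDerivAt (W := fun x => -(z ^ 2 * waveSum ℓ z a e x)) hw ?_
    (hasDerivAt_waveSum ℓ z a e) (fun x => ?_) (by
      have := continuous_waveSum ℓ z a e
      fun_prop) (hm.const_mul _)
  · filter_upwards [Lp.coeFn_neg (z ^ 2 • w), Lp.coeFn_smul (z ^ 2) w, hw] with x h1 h2 h3
    rw [h1, Pi.neg_apply, h2, Pi.smul_apply, h3, smul_eq_mul]
  · convert! (hasDerivAt_waveSum ℓ z (endSign * a) e x).const_mul (Complex.I * z) using 1
    have h1 : endSign * (endSign * a) = a := by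
      funext d
      rw [Pi.mul_apply, Pi.mul_apply, ← mul_assoc, endSign_mul_self, one_mul]
    rw [h1]
    linear_combination (-z ^ 2 * waveSum ℓ z a e x) * Complex.I_sq

/-- The response matrix is (1 - U K)⁻¹U, so a = U(Ka + s): what leaves a vertex is the scattering of
the propagated waves together with the direct signal s. -/
theorem outAmplitude_eq_scatter (G : LeadGraph V K M) {ℓ : M → ℝ} (hℓ : ∀ m, 0 < ℓ m) {z : ℂ}
    (hz : 0 < z.im) (f : L2 K ℓ) :
    outAmplitude G ℓ z f =
      G.scatter (propagate ℓ z (outAmplitude G ℓ z f) + signal ℓ z f) := by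
  classical
  have h1 : (secular G ℓ z).mulVec (outAmplitude G ℓ z f) = G.scatter (signal ℓ z f) := by
    have h2 := Matrix.mul_nonsing_inv _ (isUnit_det_secular G hℓ hz)
    rw [outAmplitude, response, Matrix.mulVec_mulVec, ← Matrix.mul_assoc]
    convert! LinearMap.toMatrix'_mulVec G.scatter (signal ℓ z f) using 2
    rw [h2, Matrix.one_mul]
  rw [secular_mulVec] at h1
  rw [map_add, ← h1]
  abel

/-- The explicit family solves `(P - z²) u = f` in the upper half plane. -/
theorem isNegLaplacian_resolventFamily (G : LeadGraph V K M) {ℓ : M → ℝ} (hℓ : ∀ m, 0 < ℓ m)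
    {z : ℂ} (hz : 0 < z.im) (f : L2 K ℓ) :
    IsNegLaplacian G ℓ (resolventFamily G ℓ (fun _ => univ) z f)
      (f + z ^ 2 • resolventFamily G ℓ (fun _ => univ) z f) := by
  have hz0 : z ≠ 0 := by
    rintro rfl
    simp at hz
  set a := outAmplitude G ℓ z f with ha
  set h : K ⊕ M → ℝ → ℂ := fun e => (edgeSegment ℓ e).indicator (f e) with hh
  set J : K ⊕ M → ℂ := fun e => ∫ y, Complex.exp (Complex.I * z * y) * f e y ∂edgeMeasure ℓ e with hJ
  let U : K ⊕ M → ℝ → ℂ := fun e x => Complex.I / (2 * z) * (greenLeft z (h e) x + greenRight z (J e) (h e) x)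
    + waveSum ℓ z a e x
  let D : K ⊕ M → ℝ → ℂ := fun e x => -(1 / 2) * (greenLeft z (h e) x - greenRight z (J e) (h e) x)
    + Complex.I * z * waveSum ℓ z (endSign * a) e x
  -- The left part of the Green function vanishes at x = 0 and the right part at x = ℓ. So the free
  -- solution only contributes incoming amplitude at each end, namely the signal.
  have hamp : HasAmplitudes ℓ z U D a
      (propagate ℓ z a + signal ℓ z f) := by
    have hI : Complex.I * Complex.I = -1 := Complex.I_mul_I
    have hL0 : ∀ e, greenLeft z (h e) 0 = 0 := fun e => by simp [greenLeft]
    have hR0 : ∀ e, greenRight z (J e) (h e) 0 = J e := fun e => by simp [greenRight]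
    have hRl : ∀ m, greenRight z (J (.inr m)) (h (.inr m)) (ℓ m) = 0 := by
      intro m
      simp only [greenRight, hJ, hh]
      rw [integral_edgeMeasure_edge hℓ, sub_self, mul_zero]
    have hs1 : ∀ k, signal ℓ z f (.inl k) = Complex.I / (2 * z) * J (.inl k) := fun k => rfl
    have hs2 : ∀ m, signal ℓ z f (.inr (.inl m)) = Complex.I / (2 * z) * J (.inr m) := fun m => rfl
    have hs3 : ∀ m, signal ℓ z f (.inr (.inr m)) =
        Complex.I / (2 * z) * greenLeft z (h (.inr m)) (ℓ m) := by
      intro m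
      have h1 : ∫ y, outWave ℓ z (.inr (.inr m) : EdgeEnd K M) y * f (.inr m) y
          ∂edgeMeasure ℓ (.inr m : K ⊕ M) = greenLeft z (h (.inr m)) (ℓ m) := by
        rw [integral_edgeMeasure_edge hℓ, greenLeft, ← intervalIntegral.integral_const_mul]
        refine intervalIntegral.integral_congr fun y _ => ?_
        simp only [outWave, endDist, hh, ← mul_assoc, ← Complex.exp_add]
        congr 2
        push_cast
        ring
      rw [← h1]
      rfl
    have hp1 : ∀ k, propagate ℓ z a (.inl k) = 0 := fun k => by simp [propagate_apply, transit]
    have hp2 : ∀ m, propagate ℓ z a (.inr (.inl m)) =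
        Complex.exp (Complex.I * z * ℓ m) * a (.inr (.inr m)) := fun m => rfl
    have hp3 : ∀ m, propagate ℓ z a (.inr (.inr m)) =
        Complex.exp (Complex.I * z * ℓ m) * a (.inr (.inl m)) := fun m => rfl
    refine ⟨fun k => ?_, fun m => ?_, fun m => ?_, fun k => ?_, fun m => ?_, fun m => ?_⟩
    all_goals
      simp only [U, D, waveSum_eq, sum_edgeOf_lead, sum_edgeOf_edge, Pi.add_apply, Pi.mul_apply, outWave,
        endDist, endSign, hL0, hR0, hRl, hs1, hs2, hs3, hp1, hp2, hp3, sub_self, sub_zero,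
        Complex.ofReal_zero, mul_zero, Complex.exp_zero]
    · ring
    · ring
    · ring
    · field_simp
      linear_combination (J (.inl k)) * hI
    · field_simp
      linear_combination (J (.inr m)) * hI
    · field_simp
      linear_combination (-greenLeft z (h (.inr m)) (ℓ m)) * hI
  refine ⟨U, D, fun e => ?_, hamp.vertex_conditions (outAmplitude_eq_scatter G hℓ hz f)⟩
  obtain ⟨w, hw1, hw2⟩ := resolventFamily_apply G ℓ hz f e
  have h1 := isH2_green hℓ hz0 (J e) (fun a b => intervalIntegrable_indicator (f e) a b)
    (indicator_ae_eq (f e)) (kernelOp_left_ae_eq ℓ hz (f e)) (kernelOp_right_ae_eq ℓ hz (f e))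
  have h2 := h1.add (fun x hx => uIoc_subset_edgeSegment ℓ e hx)
    (isH2_waveSum hw2 (memLp_waveSum ℓ hz _ e))
  have h3 : edgeGreen ℓ univ z e (f e) =
      kernelOp _ _ (waveKernel leftRegion (fun q => q.1 - q.2) z) (f e) +
        kernelOp _ _ (waveKernel rightRegion (fun q => q.2 - q.1) z) (f e) := by
    simp only [edgeGreen, univ_prod_univ, inter_univ, add_apply]
  rw [← h3] at h2
  convert! h2 using 1
  rw [PiLp.add_apply, PiLp.smul_apply, hw1, smul_add]
  abel

/-- The explicit family is the resolvent in the upper half plane. -/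
theorem isResolvent_resolventFamily (G : LeadGraph V K M) {ℓ : M → ℝ} (hℓ : ∀ m, 0 < ℓ m)
    {z : ℂ} (hz : 0 < z.im) :
    IsResolvent (hamiltonian G ℓ) (z ^ 2) (resolventFamily G ℓ (fun _ => univ) z) := by
  classical
  set T := resolventFamily G ℓ (fun _ => univ) z with hT
  have hz0 : z ≠ 0 := by
    rintro rfl
    simp at hz
  have hgraph : ∀ f, (T f, f + z ^ 2 • T f) ∈ (hamiltonian G ℓ).graph := fun f =>
    (mem_graph_hamiltonian G ℓ _ _).2 (isNegLaplacian_resolventFamily G hℓ hz f)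
  constructor
  · intro f
    obtain ⟨h, h1⟩ := (LinearPMap.mem_graph_iff' _).1 (hgraph f)
    have h2 : (h : L2 K ℓ) = T f := congrArg Prod.fst h1
    have h3 : hamiltonian G ℓ h = f + z ^ 2 • T f := congrArg Prod.snd h1
    refine ⟨h2 ▸ h.2, ?_⟩
    have h4 : (⟨T f, h2 ▸ h.2⟩ : (hamiltonian G ℓ).domain) = h := Subtype.ext h2.symm
    rw [h4, h3]
    abel
  · intro u
    set f := hamiltonian G ℓ u - z ^ 2 • (u : L2 K ℓ) with hf
    -- The difference T f - u solves the homogeneous equation. If nonzero it would give a null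
    -- vector of the secular matrix, which is invertible for Im z > 0.
    by_contra hne
    have h1 := (hamiltonian G ℓ).graph.sub_mem (hgraph f) ((hamiltonian G ℓ).mem_graph u)
    rw [Prod.mk_sub_mk, mem_graph_hamiltonian] at h1
    have h2 : f + z ^ 2 • T f - hamiltonian G ℓ u = z ^ 2 • (T f - u) := by
      rw [hf, smul_sub]
      abel
    rw [h2] at h1
    obtain ⟨b, hb, hb0⟩ := exists_secular_eq_zero_of_eigenfunction hℓ hz0 hz.le
      (sub_ne_zero.2 hne) h1
    exact (isUnit_det_secular G hℓ hz).ne_zero (Matrix.exists_mulVec_eq_zero_iff.1 ⟨b, hb, hb0⟩)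

/-- The resolvent has a meromorphic continuation. -/
theorem isResolventContinuation_resolventFamily (G : LeadGraph V K M) {ℓ : M → ℝ}
    (hℓ : ∀ m, 0 < ℓ m) :
    IsResolventContinuation G ℓ fun r => resolventFamily G ℓ (truncatedSegment ℓ r) := by
  refine fun r _ => ⟨fun z _ => meromorphicAt_resolventFamily G ℓ ?_ z, fun z hz =>
    ⟨_, isResolvent_resolventFamily G hℓ hz, (truncation_comp_resolventFamily G ℓ r hz).symm⟩⟩
  rintro (k | m)
  · exact isCompact_Icc
  · exact isCompact_Icc

end ResolventIdentity

/-! ### Zeros of the secular determinant are poles. -/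

section Pole

theorem MeromorphicAt.clm_apply_const {E F : Type*} [NormedAddCommGroup E] [NormedSpace ℂ E]
    [NormedAddCommGroup F] [NormedSpace ℂ F] {f : ℂ → E} {x : ℂ} (hf : MeromorphicAt f x)
    (L : E →L[ℂ] F) : MeromorphicAt (fun z => L (f z)) x := by
  obtain ⟨n, hn⟩ := hf
  refine ⟨n, ?_⟩
  convert! (L.analyticAt _).comp hn using 1
  funext z
  simp

/-- A meromorphic family of operators taking `(z - μ) • q(μ)` to a vector with a fixed nonzero
component has a pole at `z`. -/
theorem meromorphicOrderAt_neg_of_quasimode {E F : Type*} [NormedAddCommGroup E] [NormedSpace ℂ E]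
    [NormedAddCommGroup F] [NormedSpace ℂ F] {R : ℂ → E →L[ℂ] E} (hR : ∀ x, MeromorphicAt R x)
    (L : E →L[ℂ] F) {q₀ q₁ q₂ : E} {w : F} (hw : w ≠ 0) {z : ℂ}
    (h : ∀ μ : ℂ, 0 < μ.im → L (R μ ((z - μ) • (q₀ + μ • q₁ + μ ^ 2 • q₂))) = w) :
    meromorphicOrderAt R z < 0 := by
  by_contra! hneg
  obtain ⟨T, hT⟩ := tendsto_nhds_of_meromorphicOrderAt_nonneg (hR z) hneg
  set Φ : ℂ → F := fun μ => L (R μ ((z - μ) • (q₀ + μ • q₁ + μ ^ 2 • q₂))) with hΦ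
  have heval : ∀ q, Meromorphic fun μ => L (R μ q) := fun q x =>
    MeromorphicAt.clm_apply_const (hR x) (L ∘L ContinuousLinearMap.apply ℂ E q)
  have hscalar : ∀ p : ℂ → ℂ, Differentiable ℂ p → Meromorphic p := fun p hp x =>
    (hp.analyticAt x).meromorphicAt
  have hmer : Meromorphic fun μ => Φ μ - w := by
    have h1 : (fun μ => Φ μ - w) = fun μ => (z - μ) • (L (R μ q₀) + μ • L (R μ q₁) +
        μ ^ 2 • L (R μ q₂)) - w := by
      funext μ
      simp only [hΦ, map_smul, map_add]
    rw [h1]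
    intro x
    refine MeromorphicAt.sub (MeromorphicAt.smul (hscalar _ (by fun_prop) x) ?_)
      (MeromorphicAt.const _ _)
    exact ((heval q₀ x).add (MeromorphicAt.smul (hscalar _ (by fun_prop) x) (heval q₁ x))).add
      (MeromorphicAt.smul (hscalar _ (by fun_prop) x) (heval q₂ x))
  -- Identity theorem: Φ - w is meromorphic on the connected plane and vanishes near i, hence has
  -- infinite order at every point.
  have htop : meromorphicOrderAt (fun μ => Φ μ - w) z = ⊤ := by
    by_contra hne
    refine hmer.exists_meromorphicOrderAt_ne_top_iff_forall.1 ⟨z, hne⟩ Complex.I ?_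
    rw [meromorphicOrderAt_eq_top_iff]
    refine eventually_nhdsWithin_of_eventually_nhds ?_
    filter_upwards [(isOpen_lt continuous_const Complex.continuous_im).mem_nhds
      (show (0 : ℝ) < Complex.I.im by simp)] with μ hμ
    exact sub_eq_zero.2 (h μ hμ)
  have hΦw : Tendsto Φ (𝓝[≠] z) (𝓝 w) := by
    refine tendsto_const_nhds.congr' ?_
    filter_upwards [meromorphicOrderAt_eq_top_iff.1 htop] with μ hμ
    exact (sub_eq_zero.1 hμ).symm
  -- Without a pole, R tends to the operator `T` at z while its argument tends to 0 through the
  -- factor z - μ.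
  have hΦ0 : Tendsto Φ (𝓝[≠] z) (𝓝 0) := by
    have h1 : Tendsto (fun μ : ℂ => (z - μ) • (q₀ + μ • q₁ + μ ^ 2 • q₂)) (𝓝[≠] z) (𝓝 0) := by
      have : Continuous fun μ : ℂ => (z - μ) • (q₀ + μ • q₁ + μ ^ 2 • q₂) := by fun_prop
      have h2 := (this.tendsto z).mono_left (nhdsWithin_le_nhds (s := {z}ᶜ))
      rwa [sub_self, zero_smul] at h2
    have h2 := (L.continuous.tendsto _).comp
      ((isBoundedBilinearMap_apply.continuous.tendsto (T, (0 : E))).comp (hT.prodMk_nhds h1))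
    rwa [map_zero, map_zero] at h2
  exact hw (tendsto_nhds_unique hΦw hΦ0)

/-- The function x times a bump equal to 1 near 0 changes the derivative at the base of a lead
without changing the value there. Vanishing beyond 1, it is unaffected by truncation at r = 1. -/
theorem exists_cutoff : ∃ h h' h'' : ℝ → ℂ, (∀ x, HasDerivAt h (h' x) x) ∧
    (∀ x, HasDerivAt h' (h'' x) x) ∧ Continuous h'' ∧ h 0 = 0 ∧ h' 0 = 1 ∧
    ∀ x, 1 < x → h x = 0 ∧ h' x = 0 ∧ h'' x = 0 := by
  let b : ContDiffBump (0 : ℝ) := ⟨1 / 2, 1, by norm_num, by norm_num⟩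
  set f : ℝ → ℝ := fun x => x * b x with hf
  have hsmooth : ContDiff ℝ 2 f := contDiff_id.mul (b.contDiff (n := 2))
  have hsmooth' : ContDiff ℝ 1 (deriv f) := by
    refine ContDiff.deriv' ?_
    exact hsmooth.of_le (by norm_num)
  have hd : ∀ x, HasDerivAt f (deriv f x) x := fun x =>
    ((hsmooth.differentiable (by norm_num)) x).hasDerivAt
  have hd' : ∀ x, HasDerivAt (deriv f) (deriv (deriv f) x) x := fun x =>
    ((hsmooth'.differentiable (by norm_num)) x).hasDerivAt
  have hzero : ∀ x, 1 < x → f =ᶠ[𝓝 x] 0 := by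
    intro x hx
    filter_upwards [Ioi_mem_nhds hx] with y hy
    have h1 : b.rOut ≤ dist y 0 := by
      rw [Real.dist_eq, sub_zero]
      exact (le_of_lt hy).trans (le_abs_self y)
    simp [hf, b.zero_of_le_dist h1]
  refine ⟨fun x => (f x : ℝ), fun x => (deriv f x : ℝ), fun x => (deriv (deriv f) x : ℝ),
    fun x => (hd x).ofReal_comp, fun x => (hd' x).ofReal_comp,
    Complex.continuous_ofReal.comp (hsmooth'.continuous_deriv le_rfl), by simp [hf], ?_, ?_⟩
  · have h1 : f =ᶠ[𝓝 0] id := by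
      filter_upwards [Metric.closedBall_mem_nhds (0 : ℝ) b.rIn_pos] with y hy
      simp [hf, b.one_of_mem_closedBall hy]
    simp [h1.deriv_eq]
  · intro x hx
    have h1 := hzero x hx
    have h2 : deriv f =ᶠ[𝓝 x] 0 := by
      simpa using h1.deriv
    have h3 : deriv (deriv f) =ᶠ[𝓝 x] 0 := by
      simpa using h2.deriv
    simp [h1.eq_of_nhds, h2.eq_of_nhds, h3.eq_of_nhds]

variable {V K M : Type*}

theorem indicator_truncatedSegment_ae_eq {ℓ : M → ℝ} {r : ℝ} {e : K ⊕ M} {φ : ℝ → ℂ}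
    (hr : ∀ x ∈ edgeSegment ℓ e, x ∉ truncatedSegment ℓ r e → φ x = 0) :
    (truncatedSegment ℓ r e).indicator φ =ᵐ[edgeMeasure ℓ e] φ := by
  filter_upwards [ae_restrict_mem (measurableSet_edgeSegment ℓ e)] with x hx
  by_cases h : x ∈ truncatedSegment ℓ r e
  · rw [indicator_of_mem h]
  · rw [indicator_of_notMem h, hr x hx h]

theorem memLp_of_truncated {ℓ : M → ℝ} {r : ℝ} {e : K ⊕ M} {φ : ℝ → ℂ} (hφ : Continuous φ)
    (hr : ∀ x ∈ edgeSegment ℓ e, x ∉ truncatedSegment ℓ r e → φ x = 0) :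
    MemLp φ 2 (edgeMeasure ℓ e) := by
  refine (memLp_congr_ae (indicator_truncatedSegment_ae_eq hr)).1 ?_
  have hc : IsCompact (truncatedSegment ℓ r e) := by
    cases e
    · exact isCompact_Icc
    · exact isCompact_Icc
  have h1 : MemLp φ 2 (volume.restrict (truncatedSegment ℓ r e)) := by
    obtain ⟨C, hC⟩ := hc.exists_bound_of_continuousOn hφ.continuousOn
    have : IsFiniteMeasure (volume.restrict (truncatedSegment ℓ r e)) :=
      ⟨by simpa using hc.measure_lt_top⟩
    exact MemLp.of_bound hφ.aestronglyMeasurable C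
      ((ae_restrict_mem (measurableSet_truncatedSegment ℓ r e)).mono hC)
  exact ((memLp_indicator_iff_restrict (measurableSet_truncatedSegment ℓ r e)).2 h1).mono_measure
    Measure.restrict_le_self

theorem exists_truncated {ℓ : M → ℝ} {r : ℝ} {φ : K ⊕ M → ℝ → ℂ} (hφ : ∀ e, Continuous (φ e))
    (hr : ∀ e, ∀ x ∈ edgeSegment ℓ e, x ∉ truncatedSegment ℓ r e → φ e x = 0) :
    ∃ q : L2 K ℓ, truncation ℓ r q = q ∧ ∀ e, q e =ᵐ[edgeMeasure ℓ e] φ e := by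
  have hq : ∀ e, (memLp_of_truncated (hφ e) (hr e)).toLp =ᵐ[edgeMeasure ℓ e] φ e := fun e =>
    MemLp.coeFn_toLp _
  refine ⟨WithLp.toLp 2 fun e => (memLp_of_truncated (hφ e) (hr e)).toLp, ?_, hq⟩
  ext1 e
  refine Lp.ext ((coeFn_indicatorLp _ (measurableSet_truncatedSegment ℓ r e) _).trans ?_)
  refine EventuallyEq.trans ?_ ((indicator_truncatedSegment_ae_eq (hr e)).trans (hq e).symm)
  filter_upwards [hq e] with x hx
  exact indicator_eq_indicator Iff.rfl hx

variable [Fintype K] [Fintype M]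

/-- The waves on the finite edges with the amplitudes of a null vector of the secular matrix extend,
for every `μ` in the upper half plane, to an approximate solution of `(P - μ²) u = 0`, with an error
that vanishes at `μ = z`. -/
theorem exists_quasimode {G : LeadGraph V K M} {ℓ : M → ℝ} {z : ℂ} {a : EdgeEnd K M → ℂ}
    (ha : (secular G ℓ z).mulVec a = 0) :
    ∃ w : L2 K ℓ, (∀ m, w (.inr m) =ᵐ[edgeMeasure ℓ (.inr m : K ⊕ M)] waveSum ℓ z a (.inr m)) ∧
      ∃ q₀ q₁ q₂ : L2 K ℓ, truncation ℓ 1 q₀ = q₀ ∧ truncation ℓ 1 q₁ = q₁ ∧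
      truncation ℓ 1 q₂ = q₂ ∧ ∀ μ : ℂ, 0 < μ.im → ∃ u : L2 K ℓ, (∀ m, u (.inr m) = w (.inr m)) ∧
        IsNegLaplacian G ℓ u (μ ^ 2 • u + (z - μ) • (q₀ + μ • q₁ + μ ^ 2 • q₂)) := by
  obtain ⟨h, h', h'', hh, hh', hc, h0, h0', hsupp⟩ := exists_cutoff
  have hch : Continuous h := continuous_iff_continuousAt.2 fun x => (hh x).continuousAt
  have hch' : Continuous h' := continuous_iff_continuousAt.2 fun x => (hh' x).continuousAt
  have hcw : ∀ (b : EdgeEnd K M → ℂ) e, Continuous (waveSum ℓ z b e) := continuous_waveSum ℓ z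
  have hfar : ∀ {k : K} {x : ℝ}, x ∈ edgeSegment ℓ (.inl k : K ⊕ M) →
      x ∉ truncatedSegment ℓ 1 (.inl k : K ⊕ M) → 1 < x := by
    intro k x hx hx'
    by_contra! hle
    exact hx' ⟨hx, hle⟩
  have hnear : ∀ {m : M} {x : ℝ}, x ∈ edgeSegment ℓ (.inr m : K ⊕ M) →
      x ∉ truncatedSegment ℓ 1 (.inr m : K ⊕ M) → False := fun hx hx' => hx' hx
  have htrunc : ∀ (φ : K ⊕ M → ℝ → ℂ), (∀ e, Continuous (φ e)) →
      (∀ k x, 1 < x → φ (.inl k) x = 0) →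
      ∃ q : L2 K ℓ, truncation ℓ 1 q = q ∧ ∀ e, q e =ᵐ[edgeMeasure ℓ e] φ e := by
    intro φ hφ hk
    refine exists_truncated hφ ?_
    rintro (k | m) x hx hx'
    · exact hk k x (hfar hx hx')
    · exact (hnear hx hx').elim
  -- The coefficients of the error after dividing by z - μ. On a finite edge z² - μ² = (z - μ)(z +
  -- μ) gives zw + μw; on a lead the correction i(z - μ)h contributes -ia(h'' + μ²h).
  let Q₀ : K ⊕ M → ℝ → ℂ := Sum.elim (fun k x => -Complex.I * a (.inl k) * h'' x)
    fun m x => z * waveSum ℓ z a (.inr m) x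
  let Q₁ : K ⊕ M → ℝ → ℂ := Sum.elim (fun _ _ => 0) fun m x => waveSum ℓ z a (.inr m) x
  let Q₂ : K ⊕ M → ℝ → ℂ := Sum.elim (fun k x => -Complex.I * a (.inl k) * h x) fun _ _ => 0
  obtain ⟨q₀, hq₀, hq₀'⟩ := htrunc Q₀ (by
    rintro (k | m)
    · exact continuous_const.mul hc
    · exact continuous_const.mul (hcw a _)) fun k x hx => by simp [Q₀, (hsupp x hx).2.2]
  obtain ⟨q₁, hq₁, hq₁'⟩ := htrunc Q₁ (by
    rintro (k | m)
    · exact continuous_const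
    · exact hcw a _) fun k x hx => rfl
  obtain ⟨q₂, hq₂, hq₂'⟩ := htrunc Q₂ (by
    rintro (k | m)
    · exact continuous_const.mul hch
    · exact continuous_const) fun k x hx => by simp [Q₂, (hsupp x hx).1]
  -- On the finite edges `q₁` already is the wave, so it also serves as the fixed profile.
  refine ⟨q₁, fun m => hq₁' (.inr m), q₀, q₁, q₂, hq₀, hq₁, hq₂, fun μ hμ => ?_⟩
  -- The outgoing wave e^(izx) need not be square integrable, so e^(iμx) replaces it on the leads.
  -- The cutoff term restores the slope at 0, since iμ + i(z - μ) = iz, and the vertex conditions at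
  -- z persist.
  let U : K ⊕ M → ℝ → ℂ := Sum.elim (fun k x => a (.inl k) *
    (Complex.exp (Complex.I * μ * x) + Complex.I * (z - μ) * h x))
    fun m x => waveSum ℓ z a (.inr m) x
  let D : K ⊕ M → ℝ → ℂ := Sum.elim (fun k x => a (.inl k) *
    (Complex.I * μ * Complex.exp (Complex.I * μ * x) + Complex.I * (z - μ) * h' x))
    fun m x => Complex.I * z * waveSum ℓ z (endSign * a) (.inr m) x
  let W : K ⊕ M → ℝ → ℂ := Sum.elim (fun k x => a (.inl k) *
    (-μ ^ 2 * Complex.exp (Complex.I * μ * x) + Complex.I * (z - μ) * h'' x))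
    fun m x => -z ^ 2 * waveSum ℓ z a (.inr m) x
  have hexp : ∀ x : ℝ, HasDerivAt (fun x : ℝ => Complex.exp (Complex.I * μ * x))
      (Complex.I * μ * Complex.exp (Complex.I * μ * x)) x := fun x =>
    hasDerivAt_exp_mul (Complex.I * μ) x
  have hUD : ∀ e x, HasDerivAt (U e) (D e x) x := by
    rintro (k | m) x
    · exact ((hexp x).add ((hh x).const_mul _)).const_mul _
    · exact hasDerivAt_waveSum ℓ z a (.inr m) x
  have hDW : ∀ e x, HasDerivAt (D e) (W e x) x := by
    rintro (k | m) x
    · convert! (((hexp x).const_mul (Complex.I * μ)).add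
        ((hh' x).const_mul (Complex.I * (z - μ)))).const_mul (a (.inl k)) using 1
      simp only [W, Sum.elim_inl]
      linear_combination (-a (.inl k) * μ ^ 2 * Complex.exp (Complex.I * μ * x)) * Complex.I_sq
    · convert! (hasDerivAt_waveSum ℓ z (endSign * a) (.inr m) x).const_mul (Complex.I * z) using 1
      have h1 : endSign * (endSign * a) = a := by
        funext d
        rw [Pi.mul_apply, Pi.mul_apply, ← mul_assoc, endSign_mul_self, one_mul]
      simp only [W, Sum.elim_inr, h1]
      linear_combination (-z ^ 2 * waveSum ℓ z a (.inr m) x) * Complex.I_sq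
  have hW : ∀ e, Continuous (W e) := by
    rintro (k | m)
    · simp only [W, Sum.elim_inl]
      fun_prop
    · exact continuous_const.mul (hcw a _)
  have hmem : ∀ (k : K) (c c' : ℂ) {φ : ℝ → ℂ}, Continuous φ → (∀ x, 1 < x → φ x = 0) →
      MemLp (fun x : ℝ => c * Complex.exp (Complex.I * μ * x) + c' * φ x) 2
        (edgeMeasure ℓ (.inl k : K ⊕ M)) := fun k c c' φ hφ hx =>
    ((memLp_exp ℓ hμ _).const_mul c).add ((memLp_of_truncated hφ
      fun x h1 h2 => hx x (hfar h1 h2)).const_mul c')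
  have hUm : ∀ e, MemLp (U e) 2 (edgeMeasure ℓ e) := by
    rintro (k | m)
    · have h1 := (hmem k 1 (Complex.I * (z - μ)) hch fun x hx => (hsupp x hx).1).const_mul
        (a (.inl k))
      simp only [one_mul] at h1
      exact h1
    · exact memLp_of_truncated (r := 1) (hcw a _) fun x h1 h2 => (hnear h1 h2).elim
  have hDm : ∀ e, MemLp (D e) 2 (edgeMeasure ℓ e) := by
    rintro (k | m)
    · exact (hmem k _ _ hch' fun x hx => (hsupp x hx).2.1).const_mul (a (.inl k))
    · exact (memLp_of_truncated (r := 1) (hcw (endSign * a) _)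
        fun x h1 h2 => (hnear h1 h2).elim).const_mul _
  have hamp : HasAmplitudes ℓ z U D a (propagate ℓ z a) := by
    have hp1 : ∀ k, propagate ℓ z a (.inl k) = 0 := fun k => by simp [propagate_apply, transit]
    have hp2 : ∀ m, propagate ℓ z a (.inr (.inl m)) =
        Complex.exp (Complex.I * z * ℓ m) * a (.inr (.inr m)) := fun m => rfl
    have hp3 : ∀ m, propagate ℓ z a (.inr (.inr m)) =
        Complex.exp (Complex.I * z * ℓ m) * a (.inr (.inl m)) := fun m => rfl
    refine ⟨fun k => ?_, fun m => ?_, fun m => ?_, fun k => ?_, fun m => ?_, fun m => ?_⟩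
    all_goals
      simp only [U, D, Sum.elim_inl, Sum.elim_inr, h0, h0', waveSum_eq, sum_edgeOf_edge,
        Pi.mul_apply, outWave, endDist, endSign, hp1, hp2, hp3, sub_self, sub_zero,
        Complex.ofReal_zero, mul_zero, Complex.exp_zero]
      ring
  obtain ⟨u, hue⟩ : ∃ u : L2 K ℓ, ∀ e, u e =ᵐ[edgeMeasure ℓ e] U e :=
    ⟨WithLp.toLp 2 fun e => (hUm e).toLp, fun e => MemLp.coeFn_toLp (hUm e)⟩
  refine ⟨u, fun m => Lp.ext ((hue (.inr m)).trans (hq₁' (.inr m)).symm), U, D, fun e => ?_,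
    hamp.vertex_conditions (secular_mulVec_eq_zero_iff.1 ha)⟩
  refine IsH2.of_hasDerivAt (hue e) ?_ (hUD e) (hDW e) (hW e) (hDm e)
  have hf : (μ ^ 2 • u + (z - μ) • (q₀ + μ • q₁ + μ ^ 2 • q₂)) e =
      μ ^ 2 • u e + (z - μ) • (q₀ e + μ • q₁ e + μ ^ 2 • q₂ e) := rfl
  rw [hf]
  filter_upwards [Lp.coeFn_neg (μ ^ 2 • u e + (z - μ) • (q₀ e + μ • q₁ e + μ ^ 2 • q₂ e)),
    Lp.coeFn_add (μ ^ 2 • u e) ((z - μ) • (q₀ e + μ • q₁ e + μ ^ 2 • q₂ e)),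
    Lp.coeFn_smul (μ ^ 2) (u e), Lp.coeFn_smul (z - μ) (q₀ e + μ • q₁ e + μ ^ 2 • q₂ e),
    Lp.coeFn_add (q₀ e + μ • q₁ e) (μ ^ 2 • q₂ e), Lp.coeFn_add (q₀ e) (μ • q₁ e),
    Lp.coeFn_smul μ (q₁ e), Lp.coeFn_smul (μ ^ 2) (q₂ e), hue e, hq₀' e, hq₁' e, hq₂' e]
    with x h1 h2 h3 h4 h5 h6 h7 h8 h9 h10 h11 h12
  rw [h1, Pi.neg_apply, h2, Pi.add_apply, h3, h4, Pi.smul_apply, Pi.smul_apply, h5, Pi.add_apply,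
    h6, Pi.add_apply, h7, h8, Pi.smul_apply, Pi.smul_apply, h9, h10, h11, h12]
  simp only [smul_eq_mul]
  rcases e with k | m
  · simp only [U, W, Q₀, Q₁, Q₂, Sum.elim_inl]
    ring
  · simp only [U, W, Q₀, Q₁, Q₂, Sum.elim_inr]
    ring

/-- A nontrivial null vector of the secular matrix has a nonzero wave on some finite edge. -/
theorem exists_waveSum_ne_zero {G : LeadGraph V K M} {ℓ : M → ℝ} (hℓ : ∀ m, 0 < ℓ m) {z : ℂ}
    (hz : z ≠ 0) {a : EdgeEnd K M → ℂ} (ha : (secular G ℓ z).mulVec a = 0) (ha0 : a ≠ 0) :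
    ∃ m, ¬ waveSum ℓ z a (.inr m) =ᵐ[edgeMeasure ℓ (.inr m : K ⊕ M)] 0 := by
  by_contra! hcon
  -- At the midpoint both the function and its derivative vanish, giving the sum and the difference
  -- of the two waves; z ≠ 0 is needed for the latter.
  have hfin : ∀ m, a (.inr (.inl m)) = 0 ∧ a (.inr (.inr m)) = 0 := by
    intro m
    have h1 : EqOn (waveSum ℓ z a (.inr m)) 0 (Icc 0 (ℓ m)) :=
      Measure.eqOn_Icc_of_ae_eq volume (hℓ m).ne (hcon m)
        (continuous_waveSum ℓ z a _).continuousOn continuousOn_const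
    have hx : ℓ m / 2 ∈ Ioo 0 (ℓ m) := ⟨half_pos (hℓ m), half_lt_self (hℓ m)⟩
    have h2 : HasDerivAt (waveSum ℓ z a (.inr m)) 0 (ℓ m / 2) := by
      refine (hasDerivAt_const (ℓ m / 2) (0 : ℂ)).congr_of_eventuallyEq ?_
      filter_upwards [Ioo_mem_nhds hx.1 hx.2] with y hy
      exact h1 ⟨hy.1.le, hy.2.le⟩
    have h3 := (hasDerivAt_waveSum ℓ z a (.inr m) (ℓ m / 2)).unique h2
    have h4 := h1 ⟨hx.1.le, hx.2.le⟩
    have h5 := (mul_eq_zero.1 h3).resolve_left (mul_ne_zero Complex.I_ne_zero hz)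
    rw [waveSum_eq, sum_edgeOf_edge] at h4 h5
    simp only [Pi.mul_apply, endSign, Pi.zero_apply] at h4 h5
    have hE : ∀ d, outWave ℓ z d (ℓ m / 2) ≠ 0 := fun d : EdgeEnd K M => Complex.exp_ne_zero _
    refine ⟨(mul_eq_zero.1 ?_).resolve_right (hE (.inr (.inl m))),
      (mul_eq_zero.1 ?_).resolve_right (hE (.inr (.inr m)))⟩
    · linear_combination (h4 + h5) / 2
    · linear_combination (h4 - h5) / 2
  -- Nothing arrives from the leads, so silent finite edges mean no incoming amplitude anywhere, and
  -- the lead amplitudes vanish as well.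
  have hp : propagate ℓ z a = 0 := by
    funext d
    rw [propagate_apply]
    rcases d with k | m | m
    · simp [transit]
    · simp [oppositeEnd, (hfin m).2]
    · simp [oppositeEnd, (hfin m).1]
  apply ha0
  rw [secular_mulVec_eq_zero_iff.1 ha, hp, map_zero]

/-- The nonzero zeros of the secular determinant are resonances. -/
theorem mem_resonances {G : LeadGraph V K M} {ℓ : M → ℝ} (hℓ : ∀ m, 0 < ℓ m) {z : ℂ} (hz : z ≠ 0)
    {a : EdgeEnd K M → ℂ} (ha0 : a ≠ 0) (ha : (secular G ℓ z).mulVec a = 0) :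
    z ∈ resonances G ℓ := by
  have hR := isResolventContinuation_resolventFamily G hℓ
  refine ⟨_, hR, 1, one_pos, ?_⟩
  obtain ⟨hmer, hres⟩ := hR 1 one_pos
  obtain ⟨m, hm⟩ := exists_waveSum_ne_zero hℓ hz ha ha0
  obtain ⟨w, hw, q₀, q₁, q₂, hq₀, hq₁, hq₂, hu⟩ := exists_quasimode ha
  have hw0 : w (.inr m) ≠ 0 := by
    intro h0
    refine hm ((hw m).symm.trans ?_)
    rw [h0]
    exact Lp.coeFn_zero _ _ _
  refine meromorphicOrderAt_neg_of_quasimode (fun x => hmer x (mem_univ x)) (edgeProj ℓ (.inr m))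
    (q₀ := q₀) (q₁ := q₁) (q₂ := q₂) hw0 fun μ hμ => ?_
  obtain ⟨u, hum, hlap⟩ := hu μ hμ
  obtain ⟨T, ⟨-, hT⟩, hRT⟩ := hres μ hμ
  rw [← mem_graph_hamiltonian] at hlap
  obtain ⟨v, hv⟩ := ((hamiltonian G ℓ).mem_graph_iff').1 hlap
  have h1 : (v : L2 K ℓ) = u := congrArg Prod.fst hv
  have h2 : hamiltonian G ℓ v = μ ^ 2 • u + (z - μ) • (q₀ + μ • q₁ + μ ^ 2 • q₂) :=
    congrArg Prod.snd hv
  have h3 := hT v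
  rw [h1, h2, add_sub_cancel_left] at h3
  -- The error is unchanged by truncation, so the truncated resolvent returns the truncation of u,
  -- which on the finite edges is u itself.
  have h4 : truncation ℓ 1 ((z - μ) • (q₀ + μ • q₁ + μ ^ 2 • q₂)) =
      (z - μ) • (q₀ + μ • q₁ + μ ^ 2 • q₂) := by
    simp only [map_smul, map_add, hq₀, hq₁, hq₂]
  rw [hRT, ContinuousLinearMap.comp_apply, ContinuousLinearMap.comp_apply, h4, h3,
    edgeProj_truncation, edgeProj_apply, hum, ← hum m]
  refine Lp.ext ((coeFn_indicatorLp _ (measurableSet_truncatedSegment ℓ 1 (.inr m)) _).trans ?_)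
  exact indicator_truncatedSegment_ae_eq fun x hx hx' => (hx' hx).elim

end Pole

end QuantumGraph

end

/-! ### Conclusion. -/

theorem mainTheorem7 {V K M : Type*} [Finite V] [Fintype K] [Fintype M] [Nonempty K]
    (G : QuantumGraph.LeadGraph V K M) (ℓ : M → ℝ → ℝ) (hℓ : ∀ m, ContDiff ℝ 1 (ℓ m))
    (hpos : ∀ m, 0 < ℓ m 0) (lam₀ : ℝ) (hlam₀ : 0 < lam₀)
    (heig : QuantumGraph.IsEigenvalue (QuantumGraph.hamiltonian G fun m => ℓ m 0)
      ((lam₀ : ℂ) ^ 2))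
    (γ : ℝ) (hγ : γ < 1) :
    ∃ t₀ : ℝ, 0 < t₀ ∧ ∀ t : ℝ, 0 < |t| → |t| ≤ t₀ →
      (∀ m, 0 < ℓ m t) ∧
      (QuantumGraph.resonances G (fun m => ℓ m t) ∩
        Metric.ball (lam₀ : ℂ) (|t| ^ γ)).Nonempty := by
  obtain ⟨u, hu0, hu⟩ := heig
  have hlap := (QuantumGraph.hamiltonian G fun m => ℓ m 0).mem_graph u
  rw [hu, QuantumGraph.mem_graph_hamiltonian] at hlap
  obtain ⟨a, ha0, ha⟩ := QuantumGraph.exists_secular_eq_zero_of_eigenfunction hpos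
    (Complex.ofReal_ne_zero.2 hlam₀.ne') (Complex.ofReal_im lam₀).ge hu0 hlap
  have hzero := QuantumGraph.exists_secular_zero_near G
    (fun m => ((hℓ m).differentiable one_ne_zero).differentiableAt) hpos hlam₀ ⟨a, ha0, ha⟩ hγ
  have hpos' : ∀ᶠ t in 𝓝 (0 : ℝ), ∀ m, 0 < ℓ m t :=
    eventually_all.2 fun m => (hℓ m).continuous.continuousAt.eventually (Ioi_mem_nhds (hpos m))
  obtain ⟨ε, hε, hball⟩ := Metric.eventually_nhds_iff.1
    (hpos'.and (eventually_nhdsWithin_iff.1 hzero))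
  -- Half the radius, because |t| = t₀ is allowed whereas the neighbourhood is an open ball.
  refine ⟨ε / 2, half_pos hε, fun t ht ht' => ?_⟩
  obtain ⟨h1, h2⟩ := hball (show dist t 0 < ε by
    rw [Real.dist_eq, sub_zero]
    linarith)
  obtain ⟨z, hz, hz0, b, hb0, hb⟩ := h2 (abs_pos.1 ht)
  exact ⟨h1, z, QuantumGraph.mem_resonances h1 hz0 hb0 hb, by rwa [mem_ball_iff_norm]⟩
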